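/- Let $d=n+1$ with $n\ge 1$, let $m>0$, and let $xy=x_0y_0-\sum_{i=1}^n x_iy_i$ be the Lorentzian scalar product on $\mathbb R^d$. Let $\omega_{\mathbf p}=\sqrt{m^2+|\mathbf p|^2}$, $\mathscr H_1=L^2(\mathbb R^n, d^n\mathbf p/(2\omega_{\mathbf p}))$, and let $\mathscr H$ be the bosonic Fock space over $\mathscr H_1$, with $a^*(h)$ (linear in $h$) the creation operators and $a(g)=a^*(g)^*$ the annihilation operators (antilinear in $g$), on the vectors of finite particle number. For $f\in\mathscr S(\mathbb R^d)$ put $f^{\pm}(\mathbf p)=\int dx\, f(x)e^{\pm ipx}$ with $p=(\omega_{\mathbf p},\mathbf p)$, and let $\phi(f)=a(\overline{f^-})+a^*(f^+)$ be the free scalar field of mass $m$. Let $\Delta(P)$ be the space of all $h\in\mathscr H_1$ such that $(\mathbf p^2)^r h(\mathbf p)$ is (essentially) bounded for $r=0,1,2,\dots$, let $\Delta_k(P)$, $k=0,1,2,\dots$, be the space of symmetric vectors in the algebraic tensor product $\Delta(P)^{\otimes k}$, and let $P_\mu$ be the second quantized momentum operators on the span of all $\Delta_k(P)$. Let $V$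 be any unitary operator on $\mathscr H_1$, $\Gamma(V)=\bigoplus_k V^{\otimes k}$, $X_\mu=\Gamma(V^{-1})P_\mu\Gamma(V)$ and $\Delta_k(X)=\Gamma(V^{-1})\Delta_k(P)$. Let $\theta$ be a real $d\times d$ matrix that is skew-symmetric with respect to the Lorentzian scalar product. For $Q=P$ or $Q=X$, the exponentials $W_Q(y)=e^{iy_\mu Q^\mu}$ exist as a strongly continuous unitary group of $\mathbb R^d$ (on the domain of $Q_\mu$, the derivative at $0$ in the direction $\mu$ is $iQ_\mu$). For an operator $A$ on $\mathscr H$, the deformed operator is $$A_{\theta,Q}\Psi=(2\pi)^{-d}\lim_{\varepsilon\to0}\iint dx\,dy\,e^{-ixy}\,\chi(\varepsilon x,\varepsilon y)\,W_Q(\theta x)\,A\,W_Q(\theta x)^{-1}\,W_Q(y)\Psi ,$$ where $\chi\in\mathscr S(\mathbb R^d\times\mathbb R^d)$ with $\chi(0,0)=1$; it is called well defined at $\Psi$ if all vectors $W_Q(\theta x)^{-1}W_Q(y)\Psi$ lie in the domain of $A$ and, for every such $\chi$, the integrals converge absolutely for $\varepsilon\neq0$ and the limit exists and does not depend on $\chi$.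 Put $\phi_{\theta,X}(f)=\phi(f)_{\theta,X}$ and $$\phi(Vf):=a\bigl(V\overline{f^-}\bigr)+a^*\bigl(Vf^+\bigr).$$ Then $\phi(Vf)=\Gamma(V)\phi(f)\Gamma(V^{-1})$, and for every $k$ and every $\Psi_k\in\Delta_k(X)$ the deformed operators $\phi_{\theta,X}(f)$ and $\phi(Vf)_{\theta,P}$ are well defined at $\Psi_k$ and at $\Gamma(V)\Psi_k$ respectively, and $$\phi_{\theta,X}(f)\,\Psi_k=\Gamma(V^{-1})\,\phi(Vf)_{\theta,P}\,\Gamma(V)\,\Psi_k .$$ -/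

import Mathlib

open MeasureTheory Filter Topology
open scoped ENNReal ComplexConjugate SchwartzMap

noncomputable section

namespace Fockspace

/-- `L²` of `k` particles (no symmetry imposed), realised as functions of `k` variables. -/
abbrev NPart {α : Type*} [MeasurableSpace α] (μ : Measure α) (k : ℕ) : Type _ :=
  Lp ℂ 2 (Measure.pi (fun _ : Fin k => μ))

theorem memLp_tensor {α : Type*} [MeasurableSpace α] (μ : Measure α) [SigmaFinite μ] {k : ℕ}
    (h : Fin k → Lp ℂ 2 μ) :
    MemLp (fun p : Fin k → α => ∏ i, h i (p i)) 2 (Measure.pi (fun _ : Fin k => μ)) := by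
  have hm : AEStronglyMeasurable (fun p : Fin k → α => ∏ i, h i (p i))
      (Measure.pi (fun _ : Fin k => μ)) := by
    refine Finset.aestronglyMeasurable_fun_prod _ fun i _ => ?_
    exact (Lp.aestronglyMeasurable (h i)).comp_quasiMeasurePreserving
      (Measure.quasiMeasurePreserving_eval (fun _ : Fin k => μ) i)
  rw [memLp_two_iff_integrable_sq_norm hm]
  have : (fun p : Fin k → α => ‖∏ i, h i (p i)‖ ^ 2) = fun p => ∏ i, ‖h i (p i)‖ ^ 2 := by
    ext p
    rw [norm_prod, Finset.prod_pow]
  rw [this]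
  exact Integrable.fintype_prod (f := fun i x => ‖h i x‖ ^ 2)
    fun i => (memLp_two_iff_integrable_sq_norm (Lp.aestronglyMeasurable (h i))).1 (Lp.memLp (h i))

/-- The elementary tensor `h₁ ⊗ ⋯ ⊗ h_k`, i.e. the function `p ↦ ∏ i, h i (p i)`. -/
def tensor {α : Type*} [MeasurableSpace α] (μ : Measure α) [SigmaFinite μ] {k : ℕ}
    (h : Fin k → Lp ℂ 2 μ) : NPart μ k :=
  (memLp_tensor μ h).toLp

theorem inner_tensor {α : Type*} [MeasurableSpace α] (μ : Measure α) [SigmaFinite μ] {k : ℕ}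
    (g h : Fin k → Lp ℂ 2 μ) :
    inner ℂ (tensor μ g) (tensor μ h) = ∏ i, inner ℂ (g i) (h i) := by
  simp only [L2.inner_def]
  rw [← integral_fintype_prod_eq_prod (f := fun i x => inner ℂ (g i x) (h i x))]
  refine integral_congr_ae ?_
  filter_upwards [(memLp_tensor μ g).coeFn_toLp, (memLp_tensor μ h).coeFn_toLp] with p h1 h2
  unfold tensor
  rw [h1, h2]
  simp [Finset.prod_mul_distrib]

theorem eq_zero_of_inner_tensor {α : Type*} [MeasurableSpace α] (μ : Measure α) [SigmaFinite μ]
    {k : ℕ} (f : NPart μ k) (hf : ∀ h : Fin k → Lp ℂ 2 μ, inner ℂ (tensor μ h) f = 0) : f = 0 := by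
  set ν := Measure.pi (fun _ : Fin k => μ) with hν
  set B : ℕ → Set (Fin k → α) := fun j => Set.univ.pi fun _ => spanningSets μ j with hB
  have hBm : ∀ j, MeasurableSet (B j) := fun j =>
    MeasurableSet.univ_pi fun _ => measurableSet_spanningSets μ j
  have hrect : ∀ j (A : Fin k → Set α), (∀ i, MeasurableSet (A i)) →
      ∫ p in Set.univ.pi A, f p ∂(ν.restrict (B j)) = 0 := by
    intro j A hA
    have hAm : ∀ i, MeasurableSet (A i ∩ spanningSets μ j) := fun i =>
      (hA i).inter (measurableSet_spanningSets μ j)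
    have hAf : ∀ i, μ (A i ∩ spanningSets μ j) ≠ ∞ := fun i =>
      ((measure_mono Set.inter_subset_right).trans_lt (measure_spanningSets_lt_top μ j)).ne
    have key := hf fun i => indicatorConstLp 2 (hAm i) (hAf i) (1 : ℂ)
    rw [Measure.restrict_restrict (MeasurableSet.univ_pi hA), hB, ← Set.pi_inter_distrib,
      ← integral_indicator (MeasurableSet.univ_pi hAm), ← key, L2.inner_def]
    refine integral_congr_ae ?_
    have hall : ∀ᵐ p ∂ν, ∀ i, indicatorConstLp 2 (hAm i) (hAf i) (1 : ℂ) (p i)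
        = (A i ∩ spanningSets μ j).indicator (fun _ => (1 : ℂ)) (p i) := by
      rw [ae_all_iff]
      intro i
      exact (Measure.quasiMeasurePreserving_eval (fun _ : Fin k => μ) i).ae
        (indicatorConstLp_coeFn (p := 2) (hs := hAm i) (hμs := hAf i) (c := (1 : ℂ)))
    filter_upwards [hall, (memLp_tensor μ fun i =>
      indicatorConstLp 2 (hAm i) (hAf i) (1 : ℂ)).coeFn_toLp] with p h1 h2
    unfold tensor
    rw [h2]
    simp only [h1]
    by_cases hp : p ∈ Set.univ.pi fun i => A i ∩ spanningSets μ j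
    · rw [Set.indicator_of_mem hp]
      have : ∀ i, (A i ∩ spanningSets μ j).indicator (fun _ => (1 : ℂ)) (p i) = 1 := fun i =>
        Set.indicator_of_mem (hp i trivial) _
      simp [this]
    · rw [Set.indicator_of_notMem hp]
      obtain ⟨i, hi⟩ : ∃ i, p i ∉ A i ∩ spanningSets μ j := by
        by_contra hcon
        push Not at hcon
        exact hp fun i _ => hcon i
      have : ∏ i, (A i ∩ spanningSets μ j).indicator (fun _ => (1 : ℂ)) (p i) = 0 :=
        Finset.prod_eq_zero (Finset.mem_univ i) (Set.indicator_of_notMem hi _)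
      simp [this]
  have hBfin : ∀ j, ν (B j) < ∞ := fun j => by
    rw [hν, hB, Measure.pi_pi]
    exact ENNReal.prod_lt_top fun i _ => measure_spanningSets_lt_top μ j
  have hint : ∀ j, Integrable f (ν.restrict (B j)) := fun j =>
    integrableOn_Lp_of_measure_ne_top f fact_one_le_two_ennreal.elim (hBfin j).ne
  have hall : ∀ j, ∀ t, MeasurableSet t → ∫ p in t, f p ∂(ν.restrict (B j)) = 0 := by
    intro j
    refine MeasurableSpace.induction_on_inter generateFrom_pi.symm isPiSystem_pi ?_ ?_ ?_ ?_
    · simp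
    · rintro t ⟨A, hA, rfl⟩
      exact hrect j A fun i => hA i trivial
    · intro t ht h0
      have h1 := integral_add_compl ht (hint j)
      have h2 := hrect j (fun _ => Set.univ) fun _ => MeasurableSet.univ
      rw [Set.pi_univ, setIntegral_univ] at h2
      rwa [h0, h2, zero_add] at h1
    · intro s hd hm h0
      rw [integral_iUnion hm hd (hint j).integrableOn]
      simp [h0]
  have hz : ∀ j, f =ᵐ[ν.restrict (B j)] 0 := fun j =>
    (hint j).ae_eq_zero_of_forall_setIntegral_eq_zero fun t ht _ => hall j t ht
  have hU : ⋃ j, B j = Set.univ := by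
    refine Set.eq_univ_of_forall fun p => ?_
    rw [Set.mem_iUnion]
    have : ∀ i, ∃ j, p i ∈ spanningSets μ j := fun i => by
      have := Set.mem_univ (p i)
      rwa [← iUnion_spanningSets μ, Set.mem_iUnion] at this
    choose J hJ using this
    refine ⟨Finset.univ.sup J, fun i _ => monotone_spanningSets μ ?_ (hJ i)⟩
    exact Finset.le_sup (Finset.mem_univ i)
  have hfin : f =ᵐ[ν] 0 := by
    have : ∀ᵐ p ∂(ν.restrict (⋃ j, B j)), f p = 0 := by
      rw [ae_restrict_iUnion_iff]
      exact hz
    rwa [hU, Measure.restrict_univ] at this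
  exact (Lp.eq_zero_iff_ae_eq_zero).2 hfin

/-- Finite linear combinations of elementary tensors. -/
def tensorSum {α : Type*} [MeasurableSpace α] (μ : Measure α) [SigmaFinite μ] (k : ℕ) :
    ((Fin k → Lp ℂ 2 μ) →₀ ℂ) →ₗ[ℂ] NPart μ k :=
  Finsupp.linearCombination ℂ (tensor μ)

theorem denseRange_tensorSum {α : Type*} [MeasurableSpace α] (μ : Measure α) [SigmaFinite μ]
    (k : ℕ) : DenseRange (tensorSum μ k) := by
  have h : (LinearMap.range (tensorSum μ k)).topologicalClosure = ⊤ := by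
    rw [Submodule.topologicalClosure_eq_top_iff, Submodule.eq_bot_iff]
    intro f hf
    refine eq_zero_of_inner_tensor μ f fun g => ?_
    rw [Submodule.mem_orthogonal] at hf
    exact hf _ ⟨Finsupp.single g 1, by simp [tensorSum]⟩
  have h2 := (Submodule.dense_iff_topologicalClosure_eq_top).2 h
  exact h2

/-- The relabelling `h₁, …, h_k ↦ V h₁, …, V h_k` on formal linear combinations. -/
def relabel {α : Type*} [MeasurableSpace α] (μ : Measure α)
    (V : Lp ℂ 2 μ ≃ₗᵢ[ℂ] Lp ℂ 2 μ) (k : ℕ) :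
    ((Fin k → Lp ℂ 2 μ) →₀ ℂ) ≃ₗ[ℂ] ((Fin k → Lp ℂ 2 μ) →₀ ℂ) :=
  Finsupp.domLCongr (Equiv.piCongrRight fun _ => V.toEquiv)

theorem norm_tensorSum_relabel {α : Type*} [MeasurableSpace α] (μ : Measure α) [SigmaFinite μ]
    (V : Lp ℂ 2 μ ≃ₗᵢ[ℂ] Lp ℂ 2 μ) (k : ℕ) (x : (Fin k → Lp ℂ 2 μ) →₀ ℂ) :
    ‖tensorSum μ k (relabel μ V k x)‖ = ‖tensorSum μ k x‖ := by
  have key : ∀ x y, inner ℂ (tensorSum μ k (relabel μ V k x)) (tensorSum μ k (relabel μ V k y))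
      = inner ℂ (tensorSum μ k x) (tensorSum μ k y) := by
    intro x y
    induction x using Finsupp.induction_linear with
    | zero => simp
    | add a b ha hb => simp only [map_add, inner_add_left, ha, hb]
    | single g c =>
      induction y using Finsupp.induction_linear with
      | zero => simp
      | add a b ha hb => simp only [map_add, inner_add_right, ha, hb]
      | single h d =>
        simp only [tensorSum, relabel, Finsupp.domLCongr_single, Finsupp.linearCombination_single,
          inner_smul_left, inner_smul_right, inner_tensor]
        simp
  rw [@norm_eq_sqrt_re_inner ℂ, @norm_eq_sqrt_re_inner ℂ, key]

/-- `V^{⊗k}` on the `k`-particle space: the unitary with `h₁ ⊗ ⋯ ⊗ h_k ↦ V h₁ ⊗ ⋯ ⊗ V h_k`. -/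
def tensorPow {α : Type*} [MeasurableSpace α] (μ : Measure α) [SigmaFinite μ]
    (V : Lp ℂ 2 μ ≃ₗᵢ[ℂ] Lp ℂ 2 μ) (k : ℕ) : NPart μ k ≃ₗᵢ[ℂ] NPart μ k :=
  (relabel μ V k).extendOfIsometry (tensorSum μ k) (tensorSum μ k)
    (denseRange_tensorSum μ k) (denseRange_tensorSum μ k) (norm_tensorSum_relabel μ V k)

theorem tensorPow_tensor {α : Type*} [MeasurableSpace α] (μ : Measure α) [SigmaFinite μ]
    (V : Lp ℂ 2 μ ≃ₗᵢ[ℂ] Lp ℂ 2 μ) {k : ℕ} (h : Fin k → Lp ℂ 2 μ) :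
    tensorPow μ V k (tensor μ h) = tensor μ fun i => V (h i) := by
  have := (relabel μ V k).extendOfIsometry_eq (tensorSum μ k) (tensorSum μ k)
    (denseRange_tensorSum μ k) (denseRange_tensorSum μ k) (norm_tensorSum_relabel μ V k)
    (Finsupp.single h 1)
  simp only [tensorSum, relabel, Finsupp.domLCongr_single, Finsupp.linearCombination_single,
    one_smul] at this
  exact this

theorem measurePreserving_perm {α : Type*} [MeasurableSpace α] (μ : Measure α) [SigmaFinite μ]
    {k : ℕ} (σ : Equiv.Perm (Fin k)) :
    MeasurePreserving (fun p : Fin k → α => p ∘ σ) (Measure.pi fun _ : Fin k => μ)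
      (Measure.pi fun _ : Fin k => μ) := by
  have h := measurePreserving_piCongrLeft (fun _ : Fin k => μ) σ.symm
  have e : (fun p : Fin k → α => p ∘ σ) = MeasurableEquiv.piCongrLeft (fun _ => α) σ.symm := by
    funext p
    funext i
    have := Equiv.piCongrLeft_apply_apply (fun _ : Fin k => α) σ.symm p (σ i)
    rw [MeasurableEquiv.coe_piCongrLeft]
    simpa using this.symm
  rw [e]
  exact h

/-- The action of a permutation on `k`-particle functions, `Ψ ↦ (p ↦ Ψ (p ∘ σ))`. -/
def permOp {α : Type*} [MeasurableSpace α] (μ : Measure α) [SigmaFinite μ] {k : ℕ}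
    (σ : Equiv.Perm (Fin k)) : NPart μ k →ₗᵢ[ℂ] NPart μ k :=
  Lp.compMeasurePreservingₗᵢ ℂ (fun p : Fin k → α => p ∘ σ) (measurePreserving_perm μ σ)

theorem permOp_tensor {α : Type*} [MeasurableSpace α] (μ : Measure α) [SigmaFinite μ] {k : ℕ}
    (σ : Equiv.Perm (Fin k)) (h : Fin k → Lp ℂ 2 μ) :
    permOp μ σ (tensor μ h) = tensor μ (h ∘ σ.symm) := by
  refine Lp.ext ?_
  have h1 : ⇑(permOp μ σ (tensor μ h)) =ᵐ[Measure.pi fun _ : Fin k => μ]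
      (tensor μ h) ∘ (fun p : Fin k → α => p ∘ σ) :=
    Lp.coeFn_compMeasurePreserving (tensor μ h) (measurePreserving_perm μ σ)
  have h2 := (measurePreserving_perm μ σ).quasiMeasurePreserving.ae
    (memLp_tensor μ h).coeFn_toLp
  filter_upwards [h1, h2, (memLp_tensor μ (h ∘ σ.symm)).coeFn_toLp] with p e1 e2 e3
  unfold tensor at e1 ⊢
  rw [e1, e3, Function.comp_apply, e2]
  exact Fintype.prod_equiv σ _ _ fun i => by simp

/-- The bosonic `k`-particle space: the functions invariant under all permutations. -/
def symSub {α : Type*} [MeasurableSpace α] (μ : Measure α) [SigmaFinite μ] (k : ℕ) :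
    Submodule ℂ (NPart μ k) where
  carrier := {Ψ | ∀ σ : Equiv.Perm (Fin k), permOp μ σ Ψ = Ψ}
  add_mem' ha hb σ := by rw [map_add, ha σ, hb σ]
  zero_mem' σ := map_zero _
  smul_mem' c a ha σ := by rw [map_smul, ha σ]

instance {α : Type*} [MeasurableSpace α] (μ : Measure α) [SigmaFinite μ] (k : ℕ) :
    CompleteSpace (symSub μ k) := by
  have h : IsClosed (symSub μ k : Set (NPart μ k)) := by
    have : (symSub μ k : Set (NPart μ k)) = ⋂ σ : Equiv.Perm (Fin k), {Ψ | permOp μ σ Ψ = Ψ} := by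
      ext Ψ
      simp [symSub]
    rw [this]
    exact isClosed_iInter fun σ => isClosed_eq (permOp μ σ).continuous continuous_id
  exact h.completeSpace_coe

theorem tensorPow_permOp {α : Type*} [MeasurableSpace α] (μ : Measure α) [SigmaFinite μ]
    (V : Lp ℂ 2 μ ≃ₗᵢ[ℂ] Lp ℂ 2 μ) {k : ℕ} (σ : Equiv.Perm (Fin k)) (Ψ : NPart μ k) :
    tensorPow μ V k (permOp μ σ Ψ) = permOp μ σ (tensorPow μ V k Ψ) := by
  refine (denseRange_tensorSum μ k).induction_on (p := fun Ψ => tensorPow μ V k (permOp μ σ Ψ)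
    = permOp μ σ (tensorPow μ V k Ψ)) Ψ ?_ ?_
  · exact isClosed_eq ((tensorPow μ V k).continuous.comp (permOp μ σ).continuous)
      ((permOp μ σ).continuous.comp (tensorPow μ V k).continuous)
  · intro x
    induction x using Finsupp.induction_linear with
    | zero => simp
    | add a b ha hb => simp only [map_add, ha, hb]
    | single h c =>
      simp only [tensorSum, Finsupp.linearCombination_single, map_smul, permOp_tensor,
        tensorPow_tensor]
      rfl

/-- `V^{⊗k}` restricted to the bosonic `k`-particle space. -/
def symPow {α : Type*} [MeasurableSpace α] (μ : Measure α) [SigmaFinite μ]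
    (V : Lp ℂ 2 μ ≃ₗᵢ[ℂ] Lp ℂ 2 μ) (k : ℕ) : symSub μ k ≃ₗᵢ[ℂ] symSub μ k where
  toFun Ψ := ⟨tensorPow μ V k Ψ, fun σ => by rw [← tensorPow_permOp, Ψ.2 σ]⟩
  map_add' a b := by ext1; simp
  map_smul' c a := by ext1; simp
  invFun Ψ := ⟨(tensorPow μ V k).symm Ψ, fun σ => by
    apply (tensorPow μ V k).injective
    rw [tensorPow_permOp, LinearIsometryEquiv.apply_symm_apply, Ψ.2 σ]⟩
  left_inv a := by ext1; simp
  right_inv a := by ext1; simp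
  norm_map' a := by
    change ‖tensorPow μ V k a‖ = ‖(a : NPart μ k)‖
    simp

/-- The bosonic Fock space over the one-particle space `L²(μ)`: the Hilbert sum of the
bosonic `k`-particle spaces. -/
abbrev Fock {α : Type*} [MeasurableSpace α] (μ : Measure α) [SigmaFinite μ] : Type _ :=
  lp (fun k : ℕ => symSub μ k) 2

theorem memlp_graded {α : Type*} [MeasurableSpace α] (μ : Measure α) [SigmaFinite μ]
    (V : ∀ k, symSub μ k ≃ₗᵢ[ℂ] symSub μ k) (Ψ : Fock μ) :
    Memℓp (fun k => V k (Ψ k)) 2 := by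
  have h := lp.memℓp Ψ
  rw [memℓp_gen_iff (by norm_num)] at h ⊢
  simpa using h

/-- The unitary `⨁ₖ Tₖ` on Fock space. -/
def gradedUnitary {α : Type*} [MeasurableSpace α] (μ : Measure α) [SigmaFinite μ]
    (T : ∀ k, symSub μ k ≃ₗᵢ[ℂ] symSub μ k) : Fock μ ≃ₗᵢ[ℂ] Fock μ where
  toFun Ψ := ⟨fun k => T k (Ψ k), memlp_graded μ T Ψ⟩
  map_add' a b := by ext1; funext k; exact map_add (T k) _ _
  map_smul' c a := by ext1; funext k; exact map_smul (T k) _ _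
  invFun Ψ := ⟨fun k => (T k).symm (Ψ k), memlp_graded μ (fun k => (T k).symm) Ψ⟩
  left_inv a := by ext1; funext k; exact (T k).symm_apply_apply _
  right_inv a := by ext1; funext k; exact (T k).apply_symm_apply _
  norm_map' a := by
    rw [lp.norm_eq_tsum_rpow (by norm_num), lp.norm_eq_tsum_rpow (by norm_num)]
    congr 1
    refine tsum_congr fun k => ?_
    congr 1
    exact (T k).norm_map _

/-- Second quantization `Γ(V) = ⨁ₖ V^{⊗k}`. -/
def secondQuant {α : Type*} [MeasurableSpace α] (μ : Measure α) [SigmaFinite μ]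
    (V : Lp ℂ 2 μ ≃ₗᵢ[ℂ] Lp ℂ 2 μ) : Fock μ ≃ₗᵢ[ℂ] Fock μ :=
  gradedUnitary μ (symPow μ V)

/-! ### Creation and annihilation operators -/

theorem measurePreserving_cons {α : Type*} [MeasurableSpace α] (μ : Measure α) [SigmaFinite μ]
    (k : ℕ) : MeasurePreserving (fun p : Fin (k + 1) → α => (p 0, Fin.tail p))
      (Measure.pi fun _ : Fin (k + 1) => μ) (μ.prod (Measure.pi fun _ : Fin k => μ)) := by
  have h := measurePreserving_piFinSuccAbove (fun _ : Fin (k + 1) => μ) 0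
  exact h

theorem memLp_leftTensor {α : Type*} [MeasurableSpace α] (μ : Measure α) [SigmaFinite μ] {k : ℕ}
    (g : Lp ℂ 2 μ) (Ψ : NPart μ k) :
    MemLp (fun p : Fin (k + 1) → α => g (p 0) * Ψ (Fin.tail p)) 2
      (Measure.pi fun _ : Fin (k + 1) => μ) := by
  have h : MemLp (fun z : α × (Fin k → α) => g z.1 * Ψ z.2) 2
      (μ.prod (Measure.pi fun _ : Fin k => μ)) := by
    have hm : AEStronglyMeasurable (fun z : α × (Fin k → α) => g z.1 * Ψ z.2)
        (μ.prod (Measure.pi fun _ : Fin k => μ)) :=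
      ((Lp.aestronglyMeasurable g).comp_fst).mul (Lp.aestronglyMeasurable Ψ).comp_snd
    rw [memLp_two_iff_integrable_sq_norm hm]
    simp only [norm_mul, mul_pow]
    exact ((memLp_two_iff_integrable_sq_norm (Lp.aestronglyMeasurable g)).1 (Lp.memLp g)).mul_prod
      ((memLp_two_iff_integrable_sq_norm (Lp.aestronglyMeasurable Ψ)).1 (Lp.memLp Ψ))
  exact h.comp_measurePreserving (measurePreserving_cons μ k)

theorem norm_leftTensor {α : Type*} [MeasurableSpace α] (μ : Measure α) [SigmaFinite μ] {k : ℕ}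
    (g : Lp ℂ 2 μ) (Ψ : NPart μ k) :
    ‖(memLp_leftTensor μ g Ψ).toLp‖ = ‖g‖ * ‖Ψ‖ := by
  have key : inner ℂ (memLp_leftTensor μ g Ψ).toLp (memLp_leftTensor μ g Ψ).toLp
      = inner ℂ g g * inner ℂ Ψ Ψ := by
    simp only [L2.inner_def]
    rw [← integral_prod_mul]
    rw [← (measurePreserving_cons μ k).integral_comp
      (MeasurableEquiv.measurableEmbedding (MeasurableEquiv.piFinSuccAbove (fun _ => α) 0))]
    refine integral_congr_ae ?_
    filter_upwards [(memLp_leftTensor μ g Ψ).coeFn_toLp] with p hp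
    rw [hp]
    simp
    ring
  simp only [inner_self_eq_norm_sq_to_K] at key
  have k2 : ‖(memLp_leftTensor μ g Ψ).toLp‖ ^ 2 = (‖g‖ * ‖Ψ‖) ^ 2 := by
    rw [mul_pow]
    exact_mod_cast key
  exact (sq_eq_sq₀ (norm_nonneg _) (by positivity)).1 k2

/-- `Ψ ↦ g ⊗ Ψ`, i.e. `(g ⊗ Ψ)(p₀, p₁, …, p_k) = g(p₀) Ψ(p₁, …, p_k)`. -/
def leftTensor {α : Type*} [MeasurableSpace α] (μ : Measure α) [SigmaFinite μ]
    (g : Lp ℂ 2 μ) (k : ℕ) : NPart μ k →L[ℂ] NPart μ (k + 1) :=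
  LinearMap.mkContinuous
    { toFun := fun Ψ => (memLp_leftTensor μ g Ψ).toLp
      map_add' := fun a b => by
        rw [← MemLp.toLp_add]
        refine MemLp.toLp_congr _ _ ?_
        have h := ((measurePreserving_cons μ k).quasiMeasurePreserving).ae
          ((Measure.quasiMeasurePreserving_snd).ae (Lp.coeFn_add a b))
        filter_upwards [h] with p hp
        simp only [Pi.add_apply] at hp ⊢
        rw [hp]
        ring
      map_smul' := fun c a => by
        rw [RingHom.id_apply, ← MemLp.toLp_const_smul]
        refine MemLp.toLp_congr _ _ ?_
        have h := ((measurePreserving_cons μ k).quasiMeasurePreserving).ae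
          ((Measure.quasiMeasurePreserving_snd).ae (Lp.coeFn_smul c a))
        filter_upwards [h] with p hp
        simp only [Pi.smul_apply, smul_eq_mul] at hp ⊢
        rw [hp]
        ring }
    ‖g‖ (fun Ψ => (norm_leftTensor μ g Ψ).le)

/-- Creation operator `a*(g) Ψ = √(k+1) P₊ (g ⊗ Ψ)` on the bosonic `k`-particle space,
with `P₊` the orthogonal projection onto the symmetric functions. -/
def creation {α : Type*} [MeasurableSpace α] (μ : Measure α) [SigmaFinite μ]
    (g : Lp ℂ 2 μ) (k : ℕ) : symSub μ k →L[ℂ] symSub μ (k + 1) :=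
  ((Real.sqrt (k + 1) : ℝ) : ℂ) •
    ((symSub μ (k + 1)).orthogonalProjectionOnto ∘L leftTensor μ g k ∘L (symSub μ k).subtypeL)

/-- Annihilation operator `a(g)`, the adjoint of `a*(g)` (so `a(g)` is antilinear in `g`). -/
def annihilation {α : Type*} [MeasurableSpace α] (μ : Measure α) [SigmaFinite μ]
    (g : Lp ℂ 2 μ) (k : ℕ) : symSub μ (k + 1) →L[ℂ] symSub μ k :=
  ContinuousLinearMap.adjoint (creation μ g k)

/-- Vectors of finite particle number. -/
def finiteParticle {α : Type*} [MeasurableSpace α] (μ : Measure α) [SigmaFinite μ] :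
    Submodule ℂ (Fock μ) where
  carrier := {Ψ | ∃ N, ∀ k, N ≤ k → Ψ k = 0}
  add_mem' := by
    rintro a b ⟨M, hM⟩ ⟨N, hN⟩
    refine ⟨max M N, fun k hk => ?_⟩
    rw [lp.coeFn_add, Pi.add_apply, hM k (le_of_max_le_left hk), hN k (le_of_max_le_right hk),
      add_zero]
  zero_mem' := ⟨0, fun _ _ => rfl⟩
  smul_mem' := by
    rintro c a ⟨M, hM⟩
    refine ⟨M, fun k hk => ?_⟩
    rw [lp.coeFn_smul, Pi.smul_apply, hM k hk, smul_zero]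

/-- The components of `(a(g) + a*(h)) Ψ`. -/
def fieldSeq {α : Type*} [MeasurableSpace α] (μ : Measure α) [SigmaFinite μ]
    (g h : Lp ℂ 2 μ) (Ψ : Fock μ) : ∀ k, symSub μ k
  | 0 => annihilation μ g 0 (Ψ 1)
  | k + 1 => annihilation μ g (k + 1) (Ψ (k + 2)) + creation μ h k (Ψ k)

theorem memlp_fieldSeq {α : Type*} [MeasurableSpace α] (μ : Measure α) [SigmaFinite μ]
    (g h : Lp ℂ 2 μ) (Ψ : finiteParticle μ) : Memℓp (fieldSeq μ g h (Ψ : Fock μ)) 2 := by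
  obtain ⟨N, hN⟩ := Ψ.2
  refine (memℓp_zero ?_).of_exponent_ge zero_le
  refine (Set.finite_lt_nat (N + 1)).subset fun k hk => ?_
  by_contra hcon
  simp only [Set.mem_ofPred_eq, not_lt] at hcon
  apply hk
  obtain ⟨j, rfl⟩ : ∃ j, k = j + 1 := ⟨k - 1, by omega⟩
  simp only [fieldSeq]
  rw [hN j (by omega), hN (j + 2) (by omega), map_zero, map_zero, add_zero]

theorem fieldSeq_add {α : Type*} [MeasurableSpace α] (μ : Measure α) [SigmaFinite μ]
    (g h : Lp ℂ 2 μ) (a b : Fock μ) :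
    fieldSeq μ g h (a + b) = fieldSeq μ g h a + fieldSeq μ g h b := by
  funext k
  cases k with
  | zero => simp [fieldSeq, Pi.add_apply]
  | succ k =>
    simp only [fieldSeq, lp.coeFn_add, Pi.add_apply, map_add]
    abel

theorem fieldSeq_smul {α : Type*} [MeasurableSpace α] (μ : Measure α) [SigmaFinite μ]
    (g h : Lp ℂ 2 μ) (c : ℂ) (a : Fock μ) :
    fieldSeq μ g h (c • a) = c • fieldSeq μ g h a := by
  funext k
  cases k with
  | zero => simp [fieldSeq, Pi.smul_apply]
  | succ k => simp only [fieldSeq, lp.coeFn_smul, Pi.smul_apply, map_smul, smul_add]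

/-- The operator `a(g) + a*(h)` with domain the vectors of finite particle number. -/
def field {α : Type*} [MeasurableSpace α] (μ : Measure α) [SigmaFinite μ]
    (g h : Lp ℂ 2 μ) : Fock μ →ₗ.[ℂ] Fock μ where
  domain := finiteParticle μ
  toFun :=
    { toFun := fun Ψ => ⟨fieldSeq μ g h Ψ, memlp_fieldSeq μ g h Ψ⟩
      map_add' := fun a b => Subtype.ext (fieldSeq_add μ g h a b)
      map_smul' := fun c a => Subtype.ext (fieldSeq_smul μ g h c a) }

/-! ### Unbounded operators, generated unitary groups, warped convolution -/

/-- The composition `S A T` of an unbounded operator with everywhere defined bijections, on the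
domain `{Ψ | T Ψ ∈ dom A}`. -/
def sandwich {H : Type*} [NormedAddCommGroup H] [InnerProductSpace ℂ H]
    (S : H ≃ₗᵢ[ℂ] H) (A : H →ₗ.[ℂ] H) (T : H ≃ₗᵢ[ℂ] H) : H →ₗ.[ℂ] H where
  domain := A.domain.comap T.toLinearEquiv.toLinearMap
  toFun := S.toLinearEquiv.toLinearMap ∘ₗ A.toFun ∘ₗ
    (T.toLinearEquiv.toLinearMap.restrict (p := A.domain.comap T.toLinearEquiv.toLinearMap)
      (q := A.domain) fun _ h => h)

open Classical in
/-- The value `A Ψ` of an unbounded operator (`0` outside the domain). -/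
def evalAt {H : Type*} [NormedAddCommGroup H] [InnerProductSpace ℂ H]
    (A : H →ₗ.[ℂ] H) (Ψ : H) : H :=
  if h : Ψ ∈ A.domain then A ⟨Ψ, h⟩ else 0

/-- `W` is the strongly continuous unitary group `W(x) = exp(i x^μ A_μ)` of the unbounded
operators `A_μ`: on the domain of `A_μ` its derivative in the direction `μ` is `i A_μ`.  If the
`A_μ` are essentially self-adjoint, there is at most one such `W`. -/
structure IsUnitaryExp {H : Type*} [NormedAddCommGroup H] [InnerProductSpace ℂ H] {d : ℕ}
    (A : Fin d → H →ₗ.[ℂ] H) (W : EuclideanSpace ℝ (Fin d) → H ≃ₗᵢ[ℂ] H) : Prop where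
  map_zero : W 0 = LinearIsometryEquiv.refl ℂ H
  map_add : ∀ x y, W (x + y) = (W y).trans (W x)
  continuous : ∀ Ψ, Continuous fun x => W x Ψ
  hasDerivAt : ∀ (μ : Fin d) (Ψ : (A μ).domain),
    HasDerivAt (fun t : ℝ => W (t • EuclideanSpace.single μ 1) (Ψ : H)) (Complex.I • A μ Ψ) 0

open Classical in
/-- The unitary group `x ↦ exp(i x^μ A_μ)`. -/
def unitaryExp {H : Type*} [NormedAddCommGroup H] [InnerProductSpace ℂ H] {d : ℕ}
    (A : Fin d → H →ₗ.[ℂ] H) : EuclideanSpace ℝ (Fin d) → H ≃ₗᵢ[ℂ] H :=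
  if h : ∃ W, IsUnitaryExp A W then h.choose else fun _ => LinearIsometryEquiv.refl ℂ H

/-- The Lorentzian scalar product `x y = x₀ y₀ - x₁ y₁ - ⋯ - xₙ yₙ`. -/
def mink {n : ℕ} (x y : EuclideanSpace ℝ (Fin (n + 1))) : ℝ :=
  x 0 * y 0 - ∑ i : Fin n, x i.succ * y i.succ

/-- The integrand `exp(-i x y) χ(ε x, ε y) β_{θ x}(A) W(y) Ψ` of the warped convolution at
`z = (x, y)`, where `β_b(A) = W(b) A W(b)⁻¹`. -/
def warpedIntegrand {H : Type*} [NormedAddCommGroup H] [InnerProductSpace ℂ H] {n : ℕ}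
    (θ : Matrix (Fin (n + 1)) (Fin (n + 1)) ℝ) (W : EuclideanSpace ℝ (Fin (n + 1)) → H ≃ₗᵢ[ℂ] H)
    (A : H →ₗ.[ℂ] H) (Ψ : H)
    (χ : 𝓢(EuclideanSpace ℝ (Fin (n + 1)) × EuclideanSpace ℝ (Fin (n + 1)), ℂ)) (ε : ℝ)
    (z : EuclideanSpace ℝ (Fin (n + 1)) × EuclideanSpace ℝ (Fin (n + 1))) : H :=
  (Complex.exp (-Complex.I * (mink z.1 z.2 : ℂ)) * χ (ε • z)) •
    evalAt (sandwich (W (θ.toEuclideanLin z.1)) A (W (θ.toEuclideanLin z.1)).symm) (W z.2 Ψ)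

/-- `Φ` is the value at `Ψ` of the operator `A` deformed with the unitary group `W`, i.e. of the
oscillatory integral `(2π)^{-d} lim_{ε → 0} ∬ dx dy exp(-i x y) χ(ε x, ε y) β_{θ x}(A) W(y) Ψ`:
all vectors occurring lie in the domains, the integrals converge absolutely, and the limit exists
and is `Φ`, whatever the cutoff `χ` with `χ(0,0) = 1`. -/
structure HasWarpedValue {H : Type*} [NormedAddCommGroup H] [InnerProductSpace ℂ H] {n : ℕ}
    (θ : Matrix (Fin (n + 1)) (Fin (n + 1)) ℝ) (W : EuclideanSpace ℝ (Fin (n + 1)) → H ≃ₗᵢ[ℂ] H)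
    (A : H →ₗ.[ℂ] H) (Ψ Φ : H) : Prop where
  mem_domain : ∀ x y, W y Ψ ∈
    (sandwich (W (θ.toEuclideanLin x)) A (W (θ.toEuclideanLin x)).symm).domain
  integrable : ∀ χ : 𝓢(EuclideanSpace ℝ (Fin (n + 1)) × EuclideanSpace ℝ (Fin (n + 1)), ℂ),
    χ 0 = 1 → ∀ ε : ℝ, ε ≠ 0 → Integrable (warpedIntegrand θ W A Ψ χ ε)
  tendsto : ∀ χ : 𝓢(EuclideanSpace ℝ (Fin (n + 1)) × EuclideanSpace ℝ (Fin (n + 1)), ℂ),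
    χ 0 = 1 → Tendsto
      (fun ε : ℝ => (((2 * Real.pi) ^ (n + 1))⁻¹ : ℂ) • ∫ z, warpedIntegrand θ W A Ψ χ ε z)
      (𝓝[≠] 0) (𝓝 Φ)

open Classical in
/-- The warped convolution `A_θ Ψ` of `A` with the unitary group `W`. -/
def warped {H : Type*} [NormedAddCommGroup H] [InnerProductSpace ℂ H] {n : ℕ}
    (θ : Matrix (Fin (n + 1)) (Fin (n + 1)) ℝ) (W : EuclideanSpace ℝ (Fin (n + 1)) → H ≃ₗᵢ[ℂ] H)
    (A : H →ₗ.[ℂ] H) (Ψ : H) : H :=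
  if h : ∃ Φ, HasWarpedValue θ W A Ψ Φ then h.choose else 0

/-! ### The massive free field -/

/-- The energy `ω_p = √(m² + |p|²)`. -/
def energy {n : ℕ} (m : ℝ) (p : EuclideanSpace ℝ (Fin n)) : ℝ := Real.sqrt (m ^ 2 + ‖p‖ ^ 2)

/-- The point `(ω_p, p)` of the upper mass shell. -/
def shellPoint {n : ℕ} (m : ℝ) (p : EuclideanSpace ℝ (Fin n)) :
    EuclideanSpace ℝ (Fin (n + 1)) :=
  WithLp.toLp 2 (Fin.cons (energy m p) fun i => p i)

/-- The Lorentz invariant measure `dⁿp / (2 ω_p)`. -/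
def shellMeasure (n : ℕ) (m : ℝ) : Measure (EuclideanSpace ℝ (Fin n)) :=
  volume.withDensity fun p => ENNReal.ofReal (1 / (2 * energy m p))

instance (n : ℕ) (m : ℝ) : SigmaFinite (shellMeasure n m) :=
  SigmaFinite.withDensity_ofReal _

/-- The one-particle Hilbert space `L²(dⁿp / (2 ω_p))`. -/
abbrev OneParticle (n : ℕ) (m : ℝ) : Type := Lp ℂ 2 (shellMeasure n m)

/-- The bosonic Fock space of the free field of mass `m`. -/
abbrev FockSpace (n : ℕ) (m : ℝ) : Type := Fock (shellMeasure n m)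

theorem continuous_shellPoint {n : ℕ} (m : ℝ) :
    Continuous (shellPoint m : EuclideanSpace ℝ (Fin n) → _) := by
  refine (PiLp.continuous_toLp 2 _).comp (continuous_pi fun j => ?_)
  refine Fin.cases ?_ (fun i => ?_) j
  · simp only [Fin.cons_zero, energy]
    fun_prop
  · simp only [Fin.cons_succ]
    fun_prop

theorem le_energy {n : ℕ} (m : ℝ) (p : EuclideanSpace ℝ (Fin n)) :
    m ≤ energy m p := by
  refine Real.le_sqrt_of_sq_le ?_
  exact le_add_of_nonneg_right (sq_nonneg _)

/-- The functions `f^±(p) = ∫ dx f(x) exp(± i p x)`, `p = (ω_p, p)` on the upper mass shell;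
the sign is `s = ±1`. -/
def shellFun {n : ℕ} (m : ℝ) (s : ℝ) (f : 𝓢(EuclideanSpace ℝ (Fin (n + 1)), ℂ))
    (p : EuclideanSpace ℝ (Fin n)) : ℂ :=
  ∫ x, f x * Complex.exp (Complex.I * ((s * mink (shellPoint m p) x : ℝ) : ℂ))

/-- The vector of Minkowski reflected, rescaled components. -/
def dualPoint {n : ℕ} (m : ℝ) (s : ℝ) (p : EuclideanSpace ℝ (Fin n)) :
    EuclideanSpace ℝ (Fin (n + 1)) :=
  WithLp.toLp 2 (Fin.cons (-(s / (2 * Real.pi)) * energy m p) fun i => s / (2 * Real.pi) * p i)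

theorem shellFun_eq {n : ℕ} (m : ℝ) (s : ℝ) (f : 𝓢(EuclideanSpace ℝ (Fin (n + 1)), ℂ))
    (p : EuclideanSpace ℝ (Fin n)) :
    shellFun m s f p = (FourierTransform.fourier f) (dualPoint m s p) := by
  rw [SchwartzMap.fourier_coe, Real.fourier_eq']
  unfold shellFun
  refine integral_congr_ae (Eventually.of_forall fun x => ?_)
  simp only [smul_eq_mul]
  rw [mul_comm]
  congr 2
  rw [mul_comm]
  congr 2
  have hpi : Real.pi ≠ 0 := Real.pi_ne_zero
  simp only [mink, shellPoint, dualPoint, PiLp.inner_apply, Fin.sum_univ_succ, Fin.cons_zero,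
    Fin.cons_succ, RCLike.inner_apply, conj_trivial]
  have : ∀ i : Fin n, s / (2 * Real.pi) * p i * x i.succ = s / (2 * Real.pi) * (p i * x i.succ) :=
    fun i => by ring
  simp only [this, ← Finset.mul_sum]
  field_simp
  ring

theorem norm_le_dualPoint {n : ℕ} (m : ℝ) (s : ℝ) (p : EuclideanSpace ℝ (Fin n)) :
    |s / (2 * Real.pi)| * ‖p‖ ≤ ‖dualPoint m s p‖ := by
  rw [EuclideanSpace.norm_eq, EuclideanSpace.norm_eq, ← Real.sqrt_sq_eq_abs, ← Real.sqrt_mul (sq_nonneg _)]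
  refine Real.sqrt_le_sqrt ?_
  rw [Fin.sum_univ_succ, Finset.mul_sum]
  refine le_add_of_nonneg_of_le (by positivity) (Finset.sum_le_sum fun i _ => ?_)
  simp only [dualPoint, Fin.cons_succ, norm_mul, mul_pow, Real.norm_eq_abs, sq_abs]
  exact le_rfl

theorem memLp_shellFun {n : ℕ} {m : ℝ} (hm : 0 < m) {s : ℝ} (hs : s ≠ 0)
    (f : 𝓢(EuclideanSpace ℝ (Fin (n + 1)), ℂ)) :
    MemLp (shellFun m s f) 2 (shellMeasure n m) := by
  have hle : shellMeasure n m ≤ ENNReal.ofReal (1 / (2 * m)) • volume := by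
    rw [← withDensity_const]
    refine withDensity_mono (Eventually.of_forall fun p => ENNReal.ofReal_le_ofReal ?_)
    exact one_div_le_one_div_of_le (by positivity) (by linarith [le_energy m p])
  refine MemLp.of_measure_le_smul ENNReal.ofReal_ne_top hle ?_
  have hcd : Continuous (dualPoint m s : EuclideanSpace ℝ (Fin n) → _) := by
    refine (PiLp.continuous_toLp 2 _).comp (continuous_pi fun j => ?_)
    refine Fin.cases ?_ (fun i => ?_) j
    · simp only [Fin.cons_zero, energy]
      fun_prop
    · simp only [Fin.cons_succ]
      fun_prop
  have heq : shellFun m s f = fun p : EuclideanSpace ℝ (Fin n) =>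
      (FourierTransform.fourier f) (dualPoint m s p) := funext (shellFun_eq m s f)
  rw [heq]
  have hmeas : AEStronglyMeasurable (fun p : EuclideanSpace ℝ (Fin n) =>
      (FourierTransform.fourier f) (dualPoint m s p)) volume :=
    ((FourierTransform.fourier f).continuous.comp hcd).aestronglyMeasurable
  rw [memLp_two_iff_integrable_sq_norm hmeas]
  obtain ⟨C, hC⟩ : ∃ C, ∀ w, (1 + ‖w‖) ^ (n + 1) * ‖(FourierTransform.fourier f) w‖ ≤ C := by
    refine ⟨2 ^ (n + 1) * (Finset.Iic (n + 1, 0)).sup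
      (fun j => SchwartzMap.seminorm ℂ j.1 j.2) (FourierTransform.fourier f), fun w => ?_⟩
    have := SchwartzMap.one_add_le_sup_seminorm_apply (𝕜 := ℂ) (m := (n + 1, 0)) (k := n + 1)
      (n := 0) le_rfl le_rfl (FourierTransform.fourier f) w
    rw [norm_iteratedFDeriv_zero] at this
    exact this
  set c : ℝ := min 1 |s / (2 * Real.pi)| with hc
  have hc0 : 0 < c := by
    have : s / (2 * Real.pi) ≠ 0 := div_ne_zero hs (by positivity)
    exact lt_min one_pos (abs_pos.2 this)
  have hlow : ∀ p : EuclideanSpace ℝ (Fin n), c * (1 + ‖p‖) ≤ 1 + ‖dualPoint m s p‖ := fun p => by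
    have h1 := norm_le_dualPoint m s p
    have h2 : c * ‖p‖ ≤ |s / (2 * Real.pi)| * ‖p‖ :=
      mul_le_mul_of_nonneg_right (min_le_right _ _) (norm_nonneg _)
    have h3 : c ≤ 1 := min_le_left _ _
    linarith
  have hint : Integrable (fun p : EuclideanSpace ℝ (Fin n) => (1 + ‖p‖) ^ (-(n + 1 : ℝ))) := by
    refine integrable_one_add_norm ?_
    simp
  refine (hint.const_mul ((C / c ^ (n + 1)) ^ 2)).mono' (hmeas.norm.pow 2)
    (Eventually.of_forall fun p => ?_)
  rw [Real.norm_of_nonneg (by positivity)]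
  have h1 : (1 : ℝ) ≤ (1 + ‖p‖) ^ (n + 1) := one_le_pow₀ (by linarith [norm_nonneg p])
  have hb : ‖(FourierTransform.fourier f) (dualPoint m s p)‖
      ≤ C / c ^ (n + 1) / (1 + ‖p‖) ^ (n + 1) := by
    rw [div_div, le_div_iff₀ (by positivity), ← mul_pow, mul_comm]
    refine le_trans (mul_le_mul_of_nonneg_right ?_ (norm_nonneg _)) (hC (dualPoint m s p))
    exact pow_le_pow_left₀ (by positivity) (hlow p) _
  have hrp : (1 + ‖p‖) ^ (-(n + 1 : ℝ)) = ((1 + ‖p‖) ^ (n + 1))⁻¹ := by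
    rw [Real.rpow_neg (by positivity)]
    congr 1
    exact_mod_cast Real.rpow_natCast (1 + ‖p‖) (n + 1)
  rw [hrp]
  calc _ ≤ (C / c ^ (n + 1) / (1 + ‖p‖) ^ (n + 1)) ^ 2 := pow_le_pow_left₀ (norm_nonneg _) hb 2
    _ = (C / c ^ (n + 1)) ^ 2 * (((1 + ‖p‖) ^ (n + 1))⁻¹) ^ 2 := by
        rw [div_eq_mul_inv, mul_pow]
    _ ≤ _ := by
        refine mul_le_mul_of_nonneg_left ?_ (by positivity)
        have h2 : ((1 + ‖p‖) ^ (n + 1))⁻¹ ≤ 1 := inv_le_one_of_one_le₀ h1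
        have h3 : 0 ≤ ((1 + ‖p‖) ^ (n + 1))⁻¹ := by positivity
        nlinarith

/-- `f⁺` as a one-particle vector. -/
def fPlus {n : ℕ} {m : ℝ} (hm : 0 < m) (f : 𝓢(EuclideanSpace ℝ (Fin (n + 1)), ℂ)) :
    OneParticle n m :=
  (memLp_shellFun hm one_ne_zero f).toLp

/-- The complex conjugate of `f⁻` as a one-particle vector. -/
def fMinusConj {n : ℕ} {m : ℝ} (hm : 0 < m) (f : 𝓢(EuclideanSpace ℝ (Fin (n + 1)), ℂ)) :
    OneParticle n m :=
  (memLp_shellFun hm (neg_ne_zero.2 one_ne_zero) f).star.toLp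

/-- The free field `φ(f) = a(conj f⁻) + a*(f⁺)`. -/
def freeField {n : ℕ} {m : ℝ} (hm : 0 < m) (f : 𝓢(EuclideanSpace ℝ (Fin (n + 1)), ℂ)) :
    FockSpace n m →ₗ.[ℂ] FockSpace n m :=
  field (shellMeasure n m) (fMinusConj hm f) (fPlus hm f)

/-- The free field with transformed test function, `φ(V f) = a(V (conj f⁻)) + a*(V f⁺)`: the
unitary `V` acts on the one-particle vectors by which `f` enters the field. -/
def freeFieldTransformed {n : ℕ} {m : ℝ} (hm : 0 < m)
    (V : OneParticle n m ≃ₗᵢ[ℂ] OneParticle n m)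
    (f : 𝓢(EuclideanSpace ℝ (Fin (n + 1)), ℂ)) : FockSpace n m →ₗ.[ℂ] FockSpace n m :=
  field (shellMeasure n m) (V (fMinusConj hm f)) (V (fPlus hm f))

/-- The one-particle domain `Δ(P)`: vectors decaying faster than any inverse polynomial. -/
def deltaOne (n : ℕ) (m : ℝ) : Submodule ℂ (OneParticle n m) where
  carrier := {f | ∀ r : ℕ, ∃ c : ℝ, ∀ᵐ p ∂(shellMeasure n m), ‖((‖p‖ ^ 2) ^ r : ℝ) * f p‖ ≤ c}
  add_mem' := by
    intro f g hf hg r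
    obtain ⟨c, hc⟩ := hf r
    obtain ⟨d, hd⟩ := hg r
    refine ⟨c + d, ?_⟩
    filter_upwards [hc, hd, Lp.coeFn_add f g] with p h1 h2 h3
    rw [h3, Pi.add_apply, mul_add]
    exact (norm_add_le _ _).trans (add_le_add h1 h2)
  zero_mem' := by
    intro r
    refine ⟨0, ?_⟩
    filter_upwards [Lp.coeFn_zero ℂ 2 (shellMeasure n m)] with p h
    rw [h]
    simp
  smul_mem' := by
    intro a f hf r
    obtain ⟨c, hc⟩ := hf r
    refine ⟨‖a‖ * c, ?_⟩
    filter_upwards [hc, Lp.coeFn_smul a f] with p h1 h2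
    rw [h2, Pi.smul_apply, smul_eq_mul, mul_left_comm, norm_mul]
    exact mul_le_mul_of_nonneg_left h1 (norm_nonneg _)

/-- The symmetrised elementary tensor `P₊ (h₁ ⊗ ⋯ ⊗ h_k)`. -/
def symTensor {α : Type*} [MeasurableSpace α] (μ : Measure α) [SigmaFinite μ] {k : ℕ}
    (h : Fin k → Lp ℂ 2 μ) : symSub μ k :=
  (symSub μ k).orthogonalProjectionOnto (tensor μ h)

/-- `Δ_k(P)`: the bosonic `k`-particle vectors in the algebraic tensor product `Δ(P)^{⊗k}`,
i.e. the finite sums of symmetrised tensors of vectors in `Δ(P)`. -/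
def deltaP (n : ℕ) (m : ℝ) (k : ℕ) : Submodule ℂ (FockSpace n m) :=
  Submodule.span ℂ {Ψ | ∃ h : Fin k → OneParticle n m, (∀ i, h i ∈ deltaOne n m) ∧
    Ψ = lp.single 2 k (symTensor (shellMeasure n m) h)}

/-- `Δ_k(X) = Γ(V⁻¹) Δ_k(P)`. -/
def deltaX {n : ℕ} {m : ℝ} (V : OneParticle n m ≃ₗᵢ[ℂ] OneParticle n m) (k : ℕ) :
    Submodule ℂ (FockSpace n m) :=
  (deltaP n m k).map (secondQuant (shellMeasure n m) V.symm).toLinearEquiv.toLinearMap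

/-- The covariant component `p_μ` (lower index) of the momentum `(ω_p, p)`. -/
def momentum {n : ℕ} (m : ℝ) (μ : Fin (n + 1)) (p : EuclideanSpace ℝ (Fin n)) : ℝ :=
  mink (EuclideanSpace.single μ 1) (shellPoint m p)

/-- The graph of the second quantized momentum operator `P_μ`: on the span of all `Δ_k(P)` it
multiplies `k`-particle functions by `(p₁)_μ + ⋯ + (p_k)_μ`. -/
def momentumGraph (n : ℕ) (m : ℝ) (μ : Fin (n + 1)) :
    Submodule ℂ (FockSpace n m × FockSpace n m) where
  carrier := {z | z.1 ∈ ⨆ k, deltaP n m k ∧ ∀ k,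
    ∀ᵐ p ∂(Measure.pi fun _ : Fin k => shellMeasure n m),
      (z.2 k : NPart (shellMeasure n m) k) p
        = ((∑ i, momentum m μ (p i) : ℝ) : ℂ) * (z.1 k : NPart (shellMeasure n m) k) p}
  add_mem' := by
    rintro a b ⟨ha, ha'⟩ ⟨hb, hb'⟩
    refine ⟨Submodule.add_mem _ ha hb, fun k => ?_⟩
    filter_upwards [ha' k, hb' k,
      Lp.coeFn_add (a.1 k : NPart (shellMeasure n m) k) (b.1 k : NPart (shellMeasure n m) k),
      Lp.coeFn_add (a.2 k : NPart (shellMeasure n m) k) (b.2 k : NPart (shellMeasure n m) k)]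
      with p h1 h2 h3 h4
    simp only [Prod.fst_add, Prod.snd_add, lp.coeFn_add, Pi.add_apply, Submodule.coe_add] at h3 h4 ⊢
    rw [h3, h4, h1, h2, mul_add]
  zero_mem' := by
    refine ⟨Submodule.zero_mem _, fun k => ?_⟩
    filter_upwards [Lp.coeFn_zero ℂ 2 (Measure.pi fun _ : Fin k => shellMeasure n m)] with p h
    change (0 : NPart (shellMeasure n m) k) p = _ * (0 : NPart (shellMeasure n m) k) p
    rw [h]
    simp
  smul_mem' := by
    rintro c a ⟨ha, ha'⟩
    refine ⟨Submodule.smul_mem _ c ha, fun k => ?_⟩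
    filter_upwards [ha' k, Lp.coeFn_smul c (a.1 k : NPart (shellMeasure n m) k),
      Lp.coeFn_smul c (a.2 k : NPart (shellMeasure n m) k)] with p h1 h2 h3
    simp only [Prod.smul_fst, Prod.smul_snd, lp.coeFn_smul, Pi.smul_apply, Submodule.coe_smul,
      smul_eq_mul] at h2 h3 ⊢
    rw [h2, h3, h1, mul_left_comm]

/-- The second quantized momentum operator `P_μ` on the span of all `Δ_k(P)`. -/
def momentumOp (n : ℕ) (m : ℝ) (μ : Fin (n + 1)) : FockSpace n m →ₗ.[ℂ] FockSpace n m :=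
  (momentumGraph n m μ).toLinearPMap

/-- The deformation operator `X_μ = Γ(V⁻¹) P_μ Γ(V)`. -/
def xOp {n : ℕ} {m : ℝ} (V : OneParticle n m ≃ₗᵢ[ℂ] OneParticle n m) (μ : Fin (n + 1)) :
    FockSpace n m →ₗ.[ℂ] FockSpace n m :=
  sandwich (secondQuant (shellMeasure n m) V.symm) (momentumOp n m μ)
    (secondQuant (shellMeasure n m) V)

end Fockspace

end

open Fockspace

noncomputable section

namespace Fockspace

/-! ### Multiplication by phases -/

/-! Everything in the `X` picture is the conjugate by `Γ(V)` of something in the `P` picture. If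
`W_X(y) = Γ(V)⁻¹ W_P(y) Γ(V)` and `φ(f) = Γ(V)⁻¹ φ(Vf) Γ(V)`, then the integrand of one deformation
is the image under the unitary `Γ(V)⁻¹` of the integrand of the other. A unitary preserves absolute
convergence and commutes with integrals and limits (`HasWarpedValue.conj`). Three facts remain.

The field identity (`sandwich_field`): `V^{⊗k}` intertwines `Ψ ↦ g ⊗ Ψ` with `Ψ ↦ V g ⊗ Ψ` and
commutes with symmetrisation, which settles creation; annihilation follows by taking adjoints.

The groups: `unitaryExp` is chosen among all groups with the prescribed derivatives, so it must be
shown unique. The second quantized translations, which multiply `k`-particle functions by `exp(i y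
(p₁ + ⋯ + p_k))`, form such a group. They leave the dense span of the `Δ_k(P)` invariant, and this
span lies in the domain of every `P_μ`. For two such groups, `W₂(-s) W₁(s) Ψ` then has zero
derivative (`IsUnitaryExp.eq_of_invariant`).

Existence of the deformed field (`exists_hasWarpedValue_field`): on a vector of fixed particle
number, `β_{θx}(a*(h)) W(y) ψ` is a fixed bounded operator applied to `exp(i(θx·p₀ + y·∑ pᵢ)) (h ⊗
ψ)`, and annihilation has the same form with `-θx`. What is left is the scalar integral `∬ exp(-ixy)
χ(εx, εy) exp(i(φ(x) + y b))`. The substitution `x = b + εu` together with rescaling `y` turns it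
into an integral over `u` of a unimodular factor times a partial Fourier transform of `χ`
(`planeWaveIntegral_eq`). That integral is bounded uniformly in `ε`, `φ`, `b` and tends to `(2π)^d
exp(iφ(b))`. Dominated convergence in `L²` gives a limit that does not depend on `χ`. -/

theorem norm_sq_Lp_two {α : Type*} [MeasurableSpace α] {ν : Measure α} (f : Lp ℂ 2 ν) :
    ‖f‖ ^ 2 = ∫ p, ‖f p‖ ^ 2 ∂ν := by
  have h : inner ℂ f f = ((∫ p, ‖f p‖ ^ 2 ∂ν : ℝ) : ℂ) := by
    rw [L2.inner_def, ← integral_complex_ofReal]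
    refine integral_congr_ae (Eventually.of_forall fun p => ?_)
    simp only [inner_self_eq_norm_sq_to_K]
    push_cast
    rfl
  rw [inner_self_eq_norm_sq_to_K] at h
  apply Complex.ofReal_injective
  rw [← h]
  push_cast
  rfl

/-- Dominated convergence in `L²`. -/
theorem tendsto_Lp_two_of_dominated {α ι : Type*} [MeasurableSpace α] {ν : Measure α}
    {l : Filter ι} [l.IsCountablyGenerated] {F : ι → Lp ℂ 2 ν} {G : Lp ℂ 2 ν}
    {F' : ι → α → ℂ} {G' : α → ℂ} (hF : ∀ᶠ i in l, F i =ᵐ[ν] F' i) (hG : G =ᵐ[ν] G')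
    {g : α → ℝ} (hg : MemLp g 2 ν) (hb : ∀ᶠ i in l, ∀ᵐ p ∂ν, ‖F' i p - G' p‖ ≤ g p)
    (hlim : ∀ᵐ p ∂ν, Tendsto (fun i => F' i p) l (𝓝 (G' p))) : Tendsto F l (𝓝 G) := by
  have key : Tendsto (fun i => ∫ p, ‖(F i - G) p‖ ^ 2 ∂ν) l (𝓝 (∫ _, (0 : ℝ) ∂ν)) := by
    have h1 : Tendsto (fun i => ∫ p, ‖F' i p - G' p‖ ^ 2 ∂ν) l (𝓝 (∫ _, (0 : ℝ) ∂ν)) := by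
      refine tendsto_integral_filter_of_dominated_convergence (fun p => g p ^ 2) ?_ ?_ ?_ ?_
      · filter_upwards [hF] with i hi
        have : AEStronglyMeasurable (fun p => F' i p - G' p) ν :=
          ((Lp.aestronglyMeasurable (F i)).congr hi).sub ((Lp.aestronglyMeasurable G).congr hG)
        exact this.norm.pow 2
      · filter_upwards [hb] with i hi
        filter_upwards [hi] with p hp
        rw [Real.norm_of_nonneg (by positivity)]
        exact pow_le_pow_left₀ (norm_nonneg _) hp 2
      · exact hg.integrable_sq
      · filter_upwards [hlim] with p hp
        have := ((hp.sub_const (G' p)).norm).pow 2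
        simpa using this
    refine h1.congr' ?_
    filter_upwards [hF] with i hi
    refine integral_congr_ae ?_
    filter_upwards [hi, hG, Lp.coeFn_sub (F i) G] with p h1 h2 h3
    rw [h3, Pi.sub_apply, h1, h2]
  rw [tendsto_iff_norm_sub_tendsto_zero]
  simp only [← norm_sq_Lp_two, integral_zero] at key
  have := key.sqrt
  simpa using this

theorem memLp_phase_mul {α : Type*} [MeasurableSpace α] {ν : Measure α} {φ : α → ℝ}
    (hφ : Measurable φ) (f : Lp ℂ 2 ν) :
    MemLp (fun p => Complex.exp (Complex.I * φ p) * f p) 2 ν := by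
  refine (Lp.memLp f).of_le ?_ (Eventually.of_forall fun p => ?_)
  · refine AEStronglyMeasurable.mul ?_ (Lp.aestronglyMeasurable f)
    have : Measurable fun p => Complex.exp (Complex.I * φ p) := by fun_prop
    exact this.aestronglyMeasurable
  · rw [norm_mul, mul_comm Complex.I, Complex.norm_exp_ofReal_mul_I, one_mul]

theorem phase_mul_cancel {α : Type*} [MeasurableSpace α] {ν : Measure α} {φ ψ : α → ℝ}
    (hφ : Measurable φ) (hψ : Measurable ψ) (h : ∀ p, φ p + ψ p = 0) (f : Lp ℂ 2 ν) :
    (memLp_phase_mul hφ (memLp_phase_mul hψ f).toLp).toLp = f := by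
  refine Lp.ext ?_
  filter_upwards [(memLp_phase_mul hφ (memLp_phase_mul hψ f).toLp).coeFn_toLp,
    (memLp_phase_mul hψ f).coeFn_toLp] with p h1 h2
  rw [h1, h2, ← mul_assoc, ← Complex.exp_add, ← mul_add, ← Complex.ofReal_add, h p]
  simp

/-- Multiplication by `exp(i φ)` for a measurable real function `φ`. -/
def phaseMul {α : Type*} [MeasurableSpace α] (ν : Measure α) {φ : α → ℝ} (hφ : Measurable φ) :
    Lp ℂ 2 ν ≃ₗᵢ[ℂ] Lp ℂ 2 ν where
  toFun f := (memLp_phase_mul hφ f).toLp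
  map_add' a b := by
    rw [← MemLp.toLp_add]
    refine MemLp.toLp_congr _ _ ?_
    filter_upwards [Lp.coeFn_add a b] with p hp
    rw [hp, Pi.add_apply, Pi.add_apply, mul_add]
  map_smul' c a := by
    rw [RingHom.id_apply, ← MemLp.toLp_const_smul]
    refine MemLp.toLp_congr _ _ ?_
    filter_upwards [Lp.coeFn_smul c a] with p hp
    rw [hp, Pi.smul_apply, Pi.smul_apply, smul_eq_mul, smul_eq_mul, mul_left_comm]
  invFun f := (memLp_phase_mul hφ.neg f).toLp
  left_inv f := phase_mul_cancel hφ.neg hφ (fun p => by simp) f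
  right_inv f := phase_mul_cancel hφ hφ.neg (fun p => by simp) f
  norm_map' f := by
    change ‖(memLp_phase_mul hφ f).toLp‖ = ‖f‖
    have : ‖(memLp_phase_mul hφ f).toLp‖ ^ 2 = ‖f‖ ^ 2 := by
      rw [norm_sq_Lp_two, norm_sq_Lp_two]
      refine integral_congr_ae ?_
      filter_upwards [(memLp_phase_mul hφ f).coeFn_toLp] with p hp
      rw [hp, norm_mul, mul_comm Complex.I, Complex.norm_exp_ofReal_mul_I, one_mul]
    exact (sq_eq_sq₀ (norm_nonneg _) (norm_nonneg _)).1 this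

theorem coeFn_phaseMul {α : Type*} [MeasurableSpace α] {ν : Measure α} {φ : α → ℝ}
    (hφ : Measurable φ) (f : Lp ℂ 2 ν) :
    phaseMul ν hφ f =ᵐ[ν] fun p => Complex.exp (Complex.I * φ p) * f p :=
  (memLp_phase_mul hφ f).coeFn_toLp

theorem phaseMul_phaseMul {α : Type*} [MeasurableSpace α] {ν : Measure α} {φ ψ χ : α → ℝ}
    (hφ : Measurable φ) (hψ : Measurable ψ) (hχ : Measurable χ) (h : ∀ p, χ p = φ p + ψ p)
    (f : Lp ℂ 2 ν) : phaseMul ν hφ (phaseMul ν hψ f) = phaseMul ν hχ f := by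
  refine Lp.ext ?_
  filter_upwards [coeFn_phaseMul hφ (phaseMul ν hψ f), coeFn_phaseMul hψ f,
    coeFn_phaseMul hχ f] with p h1 h2 h3
  rw [h1, h2, h3, ← mul_assoc, ← Complex.exp_add, ← mul_add, ← Complex.ofReal_add, h p]

theorem phaseMul_zero {α : Type*} [MeasurableSpace α] {ν : Measure α} {φ : α → ℝ}
    (hφ : Measurable φ) (h : ∀ p, φ p = 0) : phaseMul ν hφ = LinearIsometryEquiv.refl ℂ _ := by
  ext1 f
  refine Lp.ext ?_
  filter_upwards [coeFn_phaseMul hφ f] with p h1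
  rw [h1, h p]
  simp

/-- Pointwise continuity of the phases suffices, since `2 |f|` dominates every difference. This
yields strong continuity of the translations and measurability of the oscillatory integrands. -/
theorem continuous_phaseMul {α X : Type*} [MeasurableSpace α] {ν : Measure α} [TopologicalSpace X]
    [FirstCountableTopology X] {φ : X → α → ℝ} (hφ : ∀ x, Measurable (φ x))
    (hc : ∀ p, Continuous fun x => φ x p) (f : Lp ℂ 2 ν) :
    Continuous fun x => phaseMul ν (hφ x) f := by
  rw [continuous_iff_continuousAt]
  intro x₀
  refine tendsto_Lp_two_of_dominated (Eventually.of_forall fun x => coeFn_phaseMul (hφ x) f)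
    (coeFn_phaseMul (hφ x₀) f) ((Lp.memLp f).norm.const_mul 2)
    (Eventually.of_forall fun x => Eventually.of_forall fun p => ?_)
    (Eventually.of_forall fun p => ?_)
  · refine (norm_sub_le _ _).trans ?_
    simp only [norm_mul, mul_comm Complex.I, Complex.norm_exp_ofReal_mul_I]
    linarith
  · have : Continuous fun x => Complex.exp (Complex.I * φ x p) * f p := by
      have := hc p
      fun_prop
    exact this.tendsto x₀

/-- The difference quotient of `exp(i t ω)` is bounded by `|ω|`, so `2 |ω f| = 2 |g|` is a majorant
in `L²`. -/
theorem hasDerivAt_phaseMul {α : Type*} [MeasurableSpace α] {ν : Measure α} {φ : ℝ → α → ℝ}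
    (hφ : ∀ t, Measurable (φ t)) {ω : α → ℝ} (hω : ∀ t p, φ t p = t * ω p) (f g : Lp ℂ 2 ν)
    (hg : g =ᵐ[ν] fun p => (ω p : ℂ) * f p) :
    HasDerivAt (fun t => phaseMul ν (hφ t) f) (Complex.I • g) 0 := by
  rw [hasDerivAt_iff_tendsto_slope]
  refine tendsto_Lp_two_of_dominated
    (F' := fun t p => (t⁻¹ : ℂ) * (Complex.exp (Complex.I * (t * ω p : ℝ)) - 1) * f p)
    (G' := fun p => Complex.I * (ω p : ℂ) * f p) (Eventually.of_forall fun t => ?_) ?_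
    ((Lp.memLp g).norm.const_mul 2) ?_ (Eventually.of_forall fun p => ?_)
  · have h0 : slope (fun t => phaseMul ν (hφ t) f) 0 t
        = (t⁻¹ : ℂ) • (phaseMul ν (hφ t) f - f) := by
      rw [slope_def_module, sub_zero, phaseMul_zero (hφ 0) (fun p => by rw [hω, zero_mul])]
      simp only [LinearIsometryEquiv.coe_refl, id]
      rw [← Complex.ofReal_inv]
      rfl
    rw [h0]
    filter_upwards [Lp.coeFn_smul (t⁻¹ : ℂ) (phaseMul ν (hφ t) f - f),
      Lp.coeFn_sub (phaseMul ν (hφ t) f) f, coeFn_phaseMul (hφ t) f] with p h1 h2 h3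
    rw [h1, Pi.smul_apply, h2, Pi.sub_apply, h3, smul_eq_mul, hω]
    ring
  · filter_upwards [Lp.coeFn_smul Complex.I g, hg] with p h1 h2
    rw [h1, Pi.smul_apply, h2, smul_eq_mul, mul_assoc]
  · filter_upwards [self_mem_nhdsWithin] with t ht
    filter_upwards [hg] with p hp
    have h1 : ‖Complex.exp (Complex.I * (t * ω p : ℝ)) - 1‖ ≤ |t| * |ω p| := by
      rw [← abs_mul]
      exact Real.norm_exp_I_mul_ofReal_sub_one_le
    have ht' : 0 < |t| := abs_pos.2 ht
    have h2 : ‖(t⁻¹ : ℂ) * (Complex.exp (Complex.I * (t * ω p : ℝ)) - 1)‖ ≤ |ω p| := by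
      rw [norm_mul, norm_inv, Complex.norm_real, Real.norm_eq_abs, inv_mul_le_iff₀ ht']
      exact h1
    rw [hp]
    calc _ ≤ ‖(t⁻¹ : ℂ) * (Complex.exp (Complex.I * (t * ω p : ℝ)) - 1) * f p‖
          + ‖Complex.I * (ω p : ℂ) * f p‖ := norm_sub_le _ _
      _ ≤ |ω p| * ‖f p‖ + |ω p| * ‖f p‖ := by
          refine add_le_add ?_ ?_
          · rw [norm_mul]
            exact mul_le_mul_of_nonneg_right h2 (norm_nonneg _)
          · simp
      _ = _ := by
          rw [norm_mul, Complex.norm_real, Real.norm_eq_abs]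
          ring
  · have h : HasDerivAt (fun t : ℝ => Complex.exp (Complex.I * (t * ω p : ℝ)))
        (Complex.I * ω p) 0 := by
      have h1 : HasDerivAt (fun t : ℝ => Complex.I * (t * ω p : ℝ)) (Complex.I * ω p) 0 := by
        have := ((hasDerivAt_id (0 : ℝ)).mul_const (ω p)).ofReal_comp.const_mul Complex.I
        simpa using this
      have := h1.cexp
      simpa using this
    rw [hasDerivAt_iff_tendsto_slope] at h
    refine Tendsto.mul_const _ (h.congr fun t => ?_)
    rw [slope_def_module]
    simp

/-! ### Second quantization and the field operators -/

/-- Elementary tensors are total, so a bounded operator is determined by its values on them. The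
operator identities for `tensorPow` and `leftTensor` reduce to elementary tensors in this way. -/
theorem ext_tensor {α F : Type*} [MeasurableSpace α] [NormedAddCommGroup F] [NormedSpace ℂ F]
    {μ : Measure α} [SigmaFinite μ] {k : ℕ} {S T : NPart μ k →L[ℂ] F}
    (hST : ∀ h, S (tensor μ h) = T (tensor μ h)) : S = T := by
  ext1 Ψ
  refine (denseRange_tensorSum μ k).induction_on (p := fun Ψ => S Ψ = T Ψ) Ψ
    (isClosed_eq S.continuous T.continuous) fun x => ?_
  induction x using Finsupp.induction_linear with
  | zero => simp
  | add a b ha hb => simp only [map_add, ha, hb]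
  | single h c => simp only [tensorSum, Finsupp.linearCombination_single, map_smul, hST]

theorem ae_tensor {α : Type*} [MeasurableSpace α] (μ : Measure α) [SigmaFinite μ] {k : ℕ}
    (h : Fin k → Lp ℂ 2 μ) :
    tensor μ h =ᵐ[Measure.pi fun _ : Fin k => μ] fun p => ∏ i, h i (p i) :=
  (memLp_tensor μ h).coeFn_toLp

theorem ae_pi_of_forall {α : Type*} [MeasurableSpace α] {μ : Measure α} [SigmaFinite μ] {k : ℕ}
    {P : Fin k → α → Prop} (h : ∀ i, ∀ᵐ p ∂μ, P i p) :
    ∀ᵐ p ∂(Measure.pi fun _ : Fin k => μ), ∀ i, P i (p i) := by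
  rw [ae_all_iff]
  exact fun i => (Measure.quasiMeasurePreserving_eval (fun _ : Fin k => μ) i).ae (h i)

theorem measurable_sum_phase {α : Type*} [MeasurableSpace α] {φ : α → ℝ} (hφ : Measurable φ)
    (k : ℕ) : Measurable fun p : Fin k → α => ∑ i, φ (p i) :=
  Finset.measurable_sum _ fun i _ => hφ.comp (measurable_pi_apply i)

/-- The phases of the factors multiply to the exponential of their sum. This makes second quantized
translations explicit multiplication operators. -/
theorem tensorPow_phaseMul {α : Type*} [MeasurableSpace α] (μ : Measure α) [SigmaFinite μ]
    {φ : α → ℝ} (hφ : Measurable φ) (k : ℕ) (Ψ : NPart μ k) :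
    tensorPow μ (phaseMul μ hφ) k Ψ = phaseMul _ (measurable_sum_phase hφ k) Ψ := by
  have : (tensorPow μ (phaseMul μ hφ) k).toContinuousLinearEquiv.toContinuousLinearMap
      = (phaseMul (Measure.pi fun _ : Fin k => μ)
          (measurable_sum_phase hφ k)).toContinuousLinearEquiv.toContinuousLinearMap := by
    refine ext_tensor fun h => ?_
    change tensorPow μ (phaseMul μ hφ) k (tensor μ h)
      = phaseMul _ (measurable_sum_phase hφ k) (tensor μ h)
    rw [tensorPow_tensor]
    refine Lp.ext ?_
    filter_upwards [coeFn_phaseMul (measurable_sum_phase hφ k) (tensor μ h), ae_tensor μ h,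
      ae_tensor μ fun i => phaseMul μ hφ (h i),
      ae_pi_of_forall fun i => coeFn_phaseMul hφ (h i)] with p h1 h2 h3 h4
    rw [h1, h2, h3, Finset.prod_congr rfl fun i _ => h4 i, Finset.prod_mul_distrib,
      ← Complex.exp_sum, Complex.ofReal_sum, Finset.mul_sum]
  exact DFunLike.congr_fun this Ψ

theorem permOp_permOp {α : Type*} [MeasurableSpace α] (μ : Measure α) [SigmaFinite μ] {k : ℕ}
    (σ τ : Equiv.Perm (Fin k)) (Ψ : NPart μ k) :
    permOp μ τ (permOp μ σ Ψ) = permOp μ (τ * σ) Ψ := by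
  have : (permOp μ τ).toContinuousLinearMap ∘L (permOp μ σ).toContinuousLinearMap
      = (permOp μ (τ * σ)).toContinuousLinearMap := by
    refine ext_tensor fun h => ?_
    simp only [ContinuousLinearMap.comp_apply, LinearIsometry.coe_toContinuousLinearMap,
      permOp_tensor]
    rfl
  exact DFunLike.congr_fun this Ψ

/-- The average over the group is invariant, and `⟨σΨ, Φ⟩ = ⟨Ψ, Φ⟩` for invariant `Φ` makes `Ψ`
minus its average orthogonal to the invariant vectors. Whatever commutes with permutations therefore
commutes with `P₊`. -/
theorem coe_projection_symSub {α : Type*} [MeasurableSpace α] (μ : Measure α) [SigmaFinite μ]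
    {k : ℕ} (Ψ : NPart μ k) :
    ((symSub μ k).orthogonalProjectionOnto Ψ : NPart μ k)
      = (((k.factorial : ℕ) : ℂ)⁻¹) • ∑ σ : Equiv.Perm (Fin k), permOp μ σ Ψ := by
  have hk : ((k.factorial : ℕ) : ℂ) ≠ 0 := by exact_mod_cast k.factorial_ne_zero
  refine Submodule.eq_starProjection_of_mem_of_inner_eq_zero (K := symSub μ k) ?_ ?_
  · refine Submodule.smul_mem _ _ fun τ => ?_
    rw [map_sum]
    simp only [permOp_permOp]
    exact Fintype.sum_equiv (Equiv.mulLeft τ) _ _ fun σ => rfl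
  · intro Φ hΦ
    have h1 : ∀ σ, inner ℂ (permOp μ σ Ψ) Φ = inner ℂ Ψ Φ := fun σ => by
      conv_lhs => rw [← hΦ σ, LinearIsometry.inner_map_map]
    rw [inner_sub_left, inner_smul_left, sum_inner, Finset.sum_congr rfl fun σ _ => h1 σ]
    simp only [Finset.sum_const, Finset.card_univ, Fintype.card_perm, Fintype.card_fin]
    simp only [map_inv₀, map_natCast, nsmul_eq_mul]
    rw [inv_mul_cancel_left₀ hk, sub_self]

theorem projection_tensorPow {α : Type*} [MeasurableSpace α] (μ : Measure α) [SigmaFinite μ]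
    (V : Lp ℂ 2 μ ≃ₗᵢ[ℂ] Lp ℂ 2 μ) {k : ℕ} (Ψ : NPart μ k) :
    (symSub μ k).orthogonalProjectionOnto (tensorPow μ V k Ψ)
      = symPow μ V k ((symSub μ k).orthogonalProjectionOnto Ψ) := by
  ext1
  change _ = tensorPow μ V k ((symSub μ k).orthogonalProjectionOnto Ψ : NPart μ k)
  rw [coe_projection_symSub, coe_projection_symSub, map_smul, map_sum]
  simp only [tensorPow_permOp]

theorem symPow_symTensor {α : Type*} [MeasurableSpace α] (μ : Measure α) [SigmaFinite μ]
    (V : Lp ℂ 2 μ ≃ₗᵢ[ℂ] Lp ℂ 2 μ) {k : ℕ} (h : Fin k → Lp ℂ 2 μ) :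
    symPow μ V k (symTensor μ h) = symTensor μ fun i => V (h i) := by
  unfold symTensor
  rw [← projection_tensorPow, tensorPow_tensor]

theorem ae_leftTensor {α : Type*} [MeasurableSpace α] (μ : Measure α) [SigmaFinite μ] {k : ℕ}
    (g : Lp ℂ 2 μ) (Ψ : NPart μ k) :
    leftTensor μ g k Ψ =ᵐ[Measure.pi fun _ : Fin (k + 1) => μ]
      fun p => g (p 0) * Ψ (Fin.tail p) :=
  (memLp_leftTensor μ g Ψ).coeFn_toLp

theorem ae_tail {α : Type*} [MeasurableSpace α] {μ : Measure α} [SigmaFinite μ] {k : ℕ}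
    {P : (Fin k → α) → Prop} (h : ∀ᵐ p ∂(Measure.pi fun _ : Fin k => μ), P p) :
    ∀ᵐ p ∂(Measure.pi fun _ : Fin (k + 1) => μ), P (Fin.tail p) :=
  (measurePreserving_cons μ k).quasiMeasurePreserving.ae (Measure.quasiMeasurePreserving_snd.ae h)

theorem leftTensor_tensor {α : Type*} [MeasurableSpace α] (μ : Measure α) [SigmaFinite μ] {k : ℕ}
    (g : Lp ℂ 2 μ) (h : Fin k → Lp ℂ 2 μ) :
    leftTensor μ g k (tensor μ h) = tensor μ (Fin.cons g h : Fin (k + 1) → Lp ℂ 2 μ) := by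
  refine Lp.ext ?_
  filter_upwards [ae_leftTensor μ g (tensor μ h), ae_tail (ae_tensor μ h),
    ae_tensor μ (Fin.cons g h : Fin (k + 1) → Lp ℂ 2 μ)] with p h1 h2 h3
  rw [h1, h2, h3, Fin.prod_univ_succ]
  rfl

theorem tensorPow_leftTensor {α : Type*} [MeasurableSpace α] (μ : Measure α) [SigmaFinite μ]
    (V : Lp ℂ 2 μ ≃ₗᵢ[ℂ] Lp ℂ 2 μ) {k : ℕ} (g : Lp ℂ 2 μ) (Ψ : NPart μ k) :
    tensorPow μ V (k + 1) (leftTensor μ g k Ψ) = leftTensor μ (V g) k (tensorPow μ V k Ψ) := by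
  have : (tensorPow μ V (k + 1)).toContinuousLinearEquiv.toContinuousLinearMap
        ∘L leftTensor μ g k
      = leftTensor μ (V g) k
        ∘L (tensorPow μ V k).toContinuousLinearEquiv.toContinuousLinearMap := by
    refine ext_tensor fun h => ?_
    change tensorPow μ V (k + 1) (leftTensor μ g k (tensor μ h))
      = leftTensor μ (V g) k (tensorPow μ V k (tensor μ h))
    rw [leftTensor_tensor, tensorPow_tensor, tensorPow_tensor, leftTensor_tensor]
    congr 1
    funext i
    refine Fin.cases ?_ (fun j => ?_) i <;> simp
  exact DFunLike.congr_fun this Ψ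

theorem creation_apply {α : Type*} [MeasurableSpace α] (μ : Measure α) [SigmaFinite μ]
    (g : Lp ℂ 2 μ) (k : ℕ) (ψ : symSub μ k) :
    creation μ g k ψ = ((Real.sqrt (k + 1) : ℝ) : ℂ) •
      (symSub μ (k + 1)).orthogonalProjectionOnto (leftTensor μ g k ψ) :=
  rfl

/-- `P₊` is self-adjoint and acts trivially on symmetric vectors. So the adjoint of `√(k+1) P₊ (g ⊗
·)` can be computed on the full tensor space, where phases act by multiplication. -/
theorem annihilation_apply {α : Type*} [MeasurableSpace α] (μ : Measure α) [SigmaFinite μ]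
    (g : Lp ℂ 2 μ) (k : ℕ) (ψ : symSub μ (k + 1)) :
    annihilation μ g k ψ = ((Real.sqrt (k + 1) : ℝ) : ℂ) •
      (symSub μ k).orthogonalProjectionOnto
        (ContinuousLinearMap.adjoint (leftTensor μ g k) ψ) := by
  refine ext_inner_left ℂ fun Φ => ?_
  unfold annihilation
  rw [ContinuousLinearMap.adjoint_inner_right, creation_apply, Submodule.coe_inner,
    Submodule.coe_inner, Submodule.coe_smul, Submodule.coe_smul, inner_smul_left,
    inner_smul_right, Complex.conj_ofReal, ← Submodule.coe_inner, ← Submodule.coe_inner,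
    Submodule.inner_orthogonalProjectionOnto_eq_of_mem_right,
    Submodule.inner_orthogonalProjectionOnto_eq_of_mem_left,
    ContinuousLinearMap.adjoint_inner_right]

theorem symPow_creation {α : Type*} [MeasurableSpace α] (μ : Measure α) [SigmaFinite μ]
    (V : Lp ℂ 2 μ ≃ₗᵢ[ℂ] Lp ℂ 2 μ) (g : Lp ℂ 2 μ) (k : ℕ) (ψ : symSub μ k) :
    symPow μ V (k + 1) (creation μ g k ψ) = creation μ (V g) k (symPow μ V k ψ) := by
  rw [creation_apply, creation_apply, map_smul, ← projection_tensorPow, tensorPow_leftTensor]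
  rfl

/-- Adjoint form of `symPow_creation`: by unitarity the test vector may be taken in the form `V^{⊗k}
Φ`. -/
theorem symPow_annihilation {α : Type*} [MeasurableSpace α] (μ : Measure α) [SigmaFinite μ]
    (V : Lp ℂ 2 μ ≃ₗᵢ[ℂ] Lp ℂ 2 μ) (g : Lp ℂ 2 μ) (k : ℕ) (ψ : symSub μ (k + 1)) :
    symPow μ V k (annihilation μ g k ψ) = annihilation μ (V g) k (symPow μ V (k + 1) ψ) := by
  refine ext_inner_left ℂ fun Φ => ?_
  obtain ⟨Φ, rfl⟩ := (symPow μ V k).surjective Φ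
  unfold annihilation
  rw [LinearIsometryEquiv.inner_map_map, ContinuousLinearMap.adjoint_inner_right,
    ContinuousLinearMap.adjoint_inner_right, ← symPow_creation, LinearIsometryEquiv.inner_map_map]

theorem secondQuant_apply {α : Type*} [MeasurableSpace α] (μ : Measure α) [SigmaFinite μ]
    (V : Lp ℂ 2 μ ≃ₗᵢ[ℂ] Lp ℂ 2 μ) (Ψ : Fock μ) (k : ℕ) :
    secondQuant μ V Ψ k = symPow μ V k (Ψ k) :=
  rfl

theorem tensorPow_tensorPow {α : Type*} [MeasurableSpace α] (μ : Measure α) [SigmaFinite μ]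
    {U V W : Lp ℂ 2 μ ≃ₗᵢ[ℂ] Lp ℂ 2 μ} (h : ∀ x, U (V x) = W x) {k : ℕ} (Ψ : NPart μ k) :
    tensorPow μ U k (tensorPow μ V k Ψ) = tensorPow μ W k Ψ := by
  have : (tensorPow μ U k).toContinuousLinearEquiv.toContinuousLinearMap
        ∘L (tensorPow μ V k).toContinuousLinearEquiv.toContinuousLinearMap
      = (tensorPow μ W k).toContinuousLinearEquiv.toContinuousLinearMap := by
    refine ext_tensor fun g => ?_
    change tensorPow μ U k (tensorPow μ V k (tensor μ g)) = tensorPow μ W k (tensor μ g)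
    simp only [tensorPow_tensor, h]
  exact DFunLike.congr_fun this Ψ

theorem tensorPow_refl {α : Type*} [MeasurableSpace α] (μ : Measure α) [SigmaFinite μ] {k : ℕ}
    (Ψ : NPart μ k) : tensorPow μ (LinearIsometryEquiv.refl ℂ _) k Ψ = Ψ := by
  have : (tensorPow μ (LinearIsometryEquiv.refl ℂ _) k).toContinuousLinearEquiv.toContinuousLinearMap
      = ContinuousLinearMap.id ℂ _ := by
    refine ext_tensor fun g => ?_
    change tensorPow μ _ k (tensor μ g) = tensor μ g
    simp only [tensorPow_tensor, LinearIsometryEquiv.coe_refl, id]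
  exact DFunLike.congr_fun this Ψ

theorem secondQuant_secondQuant {α : Type*} [MeasurableSpace α] (μ : Measure α) [SigmaFinite μ]
    {U V W : Lp ℂ 2 μ ≃ₗᵢ[ℂ] Lp ℂ 2 μ} (h : ∀ x, U (V x) = W x) (Ψ : Fock μ) :
    secondQuant μ U (secondQuant μ V Ψ) = secondQuant μ W Ψ := by
  ext1
  funext k
  ext1
  exact tensorPow_tensorPow μ h _

theorem secondQuant_refl {α : Type*} [MeasurableSpace α] (μ : Measure α) [SigmaFinite μ] :
    secondQuant μ (LinearIsometryEquiv.refl ℂ _) = LinearIsometryEquiv.refl ℂ (Fock μ) := by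
  ext1 Ψ
  ext1
  funext k
  ext1
  exact tensorPow_refl μ _

theorem secondQuant_symm {α : Type*} [MeasurableSpace α] (μ : Measure α) [SigmaFinite μ]
    (V : Lp ℂ 2 μ ≃ₗᵢ[ℂ] Lp ℂ 2 μ) : (secondQuant μ V).symm = secondQuant μ V.symm := by
  ext1 Ψ
  apply (secondQuant μ V).injective
  rw [LinearIsometryEquiv.apply_symm_apply,
    secondQuant_secondQuant μ (W := LinearIsometryEquiv.refl ℂ _) (fun x => by simp),
    secondQuant_refl]
  rfl

theorem secondQuant_single {α : Type*} [MeasurableSpace α] (μ : Measure α) [SigmaFinite μ]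
    (V : Lp ℂ 2 μ ≃ₗᵢ[ℂ] Lp ℂ 2 μ) (k : ℕ) (ψ : symSub μ k) :
    secondQuant μ V (lp.single 2 k ψ) = lp.single 2 k (symPow μ V k ψ) := by
  ext1
  funext j
  rw [secondQuant_apply]
  by_cases h : j = k
  · subst h
    rw [lp.single_apply_self, lp.single_apply_self]
  · rw [lp.single_apply_ne _ _ _ h, lp.single_apply_ne _ _ _ h, map_zero]

theorem secondQuant_mem_finiteParticle {α : Type*} [MeasurableSpace α] (μ : Measure α)
    [SigmaFinite μ] (V : Lp ℂ 2 μ ≃ₗᵢ[ℂ] Lp ℂ 2 μ) {Ψ : Fock μ} (hΨ : Ψ ∈ finiteParticle μ) :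
    secondQuant μ V Ψ ∈ finiteParticle μ := by
  obtain ⟨N, hN⟩ := hΨ
  exact ⟨N, fun k hk => by rw [secondQuant_apply, hN k hk, map_zero]⟩

theorem symPow_fieldSeq {α : Type*} [MeasurableSpace α] (μ : Measure α) [SigmaFinite μ]
    (V : Lp ℂ 2 μ ≃ₗᵢ[ℂ] Lp ℂ 2 μ) (g h : Lp ℂ 2 μ) (Ψ : Fock μ) (k : ℕ) :
    symPow μ V k (fieldSeq μ g h Ψ k) = fieldSeq μ (V g) (V h) (secondQuant μ V Ψ) k := by
  cases k with
  | zero => exact symPow_annihilation μ V g 0 _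
  | succ k =>
    simp only [fieldSeq, map_add, symPow_annihilation, symPow_creation, secondQuant_apply]

/-- `Γ(V) (a(g) + a*(h)) Γ(V⁻¹) = a(V g) + a*(V h)`. -/
theorem sandwich_field {α : Type*} [MeasurableSpace α] (μ : Measure α) [SigmaFinite μ]
    (V : Lp ℂ 2 μ ≃ₗᵢ[ℂ] Lp ℂ 2 μ) (g h : Lp ℂ 2 μ) :
    sandwich (secondQuant μ V) (field μ g h) (secondQuant μ V.symm)
      = field μ (V g) (V h) := by
  refine LinearPMap.ext ?_ ?_
  · ext Ψ
    constructor
    · intro hΨ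
      have := secondQuant_mem_finiteParticle μ V (Ψ := secondQuant μ V.symm Ψ) hΨ
      rwa [← secondQuant_symm, LinearIsometryEquiv.apply_symm_apply] at this
    · exact fun hΨ => secondQuant_mem_finiteParticle μ V.symm (Ψ := Ψ) hΨ
  · intro Ψ h1 h2
    ext1
    funext k
    change symPow μ V k (fieldSeq μ g h (secondQuant μ V.symm Ψ) k)
      = fieldSeq μ (V g) (V h) Ψ k
    rw [symPow_fieldSeq, ← secondQuant_symm, LinearIsometryEquiv.apply_symm_apply]

/-! ### Uniqueness of generated unitary groups -/

section UnitaryExp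

variable {H : Type*} [NormedAddCommGroup H] [InnerProductSpace ℂ H] {d : ℕ}
  {A : Fin d → H →ₗ.[ℂ] H} {W W₁ W₂ : EuclideanSpace ℝ (Fin d) → H ≃ₗᵢ[ℂ] H}

theorem IsUnitaryExp.add_apply (h : IsUnitaryExp A W) (x y : EuclideanSpace ℝ (Fin d)) (Ψ : H) :
    W (x + y) Ψ = W x (W y Ψ) := by
  rw [h.map_add]
  rfl

theorem IsUnitaryExp.zero_apply (h : IsUnitaryExp A W) (Ψ : H) : W 0 Ψ = Ψ := by
  rw [h.map_zero]
  rfl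

/-- Since `W₂(-s)` is isometric, `‖W₂(-s) W₁(s) Ψ - Ψ‖ = ‖W₁(s) Ψ - W₂(s) Ψ‖`, and this is `o(s)`
because both orbits have the same derivative at `0`. -/
theorem IsUnitaryExp.hasDerivAt_neg_comp (h₁ : IsUnitaryExp A W₁) (h₂ : IsUnitaryExp A W₂)
    (μ : Fin d) (Ψ : (A μ).domain) :
    HasDerivAt (fun s : ℝ => W₂ (-(s • EuclideanSpace.single μ 1))
      (W₁ (s • EuclideanSpace.single μ 1) (Ψ : H))) 0 0 := by
  have hu := (h₁.hasDerivAt μ Ψ).sub (h₂.hasDerivAt μ Ψ)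
  rw [sub_self] at hu
  rw [hasDerivAt_iff_isLittleO] at hu ⊢
  refine (Asymptotics.isBigO_of_le _ fun s => ?_).trans_isLittleO hu
  simp only [smul_zero, sub_zero, zero_smul, neg_zero, h₁.zero_apply, h₂.zero_apply, sub_self,
    Pi.sub_apply]
  have : (Ψ : H) = W₂ (-(s • EuclideanSpace.single μ 1))
      (W₂ (s • EuclideanSpace.single μ 1) (Ψ : H)) := by
    rw [← h₂.add_apply, neg_add_cancel, h₂.zero_apply]
  conv_lhs => rw [this]
  rw [← map_sub, LinearIsometryEquiv.norm_map, ← this]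

/-- Two unitary groups generated by the same operators agree if the operators are defined on a
dense set that is invariant under one of the groups. -/
theorem IsUnitaryExp.eq_of_invariant (h₁ : IsUnitaryExp A W₁) (h₂ : IsUnitaryExp A W₂) {D : Set H}
    (hD : Dense D) (hdom : ∀ Ψ ∈ D, ∀ μ, Ψ ∈ (A μ).domain) (hinv : ∀ Ψ ∈ D, ∀ x, W₁ x Ψ ∈ D) :
    W₁ = W₂ := by
  have hline : ∀ (μ : Fin d) (t : ℝ),
      W₁ (t • EuclideanSpace.single μ 1) = W₂ (t • EuclideanSpace.single μ 1) := by
    intro μ t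
    set e : EuclideanSpace ℝ (Fin d) := EuclideanSpace.single μ 1
    ext1 Ψ
    refine hD.induction (P := fun Ψ => W₁ (t • e) Ψ = W₂ (t • e) Ψ) (fun Ψ hΨ => ?_)
      (isClosed_eq (W₁ (t • e)).continuous (W₂ (t • e)).continuous) Ψ
    -- The derivative at `r` reduces to the one at `0` through `W₂(-s) W₁(s) Ψ = W₂(-r) [W₂(-(s-r))
    -- W₁(s-r)] W₁(r) Ψ`. Invariance of `D` keeps `W₁(r) Ψ` in the domain.
    have hd : ∀ r : ℝ, HasDerivAt (fun s : ℝ => W₂ (-(s • e)) (W₁ (s • e) Ψ)) 0 r := by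
      intro r
      have h0 := h₁.hasDerivAt_neg_comp h₂ μ ⟨W₁ (r • e) Ψ, hdom _ (hinv Ψ hΨ _) μ⟩
      have h0' := HasFDerivAt.comp_hasDerivAt (0 : ℝ)
        ((((W₂ (-(r • e))).toContinuousLinearEquiv.toContinuousLinearMap).restrictScalars
          ℝ).hasFDerivAt) h0
      rw [_root_.map_zero] at h0'
      have h1 : HasDerivAt (fun s : ℝ => s - r) 1 r := (hasDerivAt_id r).sub_const r
      rw [show (0 : ℝ) = r - r by ring] at h0'
      have h2 := HasDerivAt.scomp (h := fun s : ℝ => s - r) r h0' h1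
      rw [smul_zero] at h2
      convert h2 using 1
      funext s
      change _ = W₂ (-(r • e)) (W₂ (-((s - r) • e)) (W₁ ((s - r) • e) (W₁ (r • e) Ψ)))
      rw [← h₁.add_apply, ← h₂.add_apply, ← add_smul, ← neg_add, ← add_smul, sub_add_cancel,
        add_sub_cancel]
    have hc := is_const_of_deriv_eq_zero (fun r => (hd r).differentiableAt)
      (fun r => (hd r).deriv) t 0
    simp only [zero_smul, neg_zero, h₁.zero_apply, h₂.zero_apply] at hc
    conv_rhs => rw [← hc]
    rw [← h₂.add_apply, add_neg_cancel, h₂.zero_apply]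
  funext x
  have hx : x = ∑ μ, x μ • EuclideanSpace.single μ (1 : ℝ) := by
    ext i
    simp [Finset.sum_apply, Pi.single_apply]
  -- The group law extends agreement on the coordinate axes to all of `ℝ^d`.
  have hs : ∀ s : Finset (Fin d), W₁ (∑ μ ∈ s, x μ • EuclideanSpace.single μ (1 : ℝ))
      = W₂ (∑ μ ∈ s, x μ • EuclideanSpace.single μ (1 : ℝ)) := by
    intro s
    induction s using Finset.induction_on with
    | empty => rw [Finset.sum_empty, h₁.map_zero, h₂.map_zero]
    | insert μ s hμ ih =>
      rw [Finset.sum_insert hμ, h₁.map_add, h₂.map_add, hline, ih]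
  rw [hx]
  exact hs _

theorem isUnitaryExp_unitaryExp (h : IsUnitaryExp A W) : IsUnitaryExp A (unitaryExp A) := by
  have hex : ∃ W, IsUnitaryExp A W := ⟨W, h⟩
  unfold unitaryExp
  rw [dif_pos hex]
  exact hex.choose_spec

theorem IsUnitaryExp.conj (h : IsUnitaryExp A W) (S : H ≃ₗᵢ[ℂ] H) :
    IsUnitaryExp (fun μ => sandwich S.symm (A μ) S) fun x => S.trans ((W x).trans S.symm) where
  map_zero := by
    ext1 Ψ
    simp [h.map_zero]
  map_add x y := by
    ext1 Ψ
    simp [h.map_add]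
  continuous Ψ := S.symm.continuous.comp (h.continuous (S Ψ))
  hasDerivAt μ Ψ := by
    have h0 : HasDerivAt (fun t : ℝ => S.symm (W (t • EuclideanSpace.single μ 1) (S Ψ)))
        (S.symm (Complex.I • A μ ⟨S Ψ, Ψ.2⟩)) 0 :=
      HasFDerivAt.comp_hasDerivAt (0 : ℝ)
        (((S.symm.toContinuousLinearEquiv.toContinuousLinearMap).restrictScalars ℝ).hasFDerivAt)
        (h.hasDerivAt μ ⟨S Ψ, Ψ.2⟩)
    rw [map_smul] at h0
    exact h0

end UnitaryExp

/-! ### Transport of deformed operators by unitaries -/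

section Warped

variable {H : Type*} [NormedAddCommGroup H] [InnerProductSpace ℂ H] {n : ℕ}
  {θ : Matrix (Fin (n + 1)) (Fin (n + 1)) ℝ} {W : EuclideanSpace ℝ (Fin (n + 1)) → H ≃ₗᵢ[ℂ] H}
  {A : H →ₗ.[ℂ] H} {Ψ Φ : H}

/-- The two domains correspond under `S`, so the default value `0` of `evalAt` occurs on both sides
simultaneously. The identity thus holds without a domain hypothesis. -/
theorem evalAt_sandwich_conj (S T U : H ≃ₗᵢ[ℂ] H) (A : H →ₗ.[ℂ] H) (Ψ : H) :
    evalAt (sandwich (S.trans (T.trans S.symm)) (sandwich S.symm A S)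
      (S.trans (T.trans S.symm)).symm) ((S.trans (U.trans S.symm)) Ψ)
      = S.symm (evalAt (sandwich T A T.symm) (U (S Ψ))) := by
  by_cases h : T.symm (U (S Ψ)) ∈ A.domain
  · have h1 : U (S Ψ) ∈ (sandwich T A T.symm).domain := h
    have h2 : (S.trans (U.trans S.symm)) Ψ ∈ (sandwich (S.trans (T.trans S.symm))
        (sandwich S.symm A S) (S.trans (T.trans S.symm)).symm).domain := by
      change S (S.symm (T.symm (S (S.symm (U (S Ψ)))))) ∈ A.domain
      simpa using h
    unfold evalAt
    rw [dif_pos h1, dif_pos h2]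
    change S.symm (T (S (S.symm (A ⟨S (S.symm (T.symm (S (S.symm (U (S Ψ)))))), _⟩))))
      = S.symm (T (A ⟨T.symm (U (S Ψ)), h⟩))
    simp
  · have h1 : U (S Ψ) ∉ (sandwich T A T.symm).domain := h
    have h2 : (S.trans (U.trans S.symm)) Ψ ∉ (sandwich (S.trans (T.trans S.symm))
        (sandwich S.symm A S) (S.trans (T.trans S.symm)).symm).domain := by
      intro h2
      change S (S.symm (T.symm (S (S.symm (U (S Ψ)))))) ∈ A.domain at h2
      exact h (by simpa using h2)
    unfold evalAt
    rw [dif_neg h1, dif_neg h2, map_zero]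

theorem warpedIntegrand_conj (S : H ≃ₗᵢ[ℂ] H)
    (χ : 𝓢(EuclideanSpace ℝ (Fin (n + 1)) × EuclideanSpace ℝ (Fin (n + 1)), ℂ)) (ε : ℝ) :
    warpedIntegrand θ (fun x => S.trans ((W x).trans S.symm)) (sandwich S.symm A S) Ψ χ ε
      = fun z => S.symm (warpedIntegrand θ W A (S Ψ) χ ε z) := by
  funext z
  unfold warpedIntegrand
  rw [evalAt_sandwich_conj, LinearIsometryEquiv.map_smul]

/-- The transport principle behind the main theorem: group, operator and vector are conjugated
together, and each clause of the definition is preserved by a unitary. -/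
theorem HasWarpedValue.conj (S : H ≃ₗᵢ[ℂ] H) (h : HasWarpedValue θ W A (S Ψ) Φ) :
    HasWarpedValue θ (fun x => S.trans ((W x).trans S.symm)) (sandwich S.symm A S) Ψ
      (S.symm Φ) where
  mem_domain x y := by
    have := h.mem_domain x y
    change (W (θ.toEuclideanLin x)).symm (W y (S Ψ)) ∈ A.domain at this
    change S (S.symm ((W (θ.toEuclideanLin x)).symm (S (S.symm (W y (S Ψ)))))) ∈ A.domain
    simpa using this
  integrable χ hχ ε hε := by
    rw [warpedIntegrand_conj]
    exact S.symm.toContinuousLinearEquiv.toContinuousLinearMap.integrable_comp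
      (h.integrable χ hχ ε hε)
  tendsto χ hχ := by
    have h1 := (S.symm.continuous.tendsto Φ).comp (h.tendsto χ hχ)
    refine h1.congr fun ε => ?_
    rw [warpedIntegrand_conj, Function.comp_apply, LinearIsometryEquiv.map_smul]
    congr 1
    -- An invertible operator commutes with the integral even when the integrand is not integrable,
    -- so `ε = 0` needs no exception.
    exact (ContinuousLinearEquiv.integral_comp_comm S.symm.toContinuousLinearEquiv _).symm

/-- Without an admissible cutoff the limit condition in `HasWarpedValue` would be vacuous, and the
deformed value would not be unique. -/
theorem exists_schwartz_eq_one (E : Type*) [NormedAddCommGroup E] [NormedSpace ℝ E]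
    [FiniteDimensional ℝ E] : ∃ χ : 𝓢(E, ℂ), χ 0 = 1 := by
  let b : ContDiffBump (0 : E) := ⟨1, 2, one_pos, one_lt_two⟩
  have h1 : HasCompactSupport fun x => (b x : ℂ) :=
    b.hasCompactSupport.comp_left (g := fun x : ℝ => (x : ℂ)) Complex.ofReal_zero
  have h2 : ContDiff ℝ (⊤ : ℕ∞) fun x => (b x : ℂ) := Complex.ofRealCLM.contDiff.comp b.contDiff
  refine ⟨h1.toSchwartzMap h2, ?_⟩
  change ((b 0 : ℝ) : ℂ) = 1
  rw [b.one_of_mem_closedBall (Metric.mem_closedBall_self b.rIn_pos.le), Complex.ofReal_one]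

theorem HasWarpedValue.warped_eq (h : HasWarpedValue θ W A Ψ Φ) : warped θ W A Ψ = Φ := by
  have hex : ∃ Φ, HasWarpedValue θ W A Ψ Φ := ⟨Φ, h⟩
  obtain ⟨χ, hχ⟩ := exists_schwartz_eq_one
    (EuclideanSpace ℝ (Fin (n + 1)) × EuclideanSpace ℝ (Fin (n + 1)))
  unfold warped
  rw [dif_pos hex]
  exact tendsto_nhds_unique (hex.choose_spec.tendsto χ hχ) (h.tendsto χ hχ)

end Warped

/-! ### The tensor map is continuous and multilinear -/

/-- Isolates the dependence on one factor. It gives multilinearity of `tensor` as well as the action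
of a momentum on a single particle. -/
theorem tensor_update {α : Type*} [MeasurableSpace α] (μ : Measure α) [SigmaFinite μ] {k : ℕ}
    (h : Fin k → Lp ℂ 2 μ) (i : Fin k) (v : Lp ℂ 2 μ) :
    tensor μ (Function.update h i v) =ᵐ[Measure.pi fun _ : Fin k => μ]
      fun p => v (p i) * ∏ j ∈ Finset.univ.erase i, h j (p j) := by
  filter_upwards [ae_tensor μ (Function.update h i v)] with p hp
  rw [hp, ← Finset.mul_prod_erase _ _ (Finset.mem_univ i), Function.update_self]
  congr 1
  refine Finset.prod_congr rfl fun j hj => ?_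
  rw [Function.update_of_ne (Finset.ne_of_mem_erase hj)]

theorem ae_eval {α : Type*} [MeasurableSpace α] {μ : Measure α} [SigmaFinite μ] {k : ℕ}
    (i : Fin k) {P : α → Prop} (h : ∀ᵐ p ∂μ, P p) :
    ∀ᵐ p ∂(Measure.pi fun _ : Fin k => μ), P (p i) :=
  (Measure.quasiMeasurePreserving_eval (fun _ : Fin k => μ) i).ae h

theorem norm_tensor {α : Type*} [MeasurableSpace α] (μ : Measure α) [SigmaFinite μ] {k : ℕ}
    (h : Fin k → Lp ℂ 2 μ) : ‖tensor μ h‖ = ∏ i, ‖h i‖ := by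
  have h1 := inner_tensor μ h h
  simp only [inner_self_eq_norm_sq_to_K, Finset.prod_pow] at h1
  have h2 : ‖tensor μ h‖ ^ 2 = (∏ i, ‖h i‖) ^ 2 := by exact_mod_cast h1
  exact (sq_eq_sq₀ (norm_nonneg _) (Finset.prod_nonneg fun i _ => norm_nonneg _)).1 h2

/-- A multilinear map whose norm is the product of the norms. Continuity allows density of `Δ(P)` to
pass to tensors of vectors in `Δ(P)`. -/
theorem continuous_tensor {α : Type*} [MeasurableSpace α] (μ : Measure α) [SigmaFinite μ] (k : ℕ) :
    Continuous fun h : Fin k → Lp ℂ 2 μ => tensor μ h := by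
  let M : MultilinearMap ℂ (fun _ : Fin k => Lp ℂ 2 μ) (NPart μ k) :=
    { toFun := tensor μ
      map_update_add' := by
        intro inst h i x y
        obtain rfl : inst = instDecidableEqFin k := Subsingleton.elim _ _
        refine Lp.ext ?_
        filter_upwards [tensor_update μ h i (x + y), tensor_update μ h i x, tensor_update μ h i y,
          Lp.coeFn_add (tensor μ (Function.update h i x)) (tensor μ (Function.update h i y)),
          ae_eval i (Lp.coeFn_add x y)] with p h1 h2 h3 h4 h5
        rw [h1, h4, Pi.add_apply, h2, h3, h5, Pi.add_apply, add_mul]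
      map_update_smul' := by
        intro inst h i c x
        obtain rfl : inst = instDecidableEqFin k := Subsingleton.elim _ _
        refine Lp.ext ?_
        filter_upwards [tensor_update μ h i (c • x), tensor_update μ h i x,
          Lp.coeFn_smul c (tensor μ (Function.update h i x)),
          ae_eval i (Lp.coeFn_smul c x)] with p h1 h2 h3 h4
        rw [h1, h3, Pi.smul_apply, h2, h4, Pi.smul_apply, smul_eq_mul, smul_eq_mul, mul_assoc] }
  exact (M.mkContinuous 1 fun h => by rw [one_mul]; exact (norm_tensor μ h).le).cont

/-! ### Fock space components -/

/-- The map from `k`-particle functions to Fock space, `Ψ ↦ P₊ Ψ`. -/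
def component {α : Type*} [MeasurableSpace α] (μ : Measure α) [SigmaFinite μ] (k : ℕ) :
    NPart μ k →L[ℂ] Fock μ :=
  lp.singleContinuousLinearMap ℂ (fun k : ℕ => symSub μ k) 2 k
    ∘L (symSub μ k).orthogonalProjectionOnto

theorem component_apply {α : Type*} [MeasurableSpace α] (μ : Measure α) [SigmaFinite μ] (k : ℕ)
    (Ψ : NPart μ k) :
    component μ k Ψ = lp.single 2 k ((symSub μ k).orthogonalProjectionOnto Ψ) :=
  rfl

theorem component_coe {α : Type*} [MeasurableSpace α] (μ : Measure α) [SigmaFinite μ] (k : ℕ)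
    (ψ : symSub μ k) : component μ k ψ = lp.single 2 k ψ := by
  rw [component_apply, Submodule.orthogonalProjectionOnto_mem_subspace_eq_self]

theorem component_tensorPow {α : Type*} [MeasurableSpace α] (μ : Measure α) [SigmaFinite μ]
    (V : Lp ℂ 2 μ ≃ₗᵢ[ℂ] Lp ℂ 2 μ) (k : ℕ) (Ψ : NPart μ k) :
    component μ k (tensorPow μ V k Ψ) = secondQuant μ V (component μ k Ψ) := by
  rw [component_apply, component_apply, secondQuant_single, projection_tensorPow]

theorem eq_sum_component {α : Type*} [MeasurableSpace α] (μ : Measure α) [SigmaFinite μ]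
    {Ψ : Fock μ} {N : ℕ} (hN : ∀ k, N ≤ k → Ψ k = 0) :
    Ψ = ∑ k ∈ Finset.range N, component μ k (Ψ k) := by
  have h := lp.hasSum_single (p := 2) ENNReal.ofNat_ne_top Ψ
  refine h.unique ?_
  simp only [component_coe]
  refine hasSum_sum_of_ne_finset_zero fun k hk => ?_
  rw [hN k (by simpa using hk), lp.single_zero]

theorem single_mem_finiteParticle {α : Type*} [MeasurableSpace α] (μ : Measure α) [SigmaFinite μ]
    (k : ℕ) (ψ : symSub μ k) : (lp.single 2 k ψ : Fock μ) ∈ finiteParticle μ :=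
  ⟨k + 1, fun j hj => lp.single_apply_ne _ _ _ (by omega)⟩

/-- Truncating `Ψ` to finitely many particle numbers gives continuous functions. Because every `Γ(V
x)` is isometric, the truncation error is uniform in `x`, and uniform limits of continuous functions
are continuous. -/
theorem continuous_secondQuant {α X : Type*} [MeasurableSpace α] (μ : Measure α) [SigmaFinite μ]
    [TopologicalSpace X] {V : X → Lp ℂ 2 μ ≃ₗᵢ[ℂ] Lp ℂ 2 μ}
    (hV : ∀ k (Ψ : NPart μ k), Continuous fun x => tensorPow μ (V x) k Ψ) (Ψ : Fock μ) :
    Continuous fun x => secondQuant μ (V x) Ψ := by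
  have hs := lp.hasSum_single (p := 2) ENNReal.ofNat_ne_top Ψ
  have hf : ∀ s : Finset ℕ,
      Continuous fun x => secondQuant μ (V x) (∑ k ∈ s, lp.single 2 k (Ψ k)) := by
    intro s
    simp only [map_sum]
    refine continuous_finsetSum _ fun k _ => ?_
    simp only [← component_coe, ← component_tensorPow]
    exact (component μ k).continuous.comp (hV k _)
  refine continuous_of_uniform_approx_of_continuous fun u hu => ?_
  obtain ⟨ε, hε, hu⟩ := Metric.mem_uniformity_dist.1 hu
  have hev := (Metric.tendsto_nhds.1 hs ε hε)
  obtain ⟨s, h⟩ := hev.exists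
  refine ⟨_, hf s, fun x => hu ?_⟩
  rw [LinearIsometryEquiv.dist_map, dist_comm]
  exact h

/-! ### The translation group of the free field -/

theorem mink_add_left {n : ℕ} (x y z : EuclideanSpace ℝ (Fin (n + 1))) :
    mink (x + y) z = mink x z + mink y z := by
  simp only [mink, PiLp.add_apply, add_mul, Finset.sum_add_distrib]
  ring

theorem mink_smul_left {n : ℕ} (c : ℝ) (x z : EuclideanSpace ℝ (Fin (n + 1))) :
    mink (c • x) z = c * mink x z := by
  simp only [mink, PiLp.smul_apply, smul_eq_mul, mul_assoc, ← Finset.mul_sum]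
  ring

theorem mink_comm {n : ℕ} (x z : EuclideanSpace ℝ (Fin (n + 1))) : mink x z = mink z x := by
  simp only [mink, mul_comm]

theorem mink_sum_right {n k : ℕ} (x : EuclideanSpace ℝ (Fin (n + 1)))
    (z : Fin k → EuclideanSpace ℝ (Fin (n + 1))) :
    mink x (∑ i, z i) = ∑ i, mink x (z i) := by
  let L : EuclideanSpace ℝ (Fin (n + 1)) →+ ℝ :=
    { toFun := fun z => mink x z
      map_zero' := by simp [mink]
      map_add' := fun y z => by simp only [mink_comm x, mink_add_left] }
  exact map_sum L z Finset.univ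

theorem continuous_mink {n : ℕ} :
    Continuous fun z : EuclideanSpace ℝ (Fin (n + 1)) × EuclideanSpace ℝ (Fin (n + 1)) =>
      mink z.1 z.2 := by
  unfold mink
  fun_prop

theorem measurable_mink_shellPoint {n : ℕ} (m : ℝ) (y : EuclideanSpace ℝ (Fin (n + 1))) :
    Measurable fun p : EuclideanSpace ℝ (Fin n) => mink y (shellPoint m p) :=
  (continuous_mink.comp (continuous_const.prodMk (continuous_shellPoint m))).measurable

/-- The one-particle translation `(U(y) h)(p) = exp(i y p) h(p)`. -/
def translation (n : ℕ) (m : ℝ) (y : EuclideanSpace ℝ (Fin (n + 1))) :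
    OneParticle n m ≃ₗᵢ[ℂ] OneParticle n m :=
  phaseMul (shellMeasure n m) (measurable_mink_shellPoint m y)

theorem translation_zero (n : ℕ) (m : ℝ) :
    translation n m 0 = LinearIsometryEquiv.refl ℂ (OneParticle n m) :=
  phaseMul_zero _ fun p => by simp [mink]

theorem translation_add {n : ℕ} {m : ℝ} (x y : EuclideanSpace ℝ (Fin (n + 1)))
    (h : OneParticle n m) :
    translation n m x (translation n m y h) = translation n m (x + y) h :=
  phaseMul_phaseMul _ _ _ (fun _ => mink_add_left _ _ _) h

theorem tensorPow_translation {n : ℕ} {m : ℝ} (y : EuclideanSpace ℝ (Fin (n + 1))) (k : ℕ)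
    (Ψ : NPart (shellMeasure n m) k) :
    tensorPow (shellMeasure n m) (translation n m y) k Ψ
      = phaseMul _ (measurable_sum_phase (measurable_mink_shellPoint m y) k) Ψ :=
  tensorPow_phaseMul _ _ k Ψ

/-- The second quantized translations `exp(i y^μ P_μ)`. -/
def fockTranslation (n : ℕ) (m : ℝ) (y : EuclideanSpace ℝ (Fin (n + 1))) :
    FockSpace n m ≃ₗᵢ[ℂ] FockSpace n m :=
  secondQuant (shellMeasure n m) (translation n m y)

/-- Single-valuedness of the graph, without which `toLinearPMap` would not return an operator having
this graph. -/
theorem momentumGraph_snd_eq_zero {n : ℕ} {m : ℝ} {μ : Fin (n + 1)}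
    (z : FockSpace n m × FockSpace n m) (hz : z ∈ momentumGraph n m μ) (h0 : z.1 = 0) :
    z.2 = 0 := by
  ext1
  funext k
  ext1
  refine Lp.ext ?_
  filter_upwards [hz.2 k, Lp.coeFn_zero ℂ 2 (Measure.pi fun _ : Fin k => shellMeasure n m)]
    with p h1 h2
  rw [h1, h0]
  change _ * (0 : NPart (shellMeasure n m) k) p = (0 : NPart (shellMeasure n m) k) p
  rw [h2]
  simp

theorem momentumOp_mem_graph {n : ℕ} {m : ℝ} {μ : Fin (n + 1)} (Ψ : (momentumOp n m μ).domain) :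
    ((Ψ : FockSpace n m), momentumOp n m μ Ψ) ∈ momentumGraph n m μ :=
  Submodule.mem_graph_toLinearPMap (fun z hz h0 => momentumGraph_snd_eq_zero z hz h0) Ψ

theorem mem_domain_momentumOp {n : ℕ} {m : ℝ} {μ : Fin (n + 1)}
    {z : FockSpace n m × FockSpace n m} (hz : z ∈ momentumGraph n m μ) :
    z.1 ∈ (momentumOp n m μ).domain :=
  Submodule.mem_map.2 ⟨z, hz, rfl⟩

theorem deltaP_le_finiteParticle {n : ℕ} {m : ℝ} :
    ⨆ k, deltaP n m k ≤ finiteParticle (shellMeasure n m) := by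
  refine iSup_le fun k => Submodule.span_le.2 ?_
  rintro Ψ ⟨h, _, rfl⟩
  exact single_mem_finiteParticle _ k _

theorem hasDerivAt_clm_comp {E F : Type*} [NormedAddCommGroup E] [NormedSpace ℂ E]
    [NormedAddCommGroup F] [NormedSpace ℂ F] (L : E →L[ℂ] F) {f : ℝ → E} {f' : E} {x : ℝ}
    (hf : HasDerivAt f f' x) : HasDerivAt (fun t => L (f t)) (L f') x :=
  HasFDerivAt.comp_hasDerivAt x ((L.restrictScalars ℝ).hasFDerivAt) hf

theorem hasDerivAt_tensorPow_translation {n : ℕ} {m : ℝ} {μ : Fin (n + 1)} {k : ℕ}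
    {f g : NPart (shellMeasure n m) k}
    (h : g =ᵐ[Measure.pi fun _ : Fin k => shellMeasure n m]
      fun p => ((∑ i, momentum m μ (p i) : ℝ) : ℂ) * f p) :
    HasDerivAt (fun t : ℝ => tensorPow (shellMeasure n m)
      (translation n m (t • EuclideanSpace.single μ 1)) k f) (Complex.I • g) 0 := by
  simp only [tensorPow_translation]
  have hω : ∀ (t : ℝ) (p : Fin k → EuclideanSpace ℝ (Fin n)),
      ∑ i, mink (t • EuclideanSpace.single μ 1) (shellPoint m (p i))
        = t * ∑ i, momentum m μ (p i) := fun t p => by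
    simp only [mink_smul_left, ← Finset.mul_sum, momentum]
  exact hasDerivAt_phaseMul (fun t : ℝ => measurable_sum_phase
    (measurable_mink_shellPoint m (t • EuclideanSpace.single μ 1)) k) hω f g h

theorem hasDerivAt_fockTranslation {n : ℕ} {m : ℝ} {μ : Fin (n + 1)} {Ψ Φ : FockSpace n m}
    (h : (Ψ, Φ) ∈ momentumGraph n m μ) :
    HasDerivAt (fun t : ℝ => fockTranslation n m (t • EuclideanSpace.single μ 1) Ψ)
      (Complex.I • Φ) 0 := by
  have hΨ : Ψ ∈ ⨆ k, deltaP n m k := h.1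
  have hmul : ∀ k, ∀ᵐ p ∂(Measure.pi fun _ : Fin k => shellMeasure n m),
      (Φ k : NPart (shellMeasure n m) k) p
        = ((∑ i, momentum m μ (p i) : ℝ) : ℂ) * (Ψ k : NPart (shellMeasure n m) k) p := h.2
  obtain ⟨N, hN⟩ := deltaP_le_finiteParticle hΨ
  -- `Φ` vanishes in each particle number where `Ψ` does. Both are therefore finite sums of
  -- components, which can be differentiated term by term.
  have hN2 : ∀ k, N ≤ k → Φ k = 0 := by
    intro k hk
    ext1
    refine Lp.ext ?_
    filter_upwards [hmul k,
      Lp.coeFn_zero ℂ 2 (Measure.pi fun _ : Fin k => shellMeasure n m)] with p h1 h2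
    rw [h1, hN k hk]
    change _ * (0 : NPart (shellMeasure n m) k) p = (0 : NPart (shellMeasure n m) k) p
    rw [h2]
    simp
  have hk : ∀ k, HasDerivAt (fun t : ℝ => component (shellMeasure n m) k
      (tensorPow (shellMeasure n m) (translation n m (t • EuclideanSpace.single μ 1)) k (Ψ k)))
      (Complex.I • component (shellMeasure n m) k (Φ k)) 0 := fun k => by
    rw [← map_smul]
    exact hasDerivAt_clm_comp (component (shellMeasure n m) k)
      (hasDerivAt_tensorPow_translation (hmul k))
  have hs := HasDerivAt.fun_sum (u := Finset.range N) fun k _ => hk k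
  rw [← Finset.smul_sum, ← eq_sum_component _ hN2] at hs
  refine hs.congr_of_eventuallyEq (Eventually.of_forall fun t => ?_)
  simp only [component_tensorPow]
  rw [← map_sum, ← eq_sum_component _ hN]
  rfl

theorem isUnitaryExp_fockTranslation (n : ℕ) (m : ℝ) :
    IsUnitaryExp (momentumOp n m) (fockTranslation n m) where
  map_zero := by
    unfold fockTranslation
    rw [translation_zero, secondQuant_refl]
  map_add x y := by
    ext1 Ψ
    exact (secondQuant_secondQuant _ (translation_add x y) Ψ).symm
  continuous Ψ := by
    refine continuous_secondQuant _ (fun k Ψ => ?_) Ψ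
    simp only [tensorPow_translation]
    refine continuous_phaseMul (fun y => measurable_sum_phase (measurable_mink_shellPoint m y) k)
      (fun p => continuous_finsetSum _ fun i _ => ?_) Ψ
    exact continuous_mink.comp (continuous_id.prodMk continuous_const)
  hasDerivAt μ Ψ := hasDerivAt_fockTranslation (momentumOp_mem_graph Ψ)

/-! ### The domain `⨆ₖ Δ_k(P)` -/

theorem abs_momentum_le {n : ℕ} {m : ℝ} (hm : 0 < m) (μ : Fin (n + 1))
    (p : EuclideanSpace ℝ (Fin n)) : |momentum m μ p| ≤ m + ‖p‖ := by
  refine Fin.cases ?_ (fun i => ?_) μ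
  · have h1 : momentum m 0 p = energy m p := by
      simp [momentum, mink, shellPoint]
    rw [h1, energy, abs_of_nonneg (Real.sqrt_nonneg _),
      Real.sqrt_le_left (by positivity)]
    nlinarith [norm_nonneg p]
  · have h1 : momentum m i.succ p = -p i := by
      simp [momentum, mink, shellPoint]
    rw [h1, abs_neg]
    exact (PiLp.norm_apply_le p i).trans (by linarith)

theorem measurable_momentum {n : ℕ} (m : ℝ) (μ : Fin (n + 1)) :
    Measurable (momentum m μ : EuclideanSpace ℝ (Fin n) → ℝ) :=
  measurable_mink_shellPoint m _

/-- Converts the bounds on even powers of `|p|` that define `Δ(P)` into decay of every order. For `t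
≥ 1` one has `1 + t ≤ 2 t²`. -/
theorem one_add_pow_le {t : ℝ} (ht : 0 ≤ t) (M : ℕ) : (1 + t) ^ M ≤ 2 ^ M * (1 + (t ^ 2) ^ M) := by
  have h0 : (0 : ℝ) ≤ (t ^ 2) ^ M := by positivity
  have h2 : (0 : ℝ) < 2 ^ M := by positivity
  rcases le_total t 1 with h | h
  · calc (1 + t) ^ M ≤ 2 ^ M := pow_le_pow_left₀ (by positivity) (by linarith) M
      _ ≤ _ := by nlinarith
  · calc (1 + t) ^ M ≤ (2 * t ^ 2) ^ M := pow_le_pow_left₀ (by positivity) (by nlinarith) M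
      _ = 2 ^ M * (t ^ 2) ^ M := mul_pow _ _ _
      _ ≤ _ := by nlinarith

theorem exists_bound_of_mem_deltaOne {n : ℕ} {m : ℝ} {h : OneParticle n m} (hh : h ∈ deltaOne n m)
    (M : ℕ) : ∃ C : ℝ, ∀ᵐ p ∂(shellMeasure n m), (1 + ‖p‖) ^ M * ‖h p‖ ≤ C := by
  obtain ⟨c, hc⟩ := hh 0
  obtain ⟨d, hd⟩ := hh M
  refine ⟨2 ^ M * (c + d), ?_⟩
  filter_upwards [hc, hd] with p h1 h2
  rw [norm_mul, Complex.norm_real, Real.norm_of_nonneg (by positivity)] at h1 h2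
  calc (1 + ‖p‖) ^ M * ‖h p‖ ≤ 2 ^ M * (1 + (‖p‖ ^ 2) ^ M) * ‖h p‖ :=
        mul_le_mul_of_nonneg_right (one_add_pow_le (norm_nonneg p) M) (norm_nonneg _)
    _ = 2 ^ M * ((‖p‖ ^ 2) ^ 0 * ‖h p‖ + (‖p‖ ^ 2) ^ M * ‖h p‖) := by ring
    _ ≤ _ := by gcongr

theorem shellMeasure_le {n : ℕ} {m : ℝ} (hm : 0 < m) :
    shellMeasure n m ≤ ENNReal.ofReal (1 / (2 * m)) • volume := by
  rw [← withDensity_const]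
  refine withDensity_mono (Eventually.of_forall fun p => ENNReal.ofReal_le_ofReal ?_)
  exact one_div_le_one_div_of_le (by positivity) (by linarith [le_energy m p])

theorem memLp_inv_one_add_norm {n : ℕ} {m : ℝ} (hm : 0 < m) :
    MemLp (fun p : EuclideanSpace ℝ (Fin n) => ((1 + ‖p‖) ^ (n + 1))⁻¹) 2 (shellMeasure n m) := by
  refine MemLp.of_measure_le_smul ENNReal.ofReal_ne_top (shellMeasure_le hm) ?_
  have hc : Continuous fun p : EuclideanSpace ℝ (Fin n) => ((1 + ‖p‖) ^ (n + 1))⁻¹ :=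
    Continuous.inv₀ (by fun_prop) fun p => by positivity
  rw [memLp_two_iff_integrable_sq hc.aestronglyMeasurable]
  have hint : Integrable
      (fun p : EuclideanSpace ℝ (Fin n) => (1 + ‖p‖) ^ (-((2 * (n + 1) : ℕ) : ℝ))) := by
    refine integrable_one_add_norm ?_
    simp only [finrank_euclideanSpace, Fintype.card_fin]
    exact_mod_cast (by omega : n < 2 * (n + 1))
  refine hint.congr (Eventually.of_forall fun p => ?_)
  simp only
  rw [Real.rpow_neg (by positivity), Real.rpow_natCast, inv_pow, ← pow_mul, mul_comm 2]

/-- Of the `n + 2` powers of decay, one absorbs the linear growth of `p_μ`; the remaining `n + 1`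
are square integrable in `n` dimensions. -/
theorem memLp_momentum_mul {n : ℕ} {m : ℝ} (hm : 0 < m) (μ : Fin (n + 1)) {h : OneParticle n m}
    (hh : h ∈ deltaOne n m) :
    MemLp (fun p => (momentum m μ p : ℂ) * h p) 2 (shellMeasure n m) := by
  obtain ⟨C, hC⟩ := exists_bound_of_mem_deltaOne hh (n + 2)
  refine ((memLp_inv_one_add_norm hm).const_mul ((m + 1) * C)).mono' ?_ ?_
  · exact (Complex.measurable_ofReal.comp (measurable_momentum m μ)).aestronglyMeasurable.mul
      (Lp.aestronglyMeasurable h)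
  · filter_upwards [hC] with p hp
    rw [norm_mul, Complex.norm_real, Real.norm_eq_abs, ← div_eq_mul_inv,
      le_div_iff₀ (by positivity)]
    have h1 : |momentum m μ p| ≤ (m + 1) * (1 + ‖p‖) :=
      (abs_momentum_le hm μ p).trans (by nlinarith [norm_nonneg p])
    calc |momentum m μ p| * ‖h p‖ * (1 + ‖p‖) ^ (n + 1)
        ≤ (m + 1) * (1 + ‖p‖) * ‖h p‖ * (1 + ‖p‖) ^ (n + 1) := by gcongr
      _ = (m + 1) * ((1 + ‖p‖) ^ (n + 2) * ‖h p‖) := by ring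
      _ ≤ _ := mul_le_mul_of_nonneg_left hp (by positivity)

theorem ae_permOp {α : Type*} [MeasurableSpace α] (μ : Measure α) [SigmaFinite μ] {k : ℕ}
    (σ : Equiv.Perm (Fin k)) (Ψ : NPart μ k) :
    permOp μ σ Ψ =ᵐ[Measure.pi fun _ : Fin k => μ] fun p => Ψ (p ∘ σ) :=
  Lp.coeFn_compMeasurePreserving Ψ (measurePreserving_perm μ σ)

/-- Multiplication by a symmetric function commutes with every permutation and hence with `P₊`. -/
theorem ae_projection_mul {α : Type*} [MeasurableSpace α] (μ : Measure α) [SigmaFinite μ] {k : ℕ}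
    {F : (Fin k → α) → ℂ} (hF : ∀ (σ : Equiv.Perm (Fin k)) p, F (p ∘ σ) = F p)
    {Ψ Φ : NPart μ k} (h : Φ =ᵐ[Measure.pi fun _ : Fin k => μ] fun p => F p * Ψ p) :
    ((symSub μ k).orthogonalProjectionOnto Φ : NPart μ k) =ᵐ[Measure.pi fun _ : Fin k => μ]
      fun p => F p * ((symSub μ k).orthogonalProjectionOnto Ψ : NPart μ k) p := by
  rw [coe_projection_symSub, coe_projection_symSub]
  set c : ℂ := ((k.factorial : ℕ) : ℂ)⁻¹
  have h1 : ∀ σ : Equiv.Perm (Fin k), ∀ᵐ p ∂(Measure.pi fun _ : Fin k => μ),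
      permOp μ σ Φ p = F p * permOp μ σ Ψ p := fun σ => by
    filter_upwards [ae_permOp μ σ Φ, ae_permOp μ σ Ψ,
      (measurePreserving_perm μ σ).quasiMeasurePreserving.ae h] with p e1 e2 e3
    rw [e1, e2, e3, hF]
  filter_upwards [ae_all_iff.2 h1, Lp.coeFn_smul c (∑ σ : Equiv.Perm (Fin k), permOp μ σ Φ),
    Lp.coeFn_smul c (∑ σ : Equiv.Perm (Fin k), permOp μ σ Ψ),
    Lp.coeFn_finsetSum Finset.univ fun σ : Equiv.Perm (Fin k) => permOp μ σ Φ,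
    Lp.coeFn_finsetSum Finset.univ fun σ : Equiv.Perm (Fin k) => permOp μ σ Ψ]
    with p e1 e2 e3 e4 e5
  rw [e2, e3, Pi.smul_apply, Pi.smul_apply, e4, e5, Finset.sum_apply, Finset.sum_apply,
    Finset.sum_congr rfl fun σ _ => e1 σ, ← Finset.mul_sum, smul_eq_mul, smul_eq_mul,
    mul_left_comm]

/-- Leibniz rule: the total momentum acts as a sum over particles, the `i`-th term multiplying only
the `i`-th factor, which stays in `L²`. -/
theorem exists_momentum_mul_tensor {n : ℕ} {m : ℝ} (hm : 0 < m) (μ : Fin (n + 1)) {k : ℕ}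
    {h : Fin k → OneParticle n m} (hh : ∀ i, h i ∈ deltaOne n m) :
    ∃ G : NPart (shellMeasure n m) k, G =ᵐ[Measure.pi fun _ : Fin k => shellMeasure n m]
      fun p => ((∑ i, momentum m μ (p i) : ℝ) : ℂ) * tensor (shellMeasure n m) h p := by
  have hex : ∀ i, ∃ g : OneParticle n m,
      ∀ᵐ p ∂(shellMeasure n m), g p = (momentum m μ p : ℂ) * h i p := fun i =>
    ⟨(memLp_momentum_mul hm μ (hh i)).toLp, (memLp_momentum_mul hm μ (hh i)).coeFn_toLp⟩
  choose g hg using hex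
  refine ⟨∑ i, tensor (shellMeasure n m) (Function.update h i (g i)), ?_⟩
  filter_upwards [Lp.coeFn_finsetSum Finset.univ fun i =>
      tensor (shellMeasure n m) (Function.update h i (g i)),
    ae_all_iff.2 fun i => tensor_update (shellMeasure n m) h i (g i),
    ae_pi_of_forall hg, ae_tensor (shellMeasure n m) h] with p e1 e2 e3 e4
  rw [e1, Finset.sum_apply, e4, Complex.ofReal_sum, Finset.sum_mul]
  refine Finset.sum_congr rfl fun i _ => ?_
  rw [e2 i, e3 i, mul_assoc, Finset.mul_prod_erase _ (fun j => h j (p j)) (Finset.mem_univ i)]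

theorem single_mem_momentumGraph {n : ℕ} {m : ℝ} {μ : Fin (n + 1)} {k : ℕ}
    {ψ φ : symSub (shellMeasure n m) k}
    (hψ : (lp.single 2 k ψ : FockSpace n m) ∈ ⨆ k, deltaP n m k)
    (h : (φ : NPart (shellMeasure n m) k) =ᵐ[Measure.pi fun _ : Fin k => shellMeasure n m]
      fun p => ((∑ i, momentum m μ (p i) : ℝ) : ℂ) * (ψ : NPart (shellMeasure n m) k) p) :
    ((lp.single 2 k ψ, lp.single 2 k φ) : FockSpace n m × FockSpace n m)
      ∈ momentumGraph n m μ := by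
  refine ⟨hψ, fun j => ?_⟩
  by_cases hj : j = k
  · subst hj
    simp only [lp.single_apply_self]
    exact h
  · simp only [lp.single_apply_ne _ _ _ hj]
    filter_upwards [Lp.coeFn_zero ℂ 2 (Measure.pi fun _ : Fin j => shellMeasure n m)] with p e
    change (0 : NPart (shellMeasure n m) j) p = _ * (0 : NPart (shellMeasure n m) j) p
    rw [e]
    simp

/-- The graph contains only those vectors whose product with the total momentum is again in Fock
space, so this product has to be exhibited. -/
theorem single_symTensor_mem_domain {n : ℕ} {m : ℝ} (hm : 0 < m) (μ : Fin (n + 1)) {k : ℕ}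
    {h : Fin k → OneParticle n m} (hh : ∀ i, h i ∈ deltaOne n m) :
    (lp.single 2 k (symTensor (shellMeasure n m) h) : FockSpace n m)
      ∈ (momentumOp n m μ).domain := by
  obtain ⟨G, hG⟩ := exists_momentum_mul_tensor hm μ hh
  have hF : ∀ (σ : Equiv.Perm (Fin k)) (p : Fin k → EuclideanSpace ℝ (Fin n)),
      ((∑ i, momentum m μ ((p ∘ σ) i) : ℝ) : ℂ) = ((∑ i, momentum m μ (p i) : ℝ) : ℂ) :=
    fun σ p => congrArg _ (Equiv.sum_comp σ fun i => momentum m μ (p i))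
  exact mem_domain_momentumOp (single_mem_momentumGraph
    (Submodule.mem_iSup_of_mem k (Submodule.subset_span ⟨h, hh, rfl⟩))
    (ae_projection_mul (shellMeasure n m)
      (F := fun p => ((∑ i, momentum m μ (p i) : ℝ) : ℂ)) hF hG))

theorem deltaP_le_domain {n : ℕ} {m : ℝ} (hm : 0 < m) (μ : Fin (n + 1)) :
    ⨆ k, deltaP n m k ≤ (momentumOp n m μ).domain := by
  refine iSup_le fun k => Submodule.span_le.2 ?_
  rintro Ψ ⟨h, hh, rfl⟩
  exact single_symTensor_mem_domain hm μ hh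

theorem translation_mem_deltaOne {n : ℕ} {m : ℝ} (y : EuclideanSpace ℝ (Fin (n + 1)))
    {h : OneParticle n m} (hh : h ∈ deltaOne n m) : translation n m y h ∈ deltaOne n m := by
  intro r
  obtain ⟨c, hc⟩ := hh r
  refine ⟨c, ?_⟩
  filter_upwards [hc, coeFn_phaseMul (measurable_mink_shellPoint m y) h] with p h1 h2
  unfold translation
  rw [h2, mul_left_comm, norm_mul, mul_comm Complex.I, Complex.norm_exp_ofReal_mul_I, one_mul]
  exact h1

theorem fockTranslation_mem_deltaP {n : ℕ} {m : ℝ} (y : EuclideanSpace ℝ (Fin (n + 1)))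
    {Ψ : FockSpace n m} (hΨ : Ψ ∈ ⨆ k, deltaP n m k) :
    fockTranslation n m y Ψ ∈ ⨆ k, deltaP n m k := by
  have : ⨆ k, deltaP n m k ≤
      (⨆ k, deltaP n m k).comap (fockTranslation n m y).toLinearEquiv.toLinearMap := by
    refine iSup_le fun k => Submodule.span_le.2 ?_
    rintro Ψ ⟨h, hh, rfl⟩
    refine Submodule.mem_iSup_of_mem k (Submodule.subset_span
      ⟨fun i => translation n m y (h i), fun i => translation_mem_deltaOne y (hh i), ?_⟩)
    rw [← symPow_symTensor]
    exact secondQuant_single _ _ _ _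
  exact this hΨ

/-- Indicators of bounded sets of finite measure lie in `Δ(P)`. A vector orthogonal to them has zero
integral over `s ∩ ball(N)` for all `N`, hence over every `s` of finite measure. -/
theorem dense_deltaOne {n : ℕ} {m : ℝ} : Dense (deltaOne n m : Set (OneParticle n m)) := by
  rw [Submodule.dense_iff_topologicalClosure_eq_top, Submodule.topologicalClosure_eq_top_iff,
    Submodule.eq_bot_iff]
  intro f hf
  rw [Submodule.mem_orthogonal] at hf
  refine (Lp.eq_zero_iff_ae_eq_zero).2 (Lp.ae_eq_zero_of_forall_setIntegral_eq_zero f two_ne_zero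
    ENNReal.ofNat_ne_top (fun s _ hs => integrableOn_Lp_of_measure_ne_top f
      fact_one_le_two_ennreal.elim hs.ne) fun s hs hμs => ?_)
  have hm : ∀ N : ℕ, MeasurableSet (s ∩ Metric.closedBall 0 N) := fun N =>
    hs.inter Metric.isClosed_closedBall.measurableSet
  have hfin : ∀ N : ℕ, shellMeasure n m (s ∩ Metric.closedBall 0 N) ≠ ∞ := fun N =>
    ((measure_mono Set.inter_subset_left).trans_lt hμs).ne
  have hzero : ∀ N : ℕ, ∫ p in s ∩ Metric.closedBall 0 N, f p ∂(shellMeasure n m) = 0 := by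
    intro N
    rw [← L2.inner_indicatorConstLp_one (𝕜 := ℂ) (hm N) (hfin N) f]
    -- On the ball of radius `N` one has `(|p|²)^r ≤ (N²)^r`, and outside it the indicator vanishes.
    refine hf _ fun r => ⟨((N : ℝ) ^ 2) ^ r, ?_⟩
    filter_upwards [indicatorConstLp_coeFn (p := 2) (hs := hm N) (hμs := hfin N) (c := (1 : ℂ))]
      with p hp
    rw [hp, norm_mul, Complex.norm_real, Real.norm_of_nonneg (by positivity)]
    by_cases h : p ∈ s ∩ Metric.closedBall 0 (N : ℝ)
    · rw [Set.indicator_of_mem h, norm_one, mul_one]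
      have : ‖p‖ ≤ N := by simpa using h.2
      gcongr
    · rw [Set.indicator_of_notMem h, norm_zero, mul_zero]
      positivity
  have hU : ⋃ N : ℕ, s ∩ Metric.closedBall 0 (N : ℝ) = s := by
    rw [← Set.inter_iUnion, Metric.iUnion_closedBall_nat, Set.inter_univ]
  have ht := tendsto_setIntegral_of_monotone (μ := shellMeasure n m) (f := f) hm
    (fun M N hMN => Set.inter_subset_inter_right _
      (Metric.closedBall_subset_closedBall (by exact_mod_cast hMN)))
    (by rw [hU]; exact integrableOn_Lp_of_measure_ne_top f fact_one_le_two_ennreal.elim hμs.ne)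
  rw [hU] at ht
  simp only [hzero] at ht
  exact (tendsto_nhds_unique ht tendsto_const_nhds)

/-- For `Φ` orthogonal to the span, symmetry of each component `Φ k` removes `P₊`, so `Φ k` is
orthogonal to all tensors of vectors in `Δ(P)`. By continuity it is orthogonal to all tensors, and
these are total. -/
theorem dense_deltaP {n : ℕ} {m : ℝ} :
    Dense ((⨆ k, deltaP n m k : Submodule ℂ (FockSpace n m)) : Set (FockSpace n m)) := by
  rw [Submodule.dense_iff_topologicalClosure_eq_top, Submodule.topologicalClosure_eq_top_iff,
    Submodule.eq_bot_iff]
  intro Φ hΦ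
  rw [Submodule.mem_orthogonal] at hΦ
  ext1
  funext k
  ext1
  refine eq_zero_of_inner_tensor _ _ fun h => ?_
  have hd : Dense (Set.univ.pi fun _ : Fin k => (deltaOne n m : Set (OneParticle n m))) :=
    dense_pi _ fun _ _ => dense_deltaOne
  refine hd.induction (P := fun h => inner ℂ (tensor (shellMeasure n m) h)
    (Φ k : NPart (shellMeasure n m) k) = 0) (fun h hh => ?_)
    (isClosed_eq ((continuous_tensor _ k).inner continuous_const) continuous_const) h
  have h1 := hΦ (lp.single 2 k (symTensor (shellMeasure n m) h))
    (Submodule.mem_iSup_of_mem k (Submodule.subset_span ⟨h, fun i => hh i trivial, rfl⟩))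
  rw [lp.inner_single_left] at h1
  unfold symTensor at h1
  rwa [Submodule.inner_orthogonalProjectionOnto_eq_of_mem_right] at h1

/-- Identifies the chosen exponential with the explicit multiplication operators, on which all later
computations rest. -/
theorem unitaryExp_momentumOp {n : ℕ} {m : ℝ} (hm : 0 < m) :
    unitaryExp (momentumOp n m) = fockTranslation n m := by
  have h := isUnitaryExp_fockTranslation n m
  exact (h.eq_of_invariant (isUnitaryExp_unitaryExp h) dense_deltaP
    (fun Ψ hΨ μ => deltaP_le_domain hm μ hΨ)
    fun Ψ hΨ x => fockTranslation_mem_deltaP x hΨ).symm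

theorem xOp_eq {n : ℕ} {m : ℝ} (V : OneParticle n m ≃ₗᵢ[ℂ] OneParticle n m) :
    xOp V = fun μ => sandwich (secondQuant (shellMeasure n m) V).symm (momentumOp n m μ)
      (secondQuant (shellMeasure n m) V) := by
  funext μ
  rw [secondQuant_symm]
  rfl

theorem isUnitaryExp_xOp {n : ℕ} {m : ℝ} (V : OneParticle n m ≃ₗᵢ[ℂ] OneParticle n m) :
    IsUnitaryExp (xOp V) fun x => (secondQuant (shellMeasure n m) V).trans
      ((fockTranslation n m x).trans (secondQuant (shellMeasure n m) V).symm) := by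
  rw [xOp_eq]
  exact (isUnitaryExp_fockTranslation n m).conj _

/-- Uniqueness is applied on the preimage of the span of the `Δ_k(P)` under `Γ(V)`, which inherits
density, invariance and the domain property. -/
theorem unitaryExp_xOp {n : ℕ} {m : ℝ} (hm : 0 < m)
    (V : OneParticle n m ≃ₗᵢ[ℂ] OneParticle n m) :
    unitaryExp (xOp V) = fun x => (secondQuant (shellMeasure n m) V).trans
      ((fockTranslation n m x).trans (secondQuant (shellMeasure n m) V).symm) := by
  have h := isUnitaryExp_xOp V
  refine (h.eq_of_invariant (isUnitaryExp_unitaryExp h)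
    (D := secondQuant (shellMeasure n m) V ⁻¹' (⨆ k, deltaP n m k : Submodule ℂ (FockSpace n m)))
    ?_ (fun Ψ hΨ μ => ?_) fun Ψ hΨ x => ?_).symm
  · exact dense_deltaP.preimage (secondQuant (shellMeasure n m) V).toHomeomorph.isOpenMap
  · exact deltaP_le_domain hm μ hΨ
  · simp only [Set.mem_preimage, LinearIsometryEquiv.trans_apply,
      LinearIsometryEquiv.apply_symm_apply]
    exact fockTranslation_mem_deltaP x hΨ

/-! ### The scalar oscillatory integral -/

/-! ### Slices of Schwartz functions and their Fourier transforms, uniformly in the frozen variable.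
-/

section Slice

variable {E F : Type*} [NormedAddCommGroup E] [NormedSpace ℝ E] [NormedAddCommGroup F]
  [NormedSpace ℝ F]

/-- The slice is `χ` precomposed with an affine map whose linear part is an inclusion of norm at
most one. Hence no Schwartz seminorm of a slice exceeds that of `χ`, whatever `s` is. -/
theorem norm_iteratedFDeriv_slice_le (χ : 𝓢(E × F, ℂ)) (s : E) (l : ℕ) (y : F) :
    ‖iteratedFDeriv ℝ l (fun y => χ (s, y)) y‖ ≤ ‖iteratedFDeriv ℝ l χ (s, y)‖ := by
  have h1 : (fun y => χ (s, y)) = (fun z => χ ((s, 0) + z)) ∘ ContinuousLinearMap.inr ℝ E F := by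
    funext y
    simp
  have hc : ContDiff ℝ l fun z => χ ((s, 0) + z) :=
    (χ.smooth l).comp (contDiff_const.add contDiff_id)
  rw [h1, ContinuousLinearMap.iteratedFDeriv_comp_right _ hc _ le_rfl,
    iteratedFDeriv_comp_add_left]
  refine (ContinuousMultilinearMap.norm_compContinuousLinearMap_le _ _).trans ?_
  simp only [ContinuousLinearMap.inr_apply, Prod.mk_add_mk, add_zero, zero_add]
  refine mul_le_of_le_one_right (norm_nonneg _) ?_
  exact Finset.prod_le_one (fun _ _ => norm_nonneg _)
    fun _ _ => ContinuousLinearMap.norm_inr_le_one ℝ E F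

theorem pow_mul_norm_iteratedFDeriv_slice_le (χ : 𝓢(E × F, ℂ)) (s : E) (k l : ℕ) (y : F) :
    ‖y‖ ^ k * ‖iteratedFDeriv ℝ l (fun y => χ (s, y)) y‖ ≤ SchwartzMap.seminorm ℂ k l χ := by
  refine le_trans ?_ (SchwartzMap.le_seminorm ℂ k l χ (s, y))
  have : ‖y‖ ≤ ‖(s, y)‖ := le_max_right _ _
  have := norm_iteratedFDeriv_slice_le χ s l y
  gcongr

/-- The Schwartz function `y ↦ χ(s, y)`. -/
def slice (χ : 𝓢(E × F, ℂ)) (s : E) : 𝓢(F, ℂ) where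
  toFun y := χ (s, y)
  smooth' := (χ.smooth _).comp (contDiff_const.prodMk contDiff_id)
  decay' k l := ⟨_, pow_mul_norm_iteratedFDeriv_slice_le χ s k l⟩

theorem slice_apply (χ : 𝓢(E × F, ℂ)) (s : E) (y : F) : slice χ s y = χ (s, y) :=
  rfl

theorem seminorm_slice_le (χ : 𝓢(E × F, ℂ)) (s : E) (k l : ℕ) :
    SchwartzMap.seminorm ℂ k l (slice χ s) ≤ SchwartzMap.seminorm ℂ k l χ :=
  SchwartzMap.seminorm_le_bound ℂ k l _ (apply_nonneg _ _)
    (pow_mul_norm_iteratedFDeriv_slice_le χ s k l)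

theorem exists_slice_bound (χ : 𝓢(E × F, ℂ)) (M : ℕ) :
    ∃ C, ∀ s y, ‖χ (s, y)‖ ≤ C * ((1 + ‖y‖) ^ M)⁻¹ := by
  refine ⟨2 ^ M * (Finset.Iic (M, 0)).sup
      (fun j => SchwartzMap.seminorm ℂ j.1 j.2) χ, fun s y => ?_⟩
  have h1 := SchwartzMap.one_add_le_sup_seminorm_apply (𝕜 := ℂ) (m := (M, 0)) (k := M)
    (n := 0) le_rfl le_rfl χ (s, y)
  rw [norm_iteratedFDeriv_zero] at h1
  rw [← div_eq_mul_inv, le_div_iff₀ (by positivity), mul_comm]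
  refine le_trans ?_ h1
  have : ‖y‖ ≤ ‖(s, y)‖ := le_max_right _ _
  gcongr

end Slice

section FourierBound

variable {E F : Type*} [NormedAddCommGroup E] [NormedSpace ℝ E] [NormedAddCommGroup F]
  [InnerProductSpace ℝ F] [FiniteDimensional ℝ F] [MeasurableSpace F] [BorelSpace F]

/-- The Fourier transform is continuous on Schwartz space, so its seminorms are controlled by
finitely many seminorms of the slice, which are bounded uniformly in `s`. -/
theorem exists_seminorm_fourier_slice_bound (χ : 𝓢(E × F, ℂ)) (k : ℕ) :
    ∃ C, ∀ s, SchwartzMap.seminorm ℂ k 0 (FourierTransform.fourier (slice χ s)) ≤ C := by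
  let q : Seminorm ℂ 𝓢(F, ℂ) := (SchwartzMap.seminorm ℂ k 0).comp
    (FourierTransform.fourierCLM ℂ 𝓢(F, ℂ) : 𝓢(F, ℂ) →L[ℂ] 𝓢(F, ℂ)).toLinearMap
  have hq : Continuous q :=
    ((schwartz_withSeminorms ℂ F ℂ).continuous_seminorm (k, 0)).comp
      (FourierTransform.fourierCLM ℂ 𝓢(F, ℂ) : 𝓢(F, ℂ) →L[ℂ] 𝓢(F, ℂ)).continuous
  obtain ⟨S, C, _, hC⟩ := Seminorm.bound_of_continuous (schwartz_withSeminorms ℂ F ℂ) q hq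
  refine ⟨C * (S.sup (schwartzSeminormFamily ℂ (E × F) ℂ)) χ, fun s => (hC (slice χ s)).trans ?_⟩
  refine mul_le_mul_of_nonneg_left ?_ C.2
  refine Seminorm.finset_sup_apply_le (apply_nonneg _ _) fun i hi => ?_
  exact (seminorm_slice_le χ s i.1 i.2).trans
    (Seminorm.le_finset_sup_apply (p := schwartzSeminormFamily ℂ (E × F) ℂ) (x := χ) hi)

theorem exists_fourier_slice_bound (χ : 𝓢(E × F, ℂ)) (M : ℕ) :
    ∃ C, ∀ s w, ‖(FourierTransform.fourier (slice χ s)) w‖ ≤ C * ((1 + ‖w‖) ^ M)⁻¹ := by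
  obtain ⟨C, hC⟩ := exists_seminorm_fourier_slice_bound χ 0
  obtain ⟨D, hD⟩ := exists_seminorm_fourier_slice_bound χ M
  refine ⟨2 ^ (M - 1) * (C + D), fun s w => ?_⟩
  set g := FourierTransform.fourier (slice χ s)
  have h1 := (SchwartzMap.le_seminorm ℂ 0 0 g w).trans (hC s)
  have h2 := (SchwartzMap.le_seminorm ℂ M 0 g w).trans (hD s)
  rw [norm_iteratedFDeriv_zero] at h1 h2
  rw [← div_eq_mul_inv, le_div_iff₀ (by positivity), mul_comm]
  calc (1 + ‖w‖) ^ M * ‖g w‖ ≤ 2 ^ (M - 1) * (1 ^ M + ‖w‖ ^ M) * ‖g w‖ :=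
        mul_le_mul_of_nonneg_right (add_pow_le zero_le_one (norm_nonneg w) M) (norm_nonneg _)
    _ = 2 ^ (M - 1) * (‖w‖ ^ 0 * ‖g w‖ + ‖w‖ ^ M * ‖g w‖) := by ring
    _ ≤ _ := by gcongr

end FourierBound

/-! ### The partial Fourier transform of the cutoff and the plane wave integral. -/

/-- The reflection of the spatial components. -/
def reflection (n : ℕ) :
    EuclideanSpace ℝ (Fin (n + 1)) ≃ₗᵢ[ℝ] EuclideanSpace ℝ (Fin (n + 1)) :=
  LinearIsometryEquiv.piLpCongrRight 2 fun i : Fin (n + 1) =>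
    if i = 0 then LinearIsometryEquiv.refl ℝ ℝ else LinearIsometryEquiv.neg ℝ

theorem inner_reflection {n : ℕ} (x y : EuclideanSpace ℝ (Fin (n + 1))) :
    inner ℝ y (reflection n x) = mink x y := by
  simp [reflection, mink, PiLp.inner_apply, Fin.sum_univ_succ, sub_eq_add_neg]

/-- The partial Fourier transform of `χ` in the second variable. -/
def partialFourier {n : ℕ}
    (χ : 𝓢(EuclideanSpace ℝ (Fin (n + 1)) × EuclideanSpace ℝ (Fin (n + 1)), ℂ))
    (u s : EuclideanSpace ℝ (Fin (n + 1))) : ℂ :=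
  ∫ y, Complex.exp (-Complex.I * (mink u y : ℂ)) * χ (s, y)

/-- The reflection turns the Lorentzian pairing into the Euclidean one; the factor `(2π)⁻¹`
compensates for the kernel `exp(-2πi⟨y, w⟩)`. -/
theorem partialFourier_eq {n : ℕ}
    (χ : 𝓢(EuclideanSpace ℝ (Fin (n + 1)) × EuclideanSpace ℝ (Fin (n + 1)), ℂ))
    (u s : EuclideanSpace ℝ (Fin (n + 1))) :
    partialFourier χ u s
      = (FourierTransform.fourier (slice χ s)) ((2 * Real.pi)⁻¹ • reflection n u) := by
  rw [SchwartzMap.fourier_coe, Real.fourier_eq']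
  unfold partialFourier
  refine integral_congr_ae (Eventually.of_forall fun y => ?_)
  simp only [smul_eq_mul, slice_apply, inner_smul_right, inner_reflection]
  congr 2
  have hpi : (Real.pi : ℂ) ≠ 0 := by exact_mod_cast Real.pi_ne_zero
  push_cast
  field_simp

theorem exists_partialFourier_bound {n : ℕ}
    (χ : 𝓢(EuclideanSpace ℝ (Fin (n + 1)) × EuclideanSpace ℝ (Fin (n + 1)), ℂ)) :
    ∃ g : EuclideanSpace ℝ (Fin (n + 1)) → ℝ, Integrable g ∧
      ∀ u s, ‖partialFourier χ u s‖ ≤ g u := by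
  obtain ⟨C, hC⟩ := exists_fourier_slice_bound χ (n + 2)
  refine ⟨fun u => C * ((1 + ‖(2 * Real.pi)⁻¹ • u‖) ^ (n + 2))⁻¹, ?_, fun u s => ?_⟩
  · refine Integrable.const_mul ?_ C
    have h1 : Integrable fun u : EuclideanSpace ℝ (Fin (n + 1)) => ((1 + ‖u‖) ^ (n + 2))⁻¹ := by
      have hint : Integrable
          (fun p : EuclideanSpace ℝ (Fin (n + 1)) => (1 + ‖p‖) ^ (-((n + 2 : ℕ) : ℝ))) := by
        refine integrable_one_add_norm ?_
        simp
      refine hint.congr (Eventually.of_forall fun p => ?_)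
      simp only
      rw [Real.rpow_neg (by positivity), Real.rpow_natCast]
    exact h1.comp_smul (by positivity)
  · rw [partialFourier_eq]
    refine (hC s _).trans ?_
    rw [norm_smul, LinearIsometryEquiv.norm_map, ← norm_smul]

/-- Fourier inversion at the origin. The reflection preserves volume, and `(2π)^d` is the Jacobian
of the rescaling. -/
theorem integral_partialFourier {n : ℕ}
    (χ : 𝓢(EuclideanSpace ℝ (Fin (n + 1)) × EuclideanSpace ℝ (Fin (n + 1)), ℂ)) :
    ∫ u, partialFourier χ u 0 = (2 * Real.pi) ^ (n + 1) * χ 0 := by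
  simp only [partialFourier_eq]
  set g := slice χ 0
  have h1 : ∫ u, (FourierTransform.fourier g) ((2 * Real.pi)⁻¹ • reflection n u)
      = ∫ u, (FourierTransform.fourier g) ((2 * Real.pi)⁻¹ • u) :=
    (reflection n).measurePreserving.integral_comp
      (reflection n).toHomeomorph.measurableEmbedding
      fun u => (FourierTransform.fourier g) ((2 * Real.pi)⁻¹ • u)
  have h2 : ∫ w, (FourierTransform.fourier g) w = g 0 := by
    have h3 : FourierTransformInv.fourierInv (FourierTransform.fourier g) = g :=
      FourierTransform.fourierInv_fourier_eq g
    conv_rhs => rw [← h3]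
    rw [SchwartzMap.fourierInv_coe, Real.fourierInv_eq']
    simp
  rw [h1, Measure.integral_comp_smul, h2]
  simp only [finrank_euclideanSpace, Fintype.card_fin, inv_pow, inv_inv]
  rw [abs_of_nonneg (by positivity), Complex.real_smul]
  push_cast
  rfl

theorem continuous_partialFourier {n : ℕ}
    (χ : 𝓢(EuclideanSpace ℝ (Fin (n + 1)) × EuclideanSpace ℝ (Fin (n + 1)), ℂ)) :
    Continuous fun z : EuclideanSpace ℝ (Fin (n + 1)) × EuclideanSpace ℝ (Fin (n + 1)) =>
      partialFourier χ z.1 z.2 := by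
  obtain ⟨C, hC⟩ := exists_slice_bound χ (n + 2)
  have hcont : Continuous fun w : (EuclideanSpace ℝ (Fin (n + 1)) × EuclideanSpace ℝ (Fin (n + 1)))
      × EuclideanSpace ℝ (Fin (n + 1)) =>
      Complex.exp (-Complex.I * (mink w.1.1 w.2 : ℂ)) * χ (w.1.2, w.2) := by
    have h1 := continuous_mink.comp ((continuous_fst.comp continuous_fst).prodMk
      (continuous_snd (X := EuclideanSpace ℝ (Fin (n + 1)) × EuclideanSpace ℝ (Fin (n + 1)))
        (Y := EuclideanSpace ℝ (Fin (n + 1)))))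
    refine Continuous.mul ?_ (χ.continuous.comp (by fun_prop))
    exact Complex.continuous_exp.comp
      (continuous_const.mul (Complex.continuous_ofReal.comp h1))
  refine continuous_of_dominated (bound := fun y => C * ((1 + ‖y‖) ^ (n + 2))⁻¹)
    (fun z => ?_) (fun z => Eventually.of_forall fun y => ?_) ?_
    (Eventually.of_forall fun y => ?_)
  · exact (hcont.comp (continuous_const.prodMk continuous_id)).aestronglyMeasurable
  · rw [norm_mul, neg_mul, ← mul_neg, ← Complex.ofReal_neg, Complex.norm_exp_I_mul_ofReal, one_mul]
    exact hC _ _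
  · refine Integrable.const_mul ?_ C
    have hint : Integrable
        (fun p : EuclideanSpace ℝ (Fin (n + 1)) => (1 + ‖p‖) ^ (-((n + 2 : ℕ) : ℝ))) := by
      refine integrable_one_add_norm ?_
      simp
    refine hint.congr (Eventually.of_forall fun p => ?_)
    simp only
    rw [Real.rpow_neg (by positivity), Real.rpow_natCast]
  · exact hcont.comp (continuous_id.prodMk continuous_const)

theorem integrable_cutoff {n : ℕ}
    (χ : 𝓢(EuclideanSpace ℝ (Fin (n + 1)) × EuclideanSpace ℝ (Fin (n + 1)), ℂ)) {ε : ℝ}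
    (hε : ε ≠ 0) :
    Integrable fun z : EuclideanSpace ℝ (Fin (n + 1)) × EuclideanSpace ℝ (Fin (n + 1)) =>
      Complex.exp (-Complex.I * (mink z.1 z.2 : ℂ)) * χ (ε • z) := by
  have h1 : Integrable fun z : EuclideanSpace ℝ (Fin (n + 1)) × EuclideanSpace ℝ (Fin (n + 1)) =>
      χ (ε • z) := by
    have : (volume : Measure (EuclideanSpace ℝ (Fin (n + 1)) ×
        EuclideanSpace ℝ (Fin (n + 1)))).IsAddHaarMeasure := by
      rw [Measure.volume_eq_prod]
      infer_instance
    exact χ.integrable.comp_smul hε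
  refine h1.mono ?_ (Eventually.of_forall fun z => ?_)
  · refine AEStronglyMeasurable.mul ?_ h1.aestronglyMeasurable
    exact (Complex.continuous_exp.comp (continuous_const.mul
      (Complex.continuous_ofReal.comp continuous_mink))).aestronglyMeasurable
  · rw [norm_mul, neg_mul, ← mul_neg, ← Complex.ofReal_neg, Complex.norm_exp_I_mul_ofReal, one_mul]

/-- The regularized oscillatory integral of the plane wave `exp(i (φ(x) + y b))`. -/
def planeWaveIntegral {n : ℕ}
    (χ : 𝓢(EuclideanSpace ℝ (Fin (n + 1)) × EuclideanSpace ℝ (Fin (n + 1)), ℂ)) (ε : ℝ)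
    (φ : EuclideanSpace ℝ (Fin (n + 1)) → ℝ) (b : EuclideanSpace ℝ (Fin (n + 1))) : ℂ :=
  ∫ z, Complex.exp (-Complex.I * (mink z.1 z.2 : ℂ)) * χ (ε • z)
    * Complex.exp (Complex.I * ((φ z.1 + mink z.2 b : ℝ) : ℂ))

theorem integral_comp_add_smul {E : Type*} [NormedAddCommGroup E] [NormedSpace ℝ E]
    [FiniteDimensional ℝ E] [MeasurableSpace E] [BorelSpace E] (ν : Measure E)
    [ν.IsAddHaarMeasure] (f : E → ℂ) (b : E) (ε : ℝ) :
    ∫ u, f (b + ε • u) ∂ν = |(ε ^ Module.finrank ℝ E)⁻¹| • ∫ u, f u ∂ν := by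
  rw [Measure.integral_comp_smul ν (fun u => f (b + u)) ε, integral_add_left_eq_self f b]

/-- The plane wave in `y` shifts `x` to `x - b` in the kernel. Setting `x = b + εu` and rescaling
`y` by `ε` moves `ε` out of the oscillating kernel; the two Jacobians cancel. Afterwards `ε` enters
only in arguments where `φ` and the partial Fourier transform are continuous. -/
theorem planeWaveIntegral_eq {n : ℕ}
    (χ : 𝓢(EuclideanSpace ℝ (Fin (n + 1)) × EuclideanSpace ℝ (Fin (n + 1)), ℂ)) {ε : ℝ}
    (hε : ε ≠ 0) {φ : EuclideanSpace ℝ (Fin (n + 1)) → ℝ} (hφ : Continuous φ)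
    (b : EuclideanSpace ℝ (Fin (n + 1))) :
    planeWaveIntegral χ ε φ b = ∫ u, Complex.exp (Complex.I * (φ (b + ε • u) : ℂ))
      * partialFourier χ u (ε • (b + ε • u)) := by
  have hint : Integrable
      (fun z : EuclideanSpace ℝ (Fin (n + 1)) × EuclideanSpace ℝ (Fin (n + 1)) =>
        Complex.exp (-Complex.I * (mink z.1 z.2 : ℂ)) * χ (ε • z)
          * Complex.exp (Complex.I * ((φ z.1 + mink z.2 b : ℝ) : ℂ))) := by
    refine (integrable_cutoff χ hε).mul_bdd (c := 1) ?_ (Eventually.of_forall fun z => ?_)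
    · have h1 : Continuous fun z : EuclideanSpace ℝ (Fin (n + 1)) × EuclideanSpace ℝ (Fin (n + 1)) =>
          φ z.1 + mink z.2 b :=
        (hφ.comp continuous_fst).add (continuous_mink.comp (continuous_snd.prodMk continuous_const))
      exact (Complex.continuous_exp.comp (continuous_const.mul
        (Complex.continuous_ofReal.comp h1))).aestronglyMeasurable
    · rw [Complex.norm_exp_I_mul_ofReal]
  -- `H` is the result of the `y` integration at fixed `x`, with the plane wave absorbed into `mink
  -- (x - b) y`.
  set H : EuclideanSpace ℝ (Fin (n + 1)) → ℂ := fun x => Complex.exp (Complex.I * (φ x : ℂ))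
    * ∫ y, Complex.exp (-Complex.I * (mink (x - b) y : ℂ)) * χ (ε • (x, y)) with hH
  have h1 : planeWaveIntegral χ ε φ b = ∫ x, H x := by
    unfold planeWaveIntegral
    rw [Measure.volume_eq_prod] at hint ⊢
    rw [integral_prod _ hint]
    refine integral_congr_ae (Eventually.of_forall fun x => ?_)
    simp only [hH]
    rw [← integral_const_mul]
    refine integral_congr_ae (Eventually.of_forall fun y => ?_)
    simp only
    have : mink (x - b) y = mink x y - mink y b := by
      rw [sub_eq_add_neg, ← neg_one_smul ℝ b, mink_add_left, mink_smul_left, mink_comm b y]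
      ring
    rw [this, mul_right_comm, ← Complex.exp_add, ← mul_assoc, ← Complex.exp_add]
    congr 2
    push_cast
    ring
  have h2 : ∀ u, Complex.exp (Complex.I * (φ (b + ε • u) : ℂ))
      * partialFourier χ u (ε • (b + ε • u)) = |ε ^ (n + 1)| • H (b + ε • u) := by
    intro u
    have h3 := integral_comp_add_smul (volume : Measure (EuclideanSpace ℝ (Fin (n + 1))))
      (fun y => Complex.exp (-Complex.I * (mink u y : ℂ)) * χ (ε • (b + ε • u), y)) 0 ε
    simp only [zero_add, finrank_euclideanSpace, Fintype.card_fin] at h3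
    have h4 : partialFourier χ u (ε • (b + ε • u)) = |ε ^ (n + 1)| •
        ∫ y, Complex.exp (-Complex.I * (mink u (ε • y) : ℂ)) * χ (ε • (b + ε • u), ε • y) := by
      rw [h3, smul_smul, ← abs_mul, mul_inv_cancel₀ (pow_ne_zero _ hε), abs_one, one_smul]
      rfl
    rw [h4]
    simp only [hH, add_sub_cancel_left, mul_smul_comm]
    congr 2
    refine integral_congr_ae (Eventually.of_forall fun y => ?_)
    simp only
    rw [mink_comm u, mink_smul_left, mink_smul_left, mink_comm y]
    rfl
  have h5 := integral_comp_add_smul (volume : Measure (EuclideanSpace ℝ (Fin (n + 1)))) H b ε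
  simp only [finrank_euclideanSpace, Fintype.card_fin] at h5
  simp only [h2]
  rw [integral_smul, h5, smul_smul, ← abs_mul, mul_inv_cancel₀ (pow_ne_zero _ hε), abs_one,
    one_smul, h1]

/-- After the substitution `φ` occurs only in a unimodular factor, and the decay of the partial
Fourier transform in `u` is uniform in its other argument. The uniformity provides the majorant
needed in `L²`. -/
theorem exists_planeWaveIntegral_bound {n : ℕ}
    (χ : 𝓢(EuclideanSpace ℝ (Fin (n + 1)) × EuclideanSpace ℝ (Fin (n + 1)), ℂ)) :
    ∃ C, ∀ ε : ℝ, ε ≠ 0 → ∀ φ : EuclideanSpace ℝ (Fin (n + 1)) → ℝ, Continuous φ → ∀ b,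
      ‖planeWaveIntegral χ ε φ b‖ ≤ C := by
  obtain ⟨g, hg, hb⟩ := exists_partialFourier_bound χ
  refine ⟨∫ u, g u, fun ε hε φ hφ b => ?_⟩
  rw [planeWaveIntegral_eq χ hε hφ]
  refine norm_integral_le_of_norm_le hg (Eventually.of_forall fun u => ?_)
  rw [norm_mul, Complex.norm_exp_I_mul_ofReal, one_mul]
  exact hb _ _

/-- As `ε → 0` the argument of `φ` collapses to `b`, and the remaining integral is `(2π)^d χ(0)` by
Fourier inversion. -/
theorem tendsto_planeWaveIntegral {n : ℕ}
    (χ : 𝓢(EuclideanSpace ℝ (Fin (n + 1)) × EuclideanSpace ℝ (Fin (n + 1)), ℂ)) (hχ : χ 0 = 1)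
    {φ : EuclideanSpace ℝ (Fin (n + 1)) → ℝ} (hφ : Continuous φ)
    (b : EuclideanSpace ℝ (Fin (n + 1))) :
    Tendsto (fun ε => planeWaveIntegral χ ε φ b) (𝓝[≠] 0)
      (𝓝 ((2 * Real.pi) ^ (n + 1) * Complex.exp (Complex.I * (φ b : ℂ)))) := by
  obtain ⟨g, hg, hb⟩ := exists_partialFourier_bound χ
  have hc : Continuous fun w : ℝ × EuclideanSpace ℝ (Fin (n + 1)) =>
      Complex.exp (Complex.I * (φ (b + w.1 • w.2) : ℂ))
        * partialFourier χ w.2 (w.1 • (b + w.1 • w.2)) := by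
    have h1 : Continuous fun w : ℝ × EuclideanSpace ℝ (Fin (n + 1)) => b + w.1 • w.2 := by
      fun_prop
    refine Continuous.mul ?_ ?_
    · exact Complex.continuous_exp.comp
        (continuous_const.mul (Complex.continuous_ofReal.comp (hφ.comp h1)))
    · exact (continuous_partialFourier χ).comp (continuous_snd.prodMk (continuous_fst.smul h1))
  have ht : Tendsto (fun ε : ℝ => ∫ u, Complex.exp (Complex.I * (φ (b + ε • u) : ℂ))
      * partialFourier χ u (ε • (b + ε • u))) (𝓝[≠] 0)
      (𝓝 (∫ u, Complex.exp (Complex.I * (φ b : ℂ)) * partialFourier χ u 0)) := by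
    refine tendsto_integral_filter_of_dominated_convergence g
      (Eventually.of_forall fun ε => ?_)
      (Eventually.of_forall fun ε => Eventually.of_forall fun u => ?_) hg
      (Eventually.of_forall fun u => ?_)
    · exact (hc.comp (continuous_const.prodMk continuous_id)).aestronglyMeasurable
    · rw [norm_mul, Complex.norm_exp_I_mul_ofReal, one_mul]
      exact hb _ _
    · have h2 := (hc.comp (continuous_id.prodMk (continuous_const (y := u)))).tendsto 0
      simp only [Function.comp_apply, id, zero_smul, add_zero] at h2
      exact h2.mono_left nhdsWithin_le_nhds
  rw [integral_const_mul, integral_partialFourier, hχ, mul_one, mul_comm] at ht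
  refine ht.congr' ?_
  filter_upwards [self_mem_nhdsWithin] with ε hε
  rw [planeWaveIntegral_eq χ hε hφ]

/-! ### Oscillatory integrals of phases in `L²` -/

section Phase

variable {α : Type*} [MeasurableSpace α] {ν : Measure α} {n : ℕ}
  {q b : α → EuclideanSpace ℝ (Fin (n + 1))}
  {l : EuclideanSpace ℝ (Fin (n + 1)) → EuclideanSpace ℝ (Fin (n + 1))}

theorem measurable_mink {β : Type*} [MeasurableSpace β] {x y : β → EuclideanSpace ℝ (Fin (n + 1))}
    (hx : Measurable x) (hy : Measurable y) : Measurable fun p => mink (x p) (y p) :=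
  continuous_mink.measurable.comp (hx.prodMk hy)

theorem measurable_planeWave (hq : Measurable q) (hb : Measurable b)
    (z : EuclideanSpace ℝ (Fin (n + 1)) × EuclideanSpace ℝ (Fin (n + 1))) :
    Measurable fun p => mink (l z.1) (q p) + mink z.2 (b p) :=
  (measurable_mink measurable_const hq).add (measurable_mink measurable_const hb)

theorem measurable_planeWave_limit (hl : Continuous l) (hq : Measurable q) (hb : Measurable b) :
    Measurable fun p => mink (l (b p)) (q p) :=
  measurable_mink (hl.measurable.comp hb) hq

theorem stronglyMeasurable_integrand (hl : Continuous l) (hq : Measurable q) (hb : Measurable b)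
    (χ : 𝓢(EuclideanSpace ℝ (Fin (n + 1)) × EuclideanSpace ℝ (Fin (n + 1)), ℂ)) (ε : ℝ) :
    StronglyMeasurable
      fun w : (EuclideanSpace ℝ (Fin (n + 1)) × EuclideanSpace ℝ (Fin (n + 1))) × α =>
        Complex.exp (-Complex.I * (mink w.1.1 w.1.2 : ℂ)) * χ (ε • w.1)
          * Complex.exp (Complex.I * ((mink (l w.1.1) (q w.2) + mink w.1.2 (b w.2) : ℝ) : ℂ)) := by
  have h1 : Measurable
      fun w : (EuclideanSpace ℝ (Fin (n + 1)) × EuclideanSpace ℝ (Fin (n + 1))) × α =>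
        mink (l w.1.1) (q w.2) + mink w.1.2 (b w.2) :=
    (measurable_mink (hl.measurable.comp (measurable_fst.comp measurable_fst))
      (hq.comp measurable_snd)).add
      (measurable_mink (measurable_snd.comp measurable_fst) (hb.comp measurable_snd))
  have h2 : Measurable
      fun w : (EuclideanSpace ℝ (Fin (n + 1)) × EuclideanSpace ℝ (Fin (n + 1))) × α =>
        mink w.1.1 w.1.2 :=
    measurable_mink (measurable_fst.comp measurable_fst) (measurable_snd.comp measurable_fst)
  have h3 : Measurable
      fun w : (EuclideanSpace ℝ (Fin (n + 1)) × EuclideanSpace ℝ (Fin (n + 1))) × α =>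
        χ (ε • w.1) :=
    (χ.continuous.comp (continuous_const_smul ε)).measurable.comp measurable_fst
  exact (((Complex.measurable_exp.comp (measurable_const.mul
    (Complex.measurable_ofReal.comp h2))).mul h3).mul (Complex.measurable_exp.comp
    (measurable_const.mul (Complex.measurable_ofReal.comp h1)))).stronglyMeasurable

theorem stronglyMeasurable_planeWaveIntegral (hl : Continuous l) (hq : Measurable q)
    (hb : Measurable b)
    (χ : 𝓢(EuclideanSpace ℝ (Fin (n + 1)) × EuclideanSpace ℝ (Fin (n + 1)), ℂ)) (ε : ℝ) :
    StronglyMeasurable fun p => planeWaveIntegral χ ε (fun x => mink (l x) (q p)) (b p) :=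
  (stronglyMeasurable_integrand hl hq hb χ ε).integral_prod_left

theorem continuous_mink_left (hl : Continuous l) (c : EuclideanSpace ℝ (Fin (n + 1))) :
    Continuous fun x => mink (l x) c :=
  continuous_mink.comp (hl.prodMk continuous_const)

theorem integrable_smul_phaseMul (hl : Continuous l) (hq : Measurable q) (hb : Measurable b)
    (χ : 𝓢(EuclideanSpace ℝ (Fin (n + 1)) × EuclideanSpace ℝ (Fin (n + 1)), ℂ)) {ε : ℝ}
    (hε : ε ≠ 0) (ψ : Lp ℂ 2 ν) :
    Integrable fun z : EuclideanSpace ℝ (Fin (n + 1)) × EuclideanSpace ℝ (Fin (n + 1)) =>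
      (Complex.exp (-Complex.I * (mink z.1 z.2 : ℂ)) * χ (ε • z)) •
        phaseMul ν (measurable_planeWave (l := l) hq hb z) ψ := by
  have hc : Continuous fun z : EuclideanSpace ℝ (Fin (n + 1)) × EuclideanSpace ℝ (Fin (n + 1)) =>
      phaseMul ν (measurable_planeWave (l := l) hq hb z) ψ := by
    refine continuous_phaseMul (measurable_planeWave (l := l) hq hb) (fun p => ?_) ψ
    exact ((continuous_mink_left hl (q p)).comp continuous_fst).add
      ((continuous_mink_left continuous_id (b p)).comp continuous_snd)
  refine ((integrable_cutoff χ hε).norm.mul_const ‖ψ‖).mono'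
    ((integrable_cutoff χ hε).aestronglyMeasurable.smul hc.aestronglyMeasurable)
    (Eventually.of_forall fun z => ?_)
  rw [norm_smul, LinearIsometryEquiv.norm_map]

/-- A Bochner integral in `L²` is not defined pointwise. It is identified by pairing with an
arbitrary `v` and exchanging the integrations over `z` and `p`. -/
theorem ae_integral_smul_phaseMul [SFinite ν] (hl : Continuous l) (hq : Measurable q)
    (hb : Measurable b)
    (χ : 𝓢(EuclideanSpace ℝ (Fin (n + 1)) × EuclideanSpace ℝ (Fin (n + 1)), ℂ)) {ε : ℝ}
    (hε : ε ≠ 0) (ψ : Lp ℂ 2 ν) :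
    (∫ z, (Complex.exp (-Complex.I * (mink z.1 z.2 : ℂ)) * χ (ε • z)) •
        phaseMul ν (measurable_planeWave (l := l) hq hb z) ψ : Lp ℂ 2 ν)
      =ᵐ[ν] fun p => planeWaveIntegral χ ε (fun x => mink (l x) (q p)) (b p) * ψ p := by
  obtain ⟨C, hC⟩ := exists_planeWaveIntegral_bound χ
  have hmem : MemLp (fun p => planeWaveIntegral χ ε (fun x => mink (l x) (q p)) (b p) * ψ p) 2 ν := by
    refine MemLp.of_le_mul (c := C) (Lp.memLp ψ)
      ((stronglyMeasurable_planeWaveIntegral hl hq hb χ ε).aestronglyMeasurable.mul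
        (Lp.aestronglyMeasurable ψ)) (Eventually.of_forall fun p => ?_)
    rw [norm_mul]
    exact mul_le_mul_of_nonneg_right (hC ε hε _ (continuous_mink_left hl _) _) (norm_nonneg _)
  have key : (∫ z, (Complex.exp (-Complex.I * (mink z.1 z.2 : ℂ)) * χ (ε • z)) •
        phaseMul ν (measurable_planeWave (l := l) hq hb z) ψ : Lp ℂ 2 ν) = hmem.toLp := by
    refine ext_inner_left ℂ fun v => ?_
    rw [← integral_inner (integrable_smul_phaseMul hl hq hb χ hε ψ) v]
    have h1 : ∀ z : EuclideanSpace ℝ (Fin (n + 1)) × EuclideanSpace ℝ (Fin (n + 1)),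
        inner ℂ v ((Complex.exp (-Complex.I * (mink z.1 z.2 : ℂ)) * χ (ε • z)) •
          phaseMul ν (measurable_planeWave (l := l) hq hb z) ψ)
        = ∫ p, Complex.exp (-Complex.I * (mink z.1 z.2 : ℂ)) * χ (ε • z)
          * Complex.exp (Complex.I * ((mink (l z.1) (q p) + mink z.2 (b p) : ℝ) : ℂ))
          * inner ℂ (v p) (ψ p) ∂ν := by
      intro z
      rw [inner_smul_right, L2.inner_def, ← integral_const_mul]
      refine integral_congr_ae ?_
      filter_upwards [coeFn_phaseMul (measurable_planeWave (l := l) hq hb z) ψ] with p hp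
      rw [hp, ← smul_eq_mul (Complex.exp (Complex.I * _)), inner_smul_right]
      ring
    simp only [h1]
    have hint : Integrable
        (fun w : (EuclideanSpace ℝ (Fin (n + 1)) × EuclideanSpace ℝ (Fin (n + 1))) × α =>
          Complex.exp (-Complex.I * (mink w.1.1 w.1.2 : ℂ)) * χ (ε • w.1)
          * Complex.exp (Complex.I * ((mink (l w.1.1) (q w.2) + mink w.1.2 (b w.2) : ℝ) : ℂ))
          * inner ℂ (v w.2) (ψ w.2)) (volume.prod ν) := by
      have h2 := (integrable_cutoff χ hε).mul_prod (L2.integrable_inner (𝕜 := ℂ) v ψ)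
      refine h2.mono ?_ (Eventually.of_forall fun w => ?_)
      · exact (stronglyMeasurable_integrand hl hq hb χ ε).aestronglyMeasurable.mul
          (L2.integrable_inner (𝕜 := ℂ) v ψ).aestronglyMeasurable.comp_snd
      · simp only [norm_mul, Complex.norm_exp_I_mul_ofReal, mul_one]
        exact le_rfl
    rw [integral_integral_swap hint, L2.inner_def]
    refine integral_congr_ae ?_
    filter_upwards [hmem.coeFn_toLp] with p hp
    rw [hp, integral_mul_const, ← smul_eq_mul (planeWaveIntegral _ _ _ _), inner_smul_right]
    rfl
  rw [key]
  exact hmem.coeFn_toLp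

theorem tendsto_integral_smul_phaseMul [SFinite ν] (hl : Continuous l) (hq : Measurable q)
    (hb : Measurable b)
    (χ : 𝓢(EuclideanSpace ℝ (Fin (n + 1)) × EuclideanSpace ℝ (Fin (n + 1)), ℂ)) (hχ : χ 0 = 1)
    (ψ : Lp ℂ 2 ν) :
    Tendsto (fun ε : ℝ => (((2 * Real.pi) ^ (n + 1))⁻¹ : ℂ) •
      ∫ z, (Complex.exp (-Complex.I * (mink z.1 z.2 : ℂ)) * χ (ε • z)) •
        phaseMul ν (measurable_planeWave (l := l) hq hb z) ψ) (𝓝[≠] 0)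
      (𝓝 (phaseMul ν (measurable_planeWave_limit hl hq hb) ψ)) := by
  obtain ⟨C, hC⟩ := exists_planeWaveIntegral_bound χ
  set c : ℂ := ((2 * Real.pi) ^ (n + 1))⁻¹ with hc
  have hc0 : ((2 * Real.pi) ^ (n + 1) : ℂ) ≠ 0 := by
    exact pow_ne_zero _ (mul_ne_zero two_ne_zero (by exact_mod_cast Real.pi_ne_zero))
  refine tendsto_Lp_two_of_dominated
    (F' := fun ε p => c * (planeWaveIntegral χ ε (fun x => mink (l x) (q p)) (b p) * ψ p))
    -- `‖c‖ * C` bounds the normalised integral, and `1` is the modulus of the limiting phase.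
    (g := fun p => (‖c‖ * C + 1) * ‖ψ p‖) ?_
    (coeFn_phaseMul (measurable_planeWave_limit hl hq hb) ψ) ((Lp.memLp ψ).norm.const_mul _) ?_
    (Eventually.of_forall fun p => ?_)
  · filter_upwards [self_mem_nhdsWithin] with ε hε
    filter_upwards [Lp.coeFn_smul c (∫ z, (Complex.exp (-Complex.I * (mink z.1 z.2 : ℂ))
        * χ (ε • z)) • phaseMul ν (measurable_planeWave (l := l) hq hb z) ψ),
      ae_integral_smul_phaseMul hl hq hb χ hε ψ] with p h1 h2
    rw [h1, Pi.smul_apply, h2, smul_eq_mul]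
  · filter_upwards [self_mem_nhdsWithin] with ε hε
    refine Eventually.of_forall fun p => (norm_sub_le _ _).trans ?_
    have h1 := hC ε hε _ (continuous_mink_left hl (q p)) (b p)
    rw [norm_mul, norm_mul, norm_mul, Complex.norm_exp_I_mul_ofReal, ← mul_assoc, ← add_mul]
    gcongr
  · have h1 := ((tendsto_planeWaveIntegral χ hχ (continuous_mink_left hl (q p)) (b p)).mul_const
      (ψ p)).const_mul c
    rwa [mul_assoc, hc, inv_mul_cancel_left₀ hc0] at h1

end Phase

/-! ### The deformed field -/

/-- Two plane wave terms are allowed, on possibly different `L²` spaces, for creation and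
annihilation. In the limit `x` is replaced by the frequency `b` dual to `y`, which leaves the phase
`exp(i l(b)·q)`. -/
theorem hasWarpedValue_of_planeWaves {H : Type*} [NormedAddCommGroup H] [InnerProductSpace ℂ H]
    [CompleteSpace H] {n : ℕ} {θ : Matrix (Fin (n + 1)) (Fin (n + 1)) ℝ}
    {W : EuclideanSpace ℝ (Fin (n + 1)) → H ≃ₗᵢ[ℂ] H} {A : H →ₗ.[ℂ] H} {Ψ : H}
    (hdom : ∀ x y, W y Ψ ∈
      (sandwich (W (θ.toEuclideanLin x)) A (W (θ.toEuclideanLin x)).symm).domain)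
    {α β : Type*} [MeasurableSpace α] [MeasurableSpace β] {ν : Measure α} [SFinite ν]
    {ρ : Measure β} [SFinite ρ] {q b : α → EuclideanSpace ℝ (Fin (n + 1))}
    {r c : β → EuclideanSpace ℝ (Fin (n + 1))}
    {l k : EuclideanSpace ℝ (Fin (n + 1)) → EuclideanSpace ℝ (Fin (n + 1))}
    (hl : Continuous l) (hk : Continuous k) (hq : Measurable q) (hb : Measurable b)
    (hr : Measurable r) (hc : Measurable c) (S : Lp ℂ 2 ν →L[ℂ] H) (T : Lp ℂ 2 ρ →L[ℂ] H)
    (ψ : Lp ℂ 2 ν) (φ : Lp ℂ 2 ρ)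
    (heval : ∀ z : EuclideanSpace ℝ (Fin (n + 1)) × EuclideanSpace ℝ (Fin (n + 1)),
      evalAt (sandwich (W (θ.toEuclideanLin z.1)) A (W (θ.toEuclideanLin z.1)).symm) (W z.2 Ψ)
        = S (phaseMul ν (measurable_planeWave (l := l) hq hb z) ψ)
          + T (phaseMul ρ (measurable_planeWave (l := k) hr hc z) φ)) :
    HasWarpedValue θ W A Ψ (S (phaseMul ν (measurable_planeWave_limit hl hq hb) ψ)
      + T (phaseMul ρ (measurable_planeWave_limit hk hr hc) φ)) := by
  have hint : ∀ (χ : 𝓢(EuclideanSpace ℝ (Fin (n + 1)) × EuclideanSpace ℝ (Fin (n + 1)), ℂ))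
      (ε : ℝ), warpedIntegrand θ W A Ψ χ ε = fun z =>
        S ((Complex.exp (-Complex.I * (mink z.1 z.2 : ℂ)) * χ (ε • z)) •
          phaseMul ν (measurable_planeWave (l := l) hq hb z) ψ)
        + T ((Complex.exp (-Complex.I * (mink z.1 z.2 : ℂ)) * χ (ε • z)) •
          phaseMul ρ (measurable_planeWave (l := k) hr hc z) φ) := by
    intro χ ε
    funext z
    unfold warpedIntegrand
    rw [heval z, ContinuousLinearMap.map_smul, ContinuousLinearMap.map_smul, smul_add]
  refine ⟨hdom, fun χ _ ε hε => ?_, fun χ hχ => ?_⟩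
  · rw [hint]
    exact (S.integrable_comp (integrable_smul_phaseMul hl hq hb χ hε ψ)).add
      (T.integrable_comp (integrable_smul_phaseMul hk hr hc χ hε φ))
  · have h1 := (S.continuous.tendsto _).comp (tendsto_integral_smul_phaseMul hl hq hb χ hχ ψ)
    have h2 := (T.continuous.tendsto _).comp (tendsto_integral_smul_phaseMul hk hr hc χ hχ φ)
    refine (h1.add h2).congr' ?_
    filter_upwards [self_mem_nhdsWithin] with ε hε
    have i1 := integrable_smul_phaseMul hl hq hb χ hε ψ
    have i2 := integrable_smul_phaseMul hk hr hc χ hε φ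
    rw [hint, integral_add (S.integrable_comp i1) (T.integrable_comp i2),
      S.integral_comp_comm i1, T.integral_comp_comm i2, smul_add]
    simp only [Function.comp_apply, ContinuousLinearMap.map_smul]

/-! ### Creation and annihilation terms as bounded images of plane waves. -/

theorem leftTensor_phaseMul {α : Type*} [MeasurableSpace α] (μ : Measure α) [SigmaFinite μ]
    {φ : α → ℝ} (hφ : Measurable φ) {k : ℕ} (g : Lp ℂ 2 μ) (Ψ : NPart μ k) :
    leftTensor μ (phaseMul μ hφ g) k Ψ
      = phaseMul _ (hφ.comp (measurable_pi_apply (0 : Fin (k + 1)))) (leftTensor μ g k Ψ) := by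
  refine Lp.ext ?_
  filter_upwards [ae_leftTensor μ (phaseMul μ hφ g) Ψ, ae_leftTensor μ g Ψ,
    coeFn_phaseMul (hφ.comp (measurable_pi_apply (0 : Fin (k + 1)))) (leftTensor μ g k Ψ),
    ae_eval (0 : Fin (k + 1)) (coeFn_phaseMul hφ g)] with p h1 h2 h3 h4
  rw [h1, h3, h2, h4, mul_assoc]
  rfl

theorem leftTensor_tensorPow_phaseMul {α : Type*} [MeasurableSpace α] (μ : Measure α)
    [SigmaFinite μ] {φ : α → ℝ} (hφ : Measurable φ) {k : ℕ} (g : Lp ℂ 2 μ) (Ψ : NPart μ k) :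
    leftTensor μ g k (tensorPow μ (phaseMul μ hφ) k Ψ)
      = phaseMul _ (φ := fun p : Fin (k + 1) → α => ∑ i, φ (Fin.tail p i))
        (Finset.measurable_sum _ fun i _ => hφ.comp (measurable_pi_apply (Fin.succ i)))
        (leftTensor μ g k Ψ) := by
  rw [tensorPow_phaseMul]
  refine Lp.ext ?_
  filter_upwards [ae_leftTensor μ g (phaseMul _ (measurable_sum_phase hφ k) Ψ),
    ae_leftTensor μ g Ψ,
    coeFn_phaseMul (φ := fun p : Fin (k + 1) → α => ∑ i, φ (Fin.tail p i))
      (Finset.measurable_sum _ fun i _ => hφ.comp (measurable_pi_apply (Fin.succ i)))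
      (leftTensor μ g k Ψ),
    ae_tail (coeFn_phaseMul (measurable_sum_phase hφ k) Ψ)] with p h1 h2 h3 h4
  rw [h1, h3, h2, h4, mul_left_comm]

/-- Antilinearity of annihilation in `g` inverts the phase, which is the source of the sign `-θx` in
the annihilation term. -/
theorem adjoint_leftTensor_phaseMul {α : Type*} [MeasurableSpace α] (μ : Measure α)
    [SigmaFinite μ] {φ : α → ℝ} (hφ : Measurable φ) {k : ℕ} (g : Lp ℂ 2 μ)
    (Ψ : NPart μ (k + 1)) :
    ContinuousLinearMap.adjoint (leftTensor μ (phaseMul μ hφ g) k) Ψ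
      = ContinuousLinearMap.adjoint (leftTensor μ g k)
        ((phaseMul _ (hφ.comp (measurable_pi_apply (0 : Fin (k + 1))))).symm Ψ) := by
  refine ext_inner_left ℂ fun Φ => ?_
  rw [ContinuousLinearMap.adjoint_inner_right, ContinuousLinearMap.adjoint_inner_right,
    leftTensor_phaseMul, LinearIsometryEquiv.inner_map_eq_flip]

theorem single_self {α : Type*} [MeasurableSpace α] {μ : Measure α} [SigmaFinite μ] {k : ℕ}
    (ψ : symSub μ k) : (lp.single 2 k ψ : Fock μ) k = ψ :=
  lp.single_apply_self ..

theorem single_of_ne {α : Type*} [MeasurableSpace α] {μ : Measure α} [SigmaFinite μ] {j k : ℕ}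
    (h : j ≠ k) (ψ : symSub μ k) : (lp.single 2 k ψ : Fock μ) j = 0 :=
  lp.single_apply_ne _ _ _ h

theorem evalAt_field_single_zero {α : Type*} [MeasurableSpace α] (μ : Measure α) [SigmaFinite μ]
    (g h : Lp ℂ 2 μ) (ψ : symSub μ 0) :
    evalAt (field μ g h) (lp.single 2 0 ψ) = lp.single 2 1 (creation μ h 0 ψ) := by
  have hd : (lp.single 2 0 ψ : Fock μ) ∈ (field μ g h).domain := single_mem_finiteParticle μ 0 ψ
  unfold evalAt
  rw [dif_pos hd]
  ext1
  funext j
  change fieldSeq μ g h (lp.single 2 0 ψ) j = (lp.single 2 1 (creation μ h 0 ψ) : Fock μ) j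
  rcases j with _ | _ | j
  · simp only [fieldSeq]
    rw [single_of_ne one_ne_zero, single_of_ne zero_ne_one, map_zero]
  · simp only [fieldSeq]
    rw [single_of_ne (j := 0 + 2) (by omega), map_zero]
    refine (zero_add _).trans ?_
    exact (congrArg _ (single_self ψ)).trans (single_self (creation μ h 0 ψ)).symm
  · simp only [fieldSeq]
    rw [single_of_ne (j := j + 1 + 2) (by omega), single_of_ne (j := j + 1) (by omega),
      single_of_ne (j := j + 1 + 1) (by omega), map_zero, map_zero, zero_add]

theorem evalAt_field_single_succ {α : Type*} [MeasurableSpace α] (μ : Measure α) [SigmaFinite μ]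
    (g h : Lp ℂ 2 μ) (k : ℕ) (ψ : symSub μ (k + 1)) :
    evalAt (field μ g h) (lp.single 2 (k + 1) ψ)
      = lp.single 2 (k + 2) (creation μ h (k + 1) ψ) + lp.single 2 k (annihilation μ g k ψ) := by
  have hd : (lp.single 2 (k + 1) ψ : Fock μ) ∈ (field μ g h).domain :=
    single_mem_finiteParticle μ (k + 1) ψ
  unfold evalAt
  rw [dif_pos hd]
  ext1
  funext j
  change fieldSeq μ g h (lp.single 2 (k + 1) ψ) j
    = (lp.single 2 (k + 2) (creation μ h (k + 1) ψ) : Fock μ) j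
      + (lp.single 2 k (annihilation μ g k ψ) : Fock μ) j
  have hann : ∀ j, annihilation μ g j ((lp.single 2 (k + 1) ψ : Fock μ) (j + 1))
      = (lp.single 2 k (annihilation μ g k ψ) : Fock μ) j := fun j => by
    by_cases hj : j = k
    · subst hj
      rw [single_self, single_self]
    · rw [single_of_ne (j := j + 1) (by omega), single_of_ne hj, map_zero]
  have hcre : ∀ j, creation μ h j ((lp.single 2 (k + 1) ψ : Fock μ) j)
      = (lp.single 2 (k + 2) (creation μ h (k + 1) ψ) : Fock μ) (j + 1) := fun j => by
    by_cases hj : j = k + 1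
    · subst hj
      exact (congrArg _ (single_self ψ)).trans (single_self (creation μ h (k + 1) ψ)).symm
    · rw [single_of_ne hj, single_of_ne (j := j + 1) (by omega), map_zero]
  cases j with
  | zero =>
    rw [single_of_ne (j := 0) (k := k + 2) (by omega), zero_add]
    exact hann 0
  | succ j =>
    exact (congrArg₂ (· + ·) (hann (j + 1)) (hcre j)).trans (add_comm _ _)

theorem single_creation {α : Type*} [MeasurableSpace α] (μ : Measure α) [SigmaFinite μ]
    (g : Lp ℂ 2 μ) (k : ℕ) (ψ : symSub μ k) :
    (lp.single 2 (k + 1) (creation μ g k ψ) : Fock μ)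
      = (((Real.sqrt (k + 1) : ℝ) : ℂ) • component μ (k + 1)) (leftTensor μ g k ψ) := by
  rw [creation_apply, lp.single_smul]
  rfl

theorem single_annihilation {α : Type*} [MeasurableSpace α] (μ : Measure α) [SigmaFinite μ]
    (g : Lp ℂ 2 μ) (k : ℕ) (ψ : symSub μ (k + 1)) :
    (lp.single 2 k (annihilation μ g k ψ) : Fock μ)
      = (((Real.sqrt (k + 1) : ℝ) : ℂ) • component μ k ∘L
          ContinuousLinearMap.adjoint (leftTensor μ g k)) ψ := by
  rw [annihilation_apply, lp.single_smul]
  rfl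

theorem fockTranslation_symm {n : ℕ} {m : ℝ} (x : EuclideanSpace ℝ (Fin (n + 1))) :
    (fockTranslation n m x).symm = secondQuant (shellMeasure n m) (translation n m x).symm :=
  secondQuant_symm _ _

theorem measurable_shellPoint_eval {n k : ℕ} (m : ℝ) (i : Fin k) :
    Measurable fun p : Fin k → EuclideanSpace ℝ (Fin n) => shellPoint m (p i) :=
  (continuous_shellPoint m).measurable.comp (measurable_pi_apply i)

theorem measurable_sum_shellPoint {n k : ℕ} (m : ℝ) :
    Measurable fun p : Fin k → EuclideanSpace ℝ (Fin n) => ∑ i, shellPoint m (p i) :=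
  Finset.measurable_sum _ fun i _ => measurable_shellPoint_eval m i

theorem measurable_sum_shellPoint_tail {n k : ℕ} (m : ℝ) :
    Measurable fun p : Fin (k + 1) → EuclideanSpace ℝ (Fin n) =>
      ∑ i, shellPoint m (Fin.tail p i) :=
  Finset.measurable_sum _ fun i _ => measurable_shellPoint_eval m i.succ

/-- `W(y)` acts before the new particle exists, so `y` is paired only with the old momenta and `l x`
only with the created one. -/
theorem single_creation_translation {n : ℕ} {m : ℝ}
    (l : EuclideanSpace ℝ (Fin (n + 1)) → EuclideanSpace ℝ (Fin (n + 1)))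
    (z : EuclideanSpace ℝ (Fin (n + 1)) × EuclideanSpace ℝ (Fin (n + 1)))
    (h : OneParticle n m) (k : ℕ) (ψ : symSub (shellMeasure n m) k) :
    (lp.single 2 (k + 1) (creation (shellMeasure n m) (translation n m (l z.1) h) k
        (symPow (shellMeasure n m) (translation n m z.2) k ψ)) : FockSpace n m)
      = (((Real.sqrt (k + 1) : ℝ) : ℂ) • component (shellMeasure n m) (k + 1))
        (phaseMul _ (measurable_planeWave (l := l) (measurable_shellPoint_eval m 0)
          (measurable_sum_shellPoint_tail m) z) (leftTensor (shellMeasure n m) h k ψ)) := by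
  rw [single_creation]
  congr 1
  unfold translation
  rw [leftTensor_phaseMul]
  change phaseMul _ _ (leftTensor (shellMeasure n m) h k (tensorPow (shellMeasure n m)
    (phaseMul (shellMeasure n m) (measurable_mink_shellPoint m z.2)) k ψ)) = _
  rw [leftTensor_tensorPow_phaseMul]
  refine phaseMul_phaseMul _ _ _ (fun p => ?_) _
  rw [mink_sum_right]
  rfl

/-- Here `y` is paired with all `k + 1` momenta, including the one about to be annihilated, to which
`-l x` is attached as well. -/
theorem single_annihilation_translation {n : ℕ} {m : ℝ}
    (l : EuclideanSpace ℝ (Fin (n + 1)) → EuclideanSpace ℝ (Fin (n + 1)))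
    (z : EuclideanSpace ℝ (Fin (n + 1)) × EuclideanSpace ℝ (Fin (n + 1)))
    (g : OneParticle n m) (k : ℕ) (ψ : symSub (shellMeasure n m) (k + 1)) :
    (lp.single 2 k (annihilation (shellMeasure n m) (translation n m (l z.1) g) k
        (symPow (shellMeasure n m) (translation n m z.2) (k + 1) ψ)) : FockSpace n m)
      = (((Real.sqrt (k + 1) : ℝ) : ℂ) • component (shellMeasure n m) k ∘L
          ContinuousLinearMap.adjoint (leftTensor (shellMeasure n m) g k))
        (phaseMul _ (measurable_planeWave (l := fun x => -l x) (measurable_shellPoint_eval m 0)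
          (measurable_sum_shellPoint m) z) ψ) := by
  rw [single_annihilation]
  simp only [smul_apply, ContinuousLinearMap.comp_apply]
  congr 2
  unfold translation
  rw [adjoint_leftTensor_phaseMul]
  congr 1
  change (phaseMul _ _).symm (tensorPow (shellMeasure n m)
    (phaseMul (shellMeasure n m) (measurable_mink_shellPoint m z.2)) (k + 1) ψ) = _
  rw [tensorPow_phaseMul]
  refine phaseMul_phaseMul
    ((measurable_mink_shellPoint m (l z.1)).comp (measurable_pi_apply (0 : Fin (k + 1)))).neg _ _ (fun p => ?_) _
  rw [mink_sum_right, ← neg_one_smul ℝ (l z.1), mink_smul_left, neg_one_mul]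
  rfl

/-- The operators `a(g) + a*(h)` can be deformed with the translations on all vectors of fixed
particle number. -/
theorem exists_hasWarpedValue_field {n : ℕ} {m : ℝ} (θ : Matrix (Fin (n + 1)) (Fin (n + 1)) ℝ)
    (g h : OneParticle n m) (k : ℕ) (ψ : symSub (shellMeasure n m) k) :
    ∃ Φ, HasWarpedValue θ (fockTranslation n m) (field (shellMeasure n m) g h)
      (lp.single 2 k ψ) Φ := by
  have hconj : ∀ x, sandwich (fockTranslation n m x) (field (shellMeasure n m) g h)
      (fockTranslation n m x).symm
      = field (shellMeasure n m) (translation n m x g) (translation n m x h) := fun x => by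
    rw [fockTranslation_symm]
    exact sandwich_field _ _ _ _
  have hsingle : ∀ y, fockTranslation n m y (lp.single 2 k ψ)
      = lp.single 2 k (symPow (shellMeasure n m) (translation n m y) k ψ) := fun y =>
    secondQuant_single _ _ _ _
  have hl : Continuous θ.toEuclideanLin := LinearMap.continuous_of_finiteDimensional _
  have hdom : ∀ x y, fockTranslation n m y (lp.single 2 k ψ) ∈
      (sandwich (fockTranslation n m (θ.toEuclideanLin x)) (field (shellMeasure n m) g h)
        (fockTranslation n m (θ.toEuclideanLin x)).symm).domain := fun x y => by
    rw [hconj, hsingle]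
    exact single_mem_finiteParticle _ _ _
  cases k with
  | zero =>
    -- Nothing is annihilated in the zero-particle sector: the second operator is `0` and its plane
    -- wave data are mere placeholders.
    refine ⟨_, hasWarpedValue_of_planeWaves hdom hl hl (measurable_shellPoint_eval m 0)
      (measurable_sum_shellPoint_tail m) (measurable_shellPoint_eval m 0)
      (measurable_sum_shellPoint_tail m)
      (((Real.sqrt ((0 : ℕ) + 1) : ℝ) : ℂ) • component (shellMeasure n m) 1) 0
      (leftTensor (shellMeasure n m) h 0 ψ) (leftTensor (shellMeasure n m) h 0 ψ) fun z => ?_⟩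
    rw [hconj, hsingle, evalAt_field_single_zero, zero_apply, add_zero]
    exact single_creation_translation θ.toEuclideanLin z h 0 ψ
  | succ k =>
    refine ⟨_, hasWarpedValue_of_planeWaves hdom hl (k := fun x => -θ.toEuclideanLin x) hl.neg
      (measurable_shellPoint_eval m 0) (measurable_sum_shellPoint_tail m)
      (measurable_shellPoint_eval m 0) (measurable_sum_shellPoint m)
      (((Real.sqrt ((k + 1 : ℕ) + 1) : ℝ) : ℂ) • component (shellMeasure n m) (k + 2))
      (((Real.sqrt (k + 1) : ℝ) : ℂ) • component (shellMeasure n m) k ∘L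
          ContinuousLinearMap.adjoint (leftTensor (shellMeasure n m) g k))
      (leftTensor (shellMeasure n m) h (k + 1) ψ) ψ fun z => ?_⟩
    rw [hconj, hsingle, evalAt_field_single_succ]
    congr 1
    · exact single_creation_translation θ.toEuclideanLin z h (k + 1) ψ
    · exact single_annihilation_translation θ.toEuclideanLin z g k ψ

theorem exists_eq_single_of_mem_deltaP {n : ℕ} {m : ℝ} {k : ℕ} {Ψ : FockSpace n m}
    (hΨ : Ψ ∈ deltaP n m k) :
    ∃ ψ : symSub (shellMeasure n m) k, Ψ = lp.single 2 k ψ := by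
  have h : deltaP n m k ≤ LinearMap.range
      (lp.lsingle (𝕜 := ℂ) (E := fun k : ℕ => symSub (shellMeasure n m) k) 2 k) := by
    refine Submodule.span_le.2 ?_
    rintro Φ ⟨h, _, rfl⟩
    exact ⟨_, rfl⟩
  obtain ⟨ψ, hψ⟩ := h hΨ
  exact ⟨ψ, hψ.symm⟩

end Fockspace

end

/-! ### Transport of the deformed field from the momentum picture by `Γ(V)`. -/

theorem mainTheorem7 (n : ℕ) (hn : 1 ≤ n) (m : ℝ) (hm : 0 < m)
    (θ : Matrix (Fin (n + 1)) (Fin (n + 1)) ℝ)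
    (hθ : ∀ x y, mink (θ.toEuclideanLin x) y = -mink x (θ.toEuclideanLin y))
    (V : OneParticle n m ≃ₗᵢ[ℂ] OneParticle n m)
    (f : 𝓢(EuclideanSpace ℝ (Fin (n + 1)), ℂ)) :
    -- the exponentials of the momentum operators and of the operators `X_μ` exist
    IsUnitaryExp (momentumOp n m) (unitaryExp (momentumOp n m)) ∧
    IsUnitaryExp (xOp V) (unitaryExp (xOp V)) ∧
    -- the field with transformed test function is the conjugate of the free field
    sandwich (secondQuant _ V) (freeField hm f) (secondQuant _ V.symm)
      = freeFieldTransformed hm V f ∧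
    ∀ (k : ℕ), ∀ Ψ ∈ deltaX V k,
      -- both deformed fields are well defined on the vectors in question
      (∃ Φ, HasWarpedValue θ (unitaryExp (xOp V)) (freeField hm f) Ψ Φ) ∧
      (∃ Φ, HasWarpedValue θ (unitaryExp (momentumOp n m)) (freeFieldTransformed hm V f)
        (secondQuant _ V Ψ) Φ) ∧
      -- and they are related by the unitary `Γ(V)`
      warped θ (unitaryExp (xOp V)) (freeField hm f) Ψ =
        secondQuant _ V.symm
          (warped θ (unitaryExp (momentumOp n m)) (freeFieldTransformed hm V f)
            (secondQuant _ V Ψ)) := by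
  refine ⟨isUnitaryExp_unitaryExp (isUnitaryExp_fockTranslation n m),
    isUnitaryExp_unitaryExp (isUnitaryExp_xOp V), sandwich_field _ V _ _, fun k Ψ hΨ => ?_⟩
  obtain ⟨Ξ, hΞ, rfl⟩ := Submodule.mem_map.1 hΨ
  obtain ⟨ψ, rfl⟩ := exists_eq_single_of_mem_deltaP hΞ
  have hback : secondQuant (shellMeasure n m) V (secondQuant (shellMeasure n m) V.symm
      (lp.single 2 k ψ)) = lp.single 2 k ψ := by
    rw [← secondQuant_symm, LinearIsometryEquiv.apply_symm_apply]
  -- Conjugation by `Γ(V⁻¹)` undoes the action of `V` on the one-particle vectors, which puts the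
  -- free field into the form required by `HasWarpedValue.conj`.
  have hfield : freeField hm f = sandwich (secondQuant (shellMeasure n m) V).symm
      (freeFieldTransformed hm V f) (secondQuant (shellMeasure n m) V) := by
    have h := sandwich_field (shellMeasure n m) V.symm (V (fMinusConj hm f)) (V (fPlus hm f))
    rw [V.symm_apply_apply, V.symm_apply_apply, V.symm_symm] at h
    rw [secondQuant_symm]
    exact h.symm
  obtain ⟨Φ, hΦ⟩ := exists_hasWarpedValue_field θ (V (fMinusConj hm f)) (V (fPlus hm f)) k ψ
  have hP : HasWarpedValue θ (unitaryExp (momentumOp n m)) (freeFieldTransformed hm V f)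
      (secondQuant (shellMeasure n m) V (secondQuant (shellMeasure n m) V.symm
        (lp.single 2 k ψ))) Φ := by
    rw [hback, unitaryExp_momentumOp hm]
    exact hΦ
  have hX : HasWarpedValue θ (unitaryExp (xOp V)) (freeField hm f)
      (secondQuant (shellMeasure n m) V.symm (lp.single 2 k ψ))
      (secondQuant (shellMeasure n m) V.symm Φ) := by
    rw [unitaryExp_momentumOp hm] at hP
    rw [unitaryExp_xOp hm, hfield]
    have h := hP.conj (secondQuant (shellMeasure n m) V)
    rwa [secondQuant_symm] at h ⊢
  refine ⟨⟨_, hX⟩, ⟨_, hP⟩, ?_⟩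
  refine hX.warped_eq.trans ?_
  exact (congrArg _ hP.warped_eq).symm
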